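/- Let $(\Omega,\mathcal A,\mathbb P)$ be an atomless probability space, that is, every $A\in\mathcal A$ with $\mathbb P(A)>0$ contains some $B\in\mathcal A$ with $0<\mathbb P(B)<\mathbb P(A)$. For $a<b$ let $\mathrm U[a,b]$ denote the uniform distribution on $[a,b]$. For $n\in\mathbb N$ let $\mathcal D_n^{\mathrm U}$ be the set of all distributions of sums $X_1+\cdots+X_n$, where $X_1,\dots,X_n$ are random variables on $(\Omega,\mathcal A,\mathbb P)$, each with distribution $\mathrm U[0,1]$ (and with arbitrary dependence). For $n\ge 1$ let $\mathcal C_n^{\mathrm U}$ be the set of all probability distributions $G$ on $\mathbb R$ with finite mean that are dominated by $\mathrm U[0,n]$ in convex order, i.e. such that $$\int_{\mathbb R}\phi\,\mathrm dG\le\frac1n\int_0^n\phi(x)\,\mathrm dx$$ for every convex $\phi:\mathbb R\to\mathbb R$ for which both integrals exist (as finite or infinite numbers). Then, for every $n\ge 3$, $$\mathcal D_n^{\mathrm U}=\mathcal C_n^{\mathrm U}.$$ -/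

import Mathlib

open MeasureTheory ProbabilityTheory
open scoped ENNReal

namespace UniformSums

/-- A measure is atomless if every measurable set of positive measure has a measurable subset
of strictly smaller, but still positive, measure. (This is the measure-theoretic notion; it is
stronger in general than the vanishing of the measure on singletons.) -/
def Atomless {Ω : Type*} [MeasurableSpace Ω] (P : Measure Ω) : Prop :=
  ∀ s : Set Ω, MeasurableSet s → 0 < P s → ∃ t ⊆ s, MeasurableSet t ∧ 0 < P t ∧ P t < P s

/-- The set of distributions on `ℝ` with finite mean. -/
def finiteMean : Set (Measure ℝ) :=
  {F | IsProbabilityMeasure F ∧ Integrable (fun x : ℝ => x) F}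

/-- The uniform distribution over the interval `[a, b]`, for `a < b`. -/
noncomputable def unif (a b : ℝ) : Measure ℝ :=
  ProbabilityTheory.cond volume (Set.Icc a b)

/-- The set of all distributions of `X 0 + ⋯ + X (n - 1)`, where the `X i` are random variables
on the probability space `(Ω, P)` with distributions `F i`. -/
def sumLaws {Ω : Type*} [MeasurableSpace Ω] (P : Measure Ω) {n : ℕ} (F : Fin n → Measure ℝ) :
    Set (Measure ℝ) :=
  {G | ∃ X : Fin n → Ω → ℝ, (∀ i, Measurable (X i)) ∧ (∀ i, P.map (X i) = F i) ∧
    P.map (fun ω => ∑ i, X i ω) = G}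

/-- The integral of `φ` with respect to `F` exists, as a finite or infinite number: the integrals
of the positive part and of the negative part are not both infinite. -/
def HasExpectation (F : Measure ℝ) (φ : ℝ → ℝ) : Prop :=
  ∫⁻ x, ENNReal.ofReal (φ x) ∂F ≠ ⊤ ∨ ∫⁻ x, ENNReal.ofReal (-φ x) ∂F ≠ ⊤

/-- The integral of `φ` with respect to `F`, as an extended real number: the integral of the
positive part minus that of the negative part. It is used only where it exists. -/
noncomputable def expectation (F : Measure ℝ) (φ : ℝ → ℝ) : EReal :=
  ((∫⁻ x, ENNReal.ofReal (φ x) ∂F : ℝ≥0∞) : EReal) -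
    ((∫⁻ x, ENNReal.ofReal (-φ x) ∂F : ℝ≥0∞) : EReal)

/-- `F` is smaller than `G` in convex order. -/
def ConvexOrderLE (F G : Measure ℝ) : Prop :=
  ∀ φ : ℝ → ℝ, ConvexOn ℝ Set.univ φ → HasExpectation F φ → HasExpectation G φ →
    expectation F φ ≤ expectation G φ

/-- The set of all distributions with finite mean that are dominated by `F` in convex order. -/
def dominated (F : Measure ℝ) : Set (Measure ℝ) :=
  {G | G ∈ finiteMean ∧ ConvexOrderLE G F}

/-- The set of all distributions of sums of `n` standard uniform random variables. -/
noncomputable def sumUnifLaws {Ω : Type*} [MeasurableSpace Ω] (P : Measure Ω) (n : ℕ) :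
    Set (Measure ℝ) :=
  sumLaws P (fun _ : Fin n => unif 0 1)

/-- The set of all distributions dominated in convex order by the uniform distribution
over `[0, x]`. -/
noncomputable def dominatedUnif (x : ℝ) : Set (Measure ℝ) :=
  dominated (unif 0 x)

end UniformSums

namespace UniformSums

/-- `G` is the law of the average of `n` coordinates whose marginal laws average to `ν`. The
measures are not normalised. -/
def MeanLaw (n : ℕ) (ν G : Measure ℝ) : Prop :=
  ∃ μ : Measure (Fin n → ℝ), ∑ i, μ.map (fun x => x i) = (n : ℝ≥0∞) • ν ∧
    μ.map (fun x => (∑ i, x i) / (n : ℝ)) = G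

lemma map_finset_sum {ι α β : Type*} [MeasurableSpace α] [MeasurableSpace β] {f : α → β}
    (hf : Measurable f) (s : Finset ι) (μ : ι → Measure α) :
    (∑ i ∈ s, μ i).map f = ∑ i ∈ s, (μ i).map f := by
  have := map_sum (Measure.mapₗ f) μ s
  simpa [Measure.mapₗ_apply_of_measurable hf] using this

lemma MeanLaw.of_map {Θ : Type*} [MeasurableSpace Θ] {n : ℕ} (m : Measure Θ) (φ : Fin n → Θ → ℝ)
    (hφ : ∀ i, Measurable (φ i)) {ν G : Measure ℝ} (hν : ∑ i, m.map (φ i) = (n : ℝ≥0∞) • ν)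
    (hG : m.map (fun θ => (∑ i, φ i θ) / (n : ℝ)) = G) : MeanLaw n ν G := by
  have h : Measurable fun θ i => φ i θ := measurable_pi_lambda _ hφ
  refine ⟨m.map fun θ i => φ i θ, ?_, ?_⟩
  · rw [← hν]
    exact Finset.sum_congr rfl fun i _ => Measure.map_map (measurable_pi_apply i) h
  · rw [← hG, Measure.map_map (by fun_prop) h]
    rfl

lemma MeanLaw.add {n : ℕ} {ν ν' G G' : Measure ℝ} (h : MeanLaw n ν G) (h' : MeanLaw n ν' G') :
    MeanLaw n (ν + ν') (G + G') := by
  obtain ⟨μ, h1, h2⟩ := h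
  obtain ⟨μ', h1', h2'⟩ := h'
  refine ⟨μ + μ', ?_, ?_⟩
  · simp only [smul_add, ← h1, ← h1', ← Finset.sum_add_distrib]
    exact Finset.sum_congr rfl fun i _ => Measure.map_add _ _ (measurable_pi_apply i)
  · rw [← h2, ← h2', Measure.map_add _ _ (by fun_prop)]

lemma MeanLaw.smul {n : ℕ} {ν G : Measure ℝ} (c : ℝ≥0∞) (h : MeanLaw n ν G) :
    MeanLaw n (c • ν) (c • G) := by
  obtain ⟨μ, h1, h2⟩ := h
  refine ⟨c • μ, ?_, ?_⟩
  · simp only [Measure.map_smul, ← Finset.smul_sum, h1, smul_smul, mul_comm]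
  · rw [← h2, Measure.map_smul]

lemma MeanLaw.affine {n : ℕ} (hn : n ≠ 0) {ν G : Measure ℝ} (s t : ℝ) (h : MeanLaw n ν G) :
    MeanLaw n (ν.map fun x => s * x + t) (G.map fun x => s * x + t) := by
  obtain ⟨μ, h1, h2⟩ := h
  have hm : Measurable fun x : ℝ => s * x + t := by fun_prop
  refine MeanLaw.of_map μ (fun i x => s * x i + t) (fun i => by fun_prop) ?_ ?_
  · rw [← Measure.map_smul, ← h1, map_finset_sum hm]
    exact Finset.sum_congr rfl fun i _ => (Measure.map_map hm (measurable_pi_apply i)).symm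
  · rw [← h2, Measure.map_map hm (by fun_prop)]
    congr 1
    ext x
    have : (n : ℝ) ≠ 0 := by exact_mod_cast hn
    simp only [Function.comp, Finset.sum_add_distrib, ← Finset.mul_sum]
    simp
    field_simp

lemma MeanLaw.univ_eq {n : ℕ} (hn : n ≠ 0) {ν G : Measure ℝ} (h : MeanLaw n ν G) :
    G Set.univ = ν Set.univ := by
  obtain ⟨μ, h1, h2⟩ := h
  have := congrArg (fun m : Measure ℝ => m Set.univ) h1
  simp only [Measure.coe_finsetSum, Finset.sum_apply, Measure.smul_apply, smul_eq_mul,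
    Measure.map_apply (measurable_pi_apply _) MeasurableSet.univ, Set.preimage_univ,
    Finset.sum_const, Finset.card_univ, Fintype.card_fin, nsmul_eq_mul] at this
  rw [← h2, Measure.map_apply (by fun_prop) MeasurableSet.univ, Set.preimage_univ]
  exact (ENNReal.mul_right_inj (by exact_mod_cast hn) (by simp)).1 this

lemma MeanLaw.integrable_apply {n : ℕ} {ν : Measure ℝ} {μ : Measure (Fin n → ℝ)}
    (h1 : ∑ i, μ.map (fun x => x i) = (n : ℝ≥0∞) • ν) (hν : Integrable (fun x : ℝ => x) ν)
    (i : Fin n) : Integrable (fun x => x i) μ := by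
  have h : Integrable (fun x : ℝ => x) (∑ i, μ.map (fun x => x i)) := by
    rw [h1]; exact hν.smul_measure (by simp)
  have h' : Integrable (fun x : ℝ => x) (μ.map (fun x => x i)) := by
    rw [integrable_finsetSum_measure] at h
    exact h i (Finset.mem_univ i)
  exact (integrable_map_measure measurable_id.aestronglyMeasurable (measurable_pi_apply i).aemeasurable).1 h'

lemma MeanLaw.integral_eq {n : ℕ} (hn : n ≠ 0) {ν G : Measure ℝ} (h : MeanLaw n ν G)
    (hν : Integrable (fun x : ℝ => x) ν) : ∫ x, x ∂G = ∫ x, x ∂ν := by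
  obtain ⟨μ, h1, h2⟩ := h
  have hi := MeanLaw.integrable_apply h1 hν
  have e : ∫ x, x ∂(∑ i, μ.map (fun x => x i)) = ∑ i, ∫ x, x i ∂μ := by
    rw [integral_finsetSum_measure]
    · exact Finset.sum_congr rfl fun i _ => integral_map (measurable_pi_apply i).aemeasurable (by fun_prop)
    · exact fun i _ => (integrable_map_measure measurable_id.aestronglyMeasurable (measurable_pi_apply i).aemeasurable).2 (hi i)
  have hn' : (n : ℝ) ≠ 0 := by exact_mod_cast hn
  rw [h1, integral_smul_measure] at e
  rw [← h2, integral_map (by fun_prop) (by fun_prop), integral_div, integral_finsetSum]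
  · rw [← e]; simp [hn']
  · exact fun i _ => hi i

section

/-- The stop-loss transform `∫ x in l..r, (x - k)⁺` of the Lebesgue measure on `[l, r]`. -/
noncomputable def stopLoss (l r k : ℝ) : ℝ := (max (r - k) 0 ^ 2 - max (l - k) 0 ^ 2) / 2

lemma stopLoss_nonneg {l r : ℝ} (h : l ≤ r) (k : ℝ) : 0 ≤ stopLoss l r k := by
  have h1 : max (l - k) 0 ≤ max (r - k) 0 := max_le_max (by linarith) le_rfl
  have h2 : 0 ≤ max (l - k) 0 := le_max_right _ _
  unfold stopLoss
  nlinarith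

lemma stopLoss_add (l m r k : ℝ) : stopLoss l m k + stopLoss m r k = stopLoss l r k := by
  unfold stopLoss; ring

lemma stopLoss_of_ge {l r k : ℝ} (h : l ≤ r) (hk : r ≤ k) : stopLoss l r k = 0 := by
  simp [stopLoss, max_eq_right (sub_nonpos.2 hk), max_eq_right (sub_nonpos.2 (h.trans hk))]

lemma stopLoss_of_le {l r k : ℝ} (h : l ≤ r) (hk : k ≤ l) :
    stopLoss l r k = (r ^ 2 - l ^ 2) / 2 - (r - l) * k := by
  rw [stopLoss, max_eq_left (sub_nonneg.2 hk), max_eq_left (sub_nonneg.2 (hk.trans h))]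
  ring

lemma stopLoss_of_mem {l r k : ℝ} (hl : l ≤ k) (hr : k ≤ r) : stopLoss l r k = (r - k) ^ 2 / 2 := by
  rw [stopLoss, max_eq_right (sub_nonpos.2 hl), max_eq_left (sub_nonneg.2 hr)]
  ring

lemma stopLoss_second_diff (l r k : ℝ) {ε : ℝ} (hε : 0 ≤ ε) :
    stopLoss l r (k + ε) + stopLoss l r (k - ε) - 2 * stopLoss l r k ≤ ε ^ 2 := by
  have key : ∀ x : ℝ, 0 ≤ max (x - ε) 0 ^ 2 + max (x + ε) 0 ^ 2 - 2 * max x 0 ^ 2 ∧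
      max (x - ε) 0 ^ 2 + max (x + ε) 0 ^ 2 - 2 * max x 0 ^ 2 ≤ 2 * ε ^ 2 := by
    intro x
    rcases max_cases (x - ε) 0 with ⟨h1, h1'⟩ | ⟨h1, h1'⟩ <;>
    rcases max_cases (x + ε) 0 with ⟨h2, h2'⟩ | ⟨h2, h2'⟩ <;>
    rcases max_cases x 0 with ⟨h3, h3'⟩ | ⟨h3, h3'⟩ <;>
    rw [h1, h2, h3] <;> constructor <;> nlinarith
  have h1 := (key (r - k)).2
  have h2 := (key (l - k)).1
  unfold stopLoss
  rw [show r - (k + ε) = r - k - ε by ring, show r - (k - ε) = r - k + ε by ring,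
    show l - (k + ε) = l - k - ε by ring, show l - (k - ε) = l - k + ε by ring]
  linarith

lemma continuous_stopLoss (l r : ℝ) : Continuous (stopLoss l r) := by
  unfold stopLoss; fun_prop

/-- The weights `p` on the finite set `s` define a measure that is dominated in convex order by the
Lebesgue measure on `[l, r]`. -/
structure DiscreteDom (l r : ℝ) (s : Finset ℝ) (p : ℝ → ℝ) : Prop where
  nonneg : ∀ y ∈ s, 0 ≤ p y
  mass : ∑ y ∈ s, p y = r - l
  mean : ∑ y ∈ s, p y * y = (r ^ 2 - l ^ 2) / 2
  loss : ∀ k, ∑ y ∈ s, p y * max (y - k) 0 ≤ stopLoss l r k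

/-- The finitely supported measure with weights `p` on `s`. -/
noncomputable def discreteMeasure (s : Finset ℝ) (p : ℝ → ℝ) : Measure ℝ :=
  ∑ y ∈ s, ENNReal.ofReal (p y) • Measure.dirac y

variable {l r : ℝ} {s : Finset ℝ} {p : ℝ → ℝ}

lemma DiscreteDom.erase (h : DiscreteDom l r s p) {y : ℝ} (hp : p y = 0) :
    DiscreteDom l r (s.erase y) p where
  nonneg z hz := h.nonneg z (Finset.mem_of_mem_erase hz)
  mass := by rw [← h.mass]; exact Finset.sum_erase _ hp
  mean := by rw [← h.mean]; exact Finset.sum_erase _ (by simp [hp])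
  loss k := by
    have e : ∑ z ∈ s.erase y, p z * max (z - k) 0 = ∑ z ∈ s, p z * max (z - k) 0 :=
      Finset.sum_erase _ (by simp [hp])
    exact e.trans_le (h.loss k)

lemma discreteMeasure_erase {y : ℝ} (hp : p y = 0) :
    discreteMeasure (s.erase y) p = discreteMeasure s p :=
  Finset.sum_erase _ (by simp [hp])

/-- An atom is not a contact point of the stop-loss transforms. -/
lemma DiscreteDom.lt_of_pos (h : DiscreteDom l r s p) {x : ℝ} (hx : x ∈ s)
    (hp : 0 < p x) : ∑ y ∈ s, p y * max (y - x) 0 < stopLoss l r x := by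
  refine lt_of_le_of_ne (h.loss x) fun he => ?_
  set ε := p x / 2
  have hε : 0 < ε := by positivity
  have h1 := h.loss (x + ε)
  have h2 := h.loss (x - ε)
  have h3 := stopLoss_second_diff l r x hε.le
  have key : p x * ε ≤ ∑ y ∈ s, p y * (max (y - (x + ε)) 0 + max (y - (x - ε)) 0
      - 2 * max (y - x) 0) := by
    have : p x * (max (x - (x + ε)) 0 + max (x - (x - ε)) 0 - 2 * max (x - x) 0) = p x * ε := by
      rw [max_eq_right (by linarith), max_eq_left (by linarith), max_eq_right (by linarith)]
      ring
    rw [← this]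
    refine Finset.single_le_sum (f := fun y => p y * (max (y - (x + ε)) 0 + max (y - (x - ε)) 0
      - 2 * max (y - x) 0)) (fun y hy => mul_nonneg (h.nonneg y hy) ?_) hx
    rcases max_cases (y - (x + ε)) 0 with h1 | h1 <;>
    rcases max_cases (y - (x - ε)) 0 with h2 | h2 <;>
    rcases max_cases (y - x) 0 with h3 | h3 <;> linarith
  simp only [mul_add, mul_sub, Finset.sum_add_distrib, Finset.sum_sub_distrib] at key
  have e2 : ∑ y ∈ s, p y * (2 * max (y - x) 0) = 2 * ∑ y ∈ s, p y * max (y - x) 0 := by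
    rw [Finset.mul_sum]; exact Finset.sum_congr rfl fun _ _ => by ring
  rw [e2] at key
  have : p x = 2 * ε := by simp only [ε]; ring
  nlinarith

lemma DiscreteDom.sum_sub (h : DiscreteDom l r s p) (k : ℝ) :
    ∑ y ∈ s, p y * (y - k) = (r ^ 2 - l ^ 2) / 2 - (r - l) * k := by
  simp only [mul_sub, Finset.sum_sub_distrib, ← Finset.sum_mul, h.mass, h.mean]

lemma DiscreteDom.mem_Ioo (h : DiscreteDom l r s p) (hlr : l ≤ r) {x : ℝ} (hx : x ∈ s)
    (hp : 0 < p x) : x ∈ Set.Ioo l r := by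
  have h1 := h.lt_of_pos hx hp
  have h0 : 0 ≤ ∑ y ∈ s, p y * max (y - x) 0 :=
    Finset.sum_nonneg fun y hy => mul_nonneg (h.nonneg y hy) (le_max_right _ _)
  refine ⟨?_, ?_⟩ <;> by_contra! hc
  · rw [stopLoss_of_le hlr hc, ← h.sum_sub x] at h1
    refine h1.not_ge (Finset.sum_le_sum fun y hy => ?_)
    exact mul_le_mul_of_nonneg_left (le_max_left _ _) (h.nonneg y hy)
  · rw [stopLoss_of_ge hlr hc] at h1
    linarith

/-- At a contact point `k`, the mass to the right of `k` is `r - k`. -/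
lemma DiscreteDom.mass_right (h : DiscreteDom l r s p) {k : ℝ} (hl : l < k) (hr : k < r)
    (hc : ∑ y ∈ s, p y * max (y - k) 0 = stopLoss l r k) :
    ∑ y ∈ s with k < y, p y = r - k := by
  set m := ∑ y ∈ s with k < y, p y
  have hsplit : ∀ ε : ℝ, -(k - l) < ε → ε < r - k →
      stopLoss l r k - ε * m ≤ (r - k - ε) ^ 2 / 2 := by
    intro ε h1 h2
    have h3 := h.loss (k + ε)
    rw [stopLoss_of_mem (by linarith) (by linarith)] at h3
    have h4 : stopLoss l r k = ∑ y ∈ s with k < y, p y * (y - k) := by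
      rw [← hc, Finset.sum_filter]
      refine Finset.sum_congr rfl fun y _ => ?_
      split_ifs with hy
      · rw [max_eq_left (by linarith)]
      · rw [max_eq_right (by linarith), mul_zero]
    have h5 : stopLoss l r k - ε * m = ∑ y ∈ s with k < y, p y * (y - (k + ε)) := by
      rw [h4, Finset.mul_sum, ← Finset.sum_sub_distrib]
      exact Finset.sum_congr rfl fun _ _ => by ring
    have h6 : ∑ y ∈ s with k < y, p y * (y - (k + ε)) ≤ ∑ y ∈ s, p y * max (y - (k + ε)) 0 := by
      refine (Finset.sum_le_sum fun y hy => mul_le_mul_of_nonneg_left (le_max_left _ 0)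
        (h.nonneg y (Finset.mem_of_mem_filter y hy))).trans ?_
      exact Finset.sum_le_sum_of_subset_of_nonneg (Finset.filter_subset _ _)
        fun y hy _ => mul_nonneg (h.nonneg y hy) (le_max_right _ _)
    rw [h5]
    refine (h6.trans h3).trans_eq ?_
    ring
  rw [stopLoss_of_mem hl.le hr.le] at hsplit
  by_contra hne
  rcases lt_or_gt_of_ne hne with hlt | hgt
  · set ε := min (r - k - m) ((r - k) / 2)
    have h1 : 0 < ε := lt_min (by linarith) (by linarith)
    have h2 : ε ≤ r - k - m := min_le_left _ _
    have h3 : ε ≤ (r - k) / 2 := min_le_right _ _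
    have := hsplit ε (by linarith) (by linarith)
    nlinarith
  · set ε := min (m - (r - k)) ((k - l) / 2)
    have h1 : 0 < ε := lt_min (by linarith) (by linarith)
    have h2 : ε ≤ m - (r - k) := min_le_left _ _
    have h3 : ε ≤ (k - l) / 2 := min_le_right _ _
    have := hsplit (-ε) (by linarith) (by linarith)
    nlinarith

lemma sum_eq_filter_add (s : Finset ℝ) (f : ℝ → ℝ) (k : ℝ) (hk : k ∈ s → f k = 0) :
    ∑ y ∈ s, f y = ∑ y ∈ s with y < k, f y + ∑ y ∈ s with k < y, f y := by
  rw [Finset.sum_filter, Finset.sum_filter, ← Finset.sum_add_distrib]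
  refine Finset.sum_congr rfl fun y hy => ?_
  rcases lt_trichotomy y k with h | rfl | h
  · simp [h, h.le]
  · simp [hk hy]
  · simp [h, h.le]

/-- A contact point splits a discrete measure into two dominated pieces. -/
lemma DiscreteDom.split (h : DiscreteDom l r s p) {k : ℝ} (hl : l < k) (hr : k < r)
    (hc : ∑ y ∈ s, p y * max (y - k) 0 = stopLoss l r k) :
    (k ∈ s → p k = 0) ∧ DiscreteDom l k (s.filter (· < k)) p ∧
      DiscreteDom k r (s.filter (k < ·)) p := by
  have hk : k ∈ s → p k = 0 := fun hks => by
    by_contra hne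
    exact (h.lt_of_pos hks (lt_of_le_of_ne (h.nonneg k hks) (Ne.symm hne))).ne hc
  have m2 := h.mass_right hl hr hc
  have m1 := sum_eq_filter_add s p k hk
  rw [h.mass, m2] at m1
  have e2 : ∑ y ∈ s with k < y, p y * (y - k) = (r - k) ^ 2 / 2 := by
    rw [← stopLoss_of_mem hl.le hr.le, ← hc, Finset.sum_filter]
    refine Finset.sum_congr rfl fun y _ => ?_
    split_ifs with hy
    · rw [max_eq_left (by linarith)]
    · rw [max_eq_right (by linarith), mul_zero]
  have f2 : ∑ y ∈ s with k < y, p y * y = (r ^ 2 - k ^ 2) / 2 := by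
    simp only [mul_sub, Finset.sum_sub_distrib, ← Finset.sum_mul, m2] at e2
    linarith
  have f1 := sum_eq_filter_add s (fun y => p y * y) k fun hks => by simp [hk hks]
  simp only [h.mean, f2] at f1
  have n2 : ∀ y ∈ s.filter (k < ·), 0 ≤ p y := fun y hy =>
    h.nonneg y (Finset.mem_of_mem_filter y hy)
  have t2 : ∀ k' ≤ k, ∑ y ∈ s with k < y, p y * max (y - k') 0 = stopLoss k r k' := by
    intro k' hk'
    rw [stopLoss_of_le hr.le hk', ← f2, ← m2, Finset.sum_mul, ← Finset.sum_sub_distrib]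
    refine Finset.sum_congr rfl fun y hy => ?_
    rw [max_eq_left (by linarith [(Finset.mem_filter.1 hy).2])]
    ring
  refine ⟨hk, ⟨fun y hy => h.nonneg y (Finset.mem_of_mem_filter y hy), by linarith, by linarith,
    fun k' => ?_⟩, ⟨n2, m2, f2, fun k' => ?_⟩⟩
  · rcases le_total k k' with hk' | hk'
    · refine le_trans (le_of_eq ?_) (stopLoss_nonneg hl.le k')
      refine Finset.sum_eq_zero fun y hy => ?_
      rw [max_eq_right (by linarith [(Finset.mem_filter.1 hy).2]), mul_zero]
    · have := sum_eq_filter_add s (fun y => p y * max (y - k') 0) k fun hks => by simp [hk hks]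
      rw [t2 k' hk'] at this
      linarith [h.loss k', stopLoss_add l k r k']
  · rcases le_total k k' with hk' | hk'
    · have := stopLoss_add l k r k'
      rw [stopLoss_of_ge hl.le hk', zero_add] at this
      rw [this]
      refine le_trans ?_ (h.loss k')
      exact Finset.sum_le_sum_of_subset_of_nonneg (Finset.filter_subset _ _)
        fun y hy _ => mul_nonneg (h.nonneg y hy) (le_max_right _ _)
    · exact (t2 k' hk').le

end

section

/-- The direction in which mass at `x₂` is spread to `x₁` and `x₃`, preserving mass and mean. -/
noncomputable def spread (x₁ x₂ x₃ y : ℝ) : ℝ :=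
  (if y = x₁ then x₃ - x₂ else 0) - (if y = x₂ then x₃ - x₁ else 0) +
    (if y = x₃ then x₂ - x₁ else 0)

lemma sum_spread {s : Finset ℝ} {x₁ x₂ x₃ : ℝ} (h₁ : x₁ ∈ s) (h₂ : x₂ ∈ s) (h₃ : x₃ ∈ s)
    (f : ℝ → ℝ) : ∑ y ∈ s, spread x₁ x₂ x₃ y * f y =
      (x₃ - x₂) * f x₁ - (x₃ - x₁) * f x₂ + (x₂ - x₁) * f x₃ := by
  simp [spread, add_mul, sub_mul, Finset.sum_add_distrib, Finset.sum_sub_distrib, h₁, h₂, h₃]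

lemma tent_nonneg {x₁ x₂ x₃ : ℝ} (h : x₁ < x₂) (h' : x₂ < x₃) (k : ℝ) :
    0 ≤ (x₃ - x₂) * max (x₁ - k) 0 - (x₃ - x₁) * max (x₂ - k) 0 + (x₂ - x₁) * max (x₃ - k) 0 := by
  rcases max_cases (x₁ - k) 0 with ⟨h1, h1'⟩ | ⟨h1, h1'⟩ <;>
  rcases max_cases (x₂ - k) 0 with ⟨h2, h2'⟩ | ⟨h2, h2'⟩ <;>
  rcases max_cases (x₃ - k) 0 with ⟨h3, h3'⟩ | ⟨h3, h3'⟩ <;>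
  rw [h1, h2, h3] <;> nlinarith

lemma tent_eq_zero {x₁ x₂ x₃ : ℝ} (h : x₁ < x₂) (h' : x₂ < x₃) {k : ℝ}
    (hk : k ∉ Set.Icc x₁ x₃) :
    (x₃ - x₂) * max (x₁ - k) 0 - (x₃ - x₁) * max (x₂ - k) 0 + (x₂ - x₁) * max (x₃ - k) 0 = 0 := by
  rcases lt_or_ge k x₁ with h1 | h1
  · rw [max_eq_left (by linarith), max_eq_left (by linarith), max_eq_left (by linarith)]
    ring
  · have : x₃ < k := by by_contra! hc; exact hk ⟨h1, hc⟩
    rw [max_eq_right (by linarith), max_eq_right (by linarith), max_eq_right (by linarith)]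
    ring

variable {l r : ℝ} {s : Finset ℝ} {p : ℝ → ℝ} {x₁ x₂ x₃ : ℝ}

lemma DiscreteDom.add_spread (h : DiscreteDom l r s p) (h₁ : x₁ ∈ s) (h₂ : x₂ ∈ s) (h₃ : x₃ ∈ s)
    {t : ℝ} (ht : ∀ y ∈ s, 0 ≤ p y + t * spread x₁ x₂ x₃ y)
    (hs : ∀ k, ∑ y ∈ s, p y * max (y - k) 0 + t * ((x₃ - x₂) * max (x₁ - k) 0
      - (x₃ - x₁) * max (x₂ - k) 0 + (x₂ - x₁) * max (x₃ - k) 0) ≤ stopLoss l r k) :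
    DiscreteDom l r s fun y => p y + t * spread x₁ x₂ x₃ y := by
  have e : ∀ f : ℝ → ℝ, ∑ y ∈ s, (p y + t * spread x₁ x₂ x₃ y) * f y = ∑ y ∈ s, p y * f y +
      t * ((x₃ - x₂) * f x₁ - (x₃ - x₁) * f x₂ + (x₂ - x₁) * f x₃) := by
    intro f
    rw [← sum_spread h₁ h₂ h₃ f, Finset.mul_sum, ← Finset.sum_add_distrib]
    exact Finset.sum_congr rfl fun _ _ => by ring
  refine ⟨ht, ?_, ?_, fun k => ?_⟩
  · have := e fun _ => 1
    simp only [mul_one] at this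
    rw [this, h.mass]
    ring
  · rw [e fun y => y, h.mean]
    ring
  · exact (e fun y => max (y - k) 0).trans_le (hs k)

lemma spread_nonneg_of_ne (h : x₁ < x₂) (h' : x₂ < x₃) {y : ℝ} (hy : y ≠ x₂) :
    0 ≤ spread x₁ x₂ x₃ y := by
  unfold spread
  rw [if_neg hy]
  split_ifs <;> linarith

lemma spread_two (h : x₁ < x₂) (h' : x₂ < x₃) : spread x₁ x₂ x₃ x₂ = -(x₃ - x₁) := by
  simp [spread, h.ne', h'.ne]

lemma spread_one (h : x₁ < x₂) (h' : x₂ < x₃) : spread x₁ x₂ x₃ x₁ = x₃ - x₂ := by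
  simp [spread, h.ne, (h.trans h').ne]

lemma spread_three (h : x₁ < x₂) (h' : x₂ < x₃) : spread x₁ x₂ x₃ x₃ = x₂ - x₁ := by
  simp [spread, h'.ne', (h.trans h').ne']

lemma spread_of_ne {y : ℝ} (h1 : y ≠ x₁) (h2 : y ≠ x₂) (h3 : y ≠ x₃) :
    spread x₁ x₂ x₃ y = 0 := by
  simp [spread, h1, h2, h3]

/-- Mass can be contracted towards `x₂` until an outer atom disappears. -/
lemma DiscreteDom.exists_contract (h : DiscreteDom l r s p) (hpos : ∀ y ∈ s, 0 < p y)
    (h₁ : x₁ ∈ s) (h₂ : x₂ ∈ s) (h₃ : x₃ ∈ s) (h12 : x₁ < x₂) (h23 : x₂ < x₃) :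
    ∃ t > 0, DiscreteDom l r s (fun y => p y - t * spread x₁ x₂ x₃ y) ∧
      ∃ y ∈ s, p y - t * spread x₁ x₂ x₃ y = 0 := by
  have d1 : 0 < x₃ - x₂ := by linarith
  have d3 : 0 < x₂ - x₁ := by linarith
  set t := min (p x₁ / (x₃ - x₂)) (p x₃ / (x₂ - x₁)) with ht
  have ht0 : 0 < t := lt_min (div_pos (hpos _ h₁) d1) (div_pos (hpos _ h₃) d3)
  have ht1 : t * (x₃ - x₂) ≤ p x₁ := (le_div_iff₀ d1).1 (min_le_left _ _)
  have ht3 : t * (x₂ - x₁) ≤ p x₃ := (le_div_iff₀ d3).1 (min_le_right _ _)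
  refine ⟨t, ht0, ?_, ?_⟩
  · have := h.add_spread h₁ h₂ h₃ (t := -t) ?_ fun k => ?_
    · simpa only [neg_mul, ← sub_eq_add_neg] using this
    · intro y hy
      by_cases e1 : y = x₁
      · rw [e1, spread_one h12 h23]; linarith
      by_cases e3 : y = x₃
      · rw [e3, spread_three h12 h23]; linarith
      by_cases e2 : y = x₂
      · rw [e2, spread_two h12 h23]
        have := (hpos _ h₂).le
        nlinarith
      · rw [spread_of_ne e1 e2 e3]
        linarith [hpos y hy]
    · have := tent_nonneg h12 h23 k
      have := h.loss k
      nlinarith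
  · rcases min_choice (p x₁ / (x₃ - x₂)) (p x₃ / (x₂ - x₁)) with hc | hc
    · refine ⟨x₁, h₁, ?_⟩
      rw [spread_one h12 h23, ht, hc]
      field_simp
      ring
    · refine ⟨x₃, h₃, ?_⟩
      rw [spread_three h12 h23, ht, hc]
      field_simp
      ring

/-- Mass can be spread from `x₂` until the atom disappears or a contact occurs. -/
lemma DiscreteDom.exists_spread (h : DiscreteDom l r s p) (hlr : l ≤ r)
    (hpos : ∀ y ∈ s, 0 < p y) (h₁ : x₁ ∈ s) (h₂ : x₂ ∈ s) (h₃ : x₃ ∈ s) (h12 : x₁ < x₂)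
    (h23 : x₂ < x₃) :
    ∃ t ≥ 0, DiscreteDom l r s (fun y => p y + t * spread x₁ x₂ x₃ y) ∧
      ((∃ y ∈ s, p y + t * spread x₁ x₂ x₃ y = 0) ∨ ∃ k ∈ Set.Ioo l r,
        ∑ y ∈ s, (p y + t * spread x₁ x₂ x₃ y) * max (y - k) 0 = stopLoss l r k) := by
  have d2 : 0 < x₃ - x₁ := by linarith
  set T := p x₂ / (x₃ - x₁) with hT
  have hTpos : 0 < T := div_pos (hpos _ h₂) d2
  set tent : ℝ → ℝ := fun k => (x₃ - x₂) * max (x₁ - k) 0 - (x₃ - x₁) * max (x₂ - k) 0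
    + (x₂ - x₁) * max (x₃ - k) 0 with htent
  set u : ℝ → ℝ := fun k => ∑ y ∈ s, p y * max (y - k) 0 with hu
  set K : Set ℝ := Set.Icc 0 T ∩ ⋂ k, {t | u k + t * tent k ≤ stopLoss l r k} with hK
  have hKc : IsCompact K := isCompact_Icc.inter_right <| isClosed_iInter fun k =>
    isClosed_le (by fun_prop) (by fun_prop)
  have hK0 : (0 : ℝ) ∈ K := ⟨⟨le_rfl, hTpos.le⟩, Set.mem_iInter.2 fun k => by
    simpa using h.loss k⟩
  obtain ⟨t, ⟨⟨ht0, htT⟩, htK⟩, htmax⟩ := hKc.exists_isGreatest ⟨0, hK0⟩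
  have htK' : ∀ k, u k + t * tent k ≤ stopLoss l r k := fun k => Set.mem_iInter.1 htK k
  have hnn : ∀ y ∈ s, 0 ≤ p y + t * spread x₁ x₂ x₃ y := by
    intro y hy
    by_cases e2 : y = x₂
    · rw [e2, spread_two h12 h23]
      have := (le_div_iff₀ d2).1 htT
      linarith
    · have := mul_nonneg ht0 (spread_nonneg_of_ne h12 h23 e2)
      linarith [hpos y hy]
  have hD := h.add_spread h₁ h₂ h₃ hnn htK'
  refine ⟨t, ht0, hD, ?_⟩
  rcases htT.eq_or_lt with rfl | hlt
  · left
    refine ⟨x₂, h₂, ?_⟩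
    rw [spread_two h12 h23, hT]
    field_simp
    ring
  right
  by_contra! hno
  have hq : ∀ y ≠ x₂, y ∈ s → y ∈ Set.Ioo l r := fun y hy hys => hD.mem_Ioo hlr hys (by
    have := mul_nonneg ht0 (spread_nonneg_of_ne h12 h23 hy)
    linarith [hpos y hys])
  have hgap : ∀ k, ∑ y ∈ s, (p y + t * spread x₁ x₂ x₃ y) * max (y - k) 0 = u k + t * tent k := by
    intro k
    simp only [htent, hu]
    rw [← sum_spread h₁ h₂ h₃ fun y => max (y - k) 0, Finset.mul_sum, ← Finset.sum_add_distrib]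
    exact Finset.sum_congr rfl fun _ _ => by ring
  obtain ⟨k₀, hk₀, hmin⟩ := (isCompact_Icc (a := x₁) (b := x₃)).exists_isMinOn
    ⟨x₁, le_rfl, by linarith⟩ (f := fun k => stopLoss l r k - (u k + t * tent k))
    (by
      have := continuous_stopLoss l r
      have : Continuous u := by fun_prop
      have : Continuous tent := by fun_prop
      fun_prop)
  set δ := stopLoss l r k₀ - (u k₀ + t * tent k₀) with hδ
  have hδ0 : 0 < δ := by
    have h1 : l < k₀ := (hq x₁ h12.ne h₁).1.trans_le hk₀.1
    have h3 : k₀ < r := hk₀.2.trans_lt (hq x₃ h23.ne' h₃).2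
    have := hno k₀ ⟨h1, h3⟩
    rw [hgap] at this
    exact sub_pos.2 (lt_of_le_of_ne (htK' k₀) this)
  have hM : 0 < (x₂ - x₁) * (x₃ - x₁) := mul_pos (by linarith) d2
  set η := min (T - t) (δ / ((x₂ - x₁) * (x₃ - x₁)))
  have hη : 0 < η := lt_min (by linarith) (div_pos hδ0 hM)
  have hη1 : η ≤ T - t := min_le_left _ _
  have hη2 : η * ((x₂ - x₁) * (x₃ - x₁)) ≤ δ := (le_div_iff₀ hM).1 (min_le_right _ _)
  have : t + η ∈ K := by
    refine ⟨⟨by linarith, by linarith⟩, Set.mem_iInter.2 fun k => ?_⟩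
    change u k + (t + η) * tent k ≤ stopLoss l r k
    by_cases hk : k ∈ Set.Icc x₁ x₃
    · have h1 : δ ≤ stopLoss l r k - (u k + t * tent k) := hmin hk
      have h2 : tent k ≤ (x₂ - x₁) * (x₃ - x₁) := by
        simp only [htent]
        rw [max_eq_right (by linarith [hk.1]), max_eq_left (a := x₃ - k) (by linarith [hk.2])]
        have := mul_nonneg d2.le (le_max_right (x₂ - k) 0)
        nlinarith [hk.1]
      nlinarith
    · have h0 : tent k = 0 := tent_eq_zero h12 h23 hk
      have := h.loss k
      rw [h0, mul_zero, add_zero]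
      exact this
  linarith [htmax this]

/-- The two-point laws dominated in convex order by the Lebesgue measure on an interval are laws
of averages. -/
def TwoPoint (n : ℕ) : Prop :=
  ∀ l r y z a b : ℝ, l ≤ r → 0 ≤ a → 0 ≤ b → a + b = r - l → a * y + b * z = (r ^ 2 - l ^ 2) / 2 →
    y ≤ z → z - y ≤ (r - l) / 2 →
    MeanLaw n (volume.restrict (Set.Icc l r))
      (ENNReal.ofReal a • Measure.dirac y + ENNReal.ofReal b • Measure.dirac z)

lemma restrict_Icc_add {l m r : ℝ} (h : l ≤ m) (h' : m ≤ r) :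
    volume.restrict (Set.Icc l m) + volume.restrict (Set.Icc m r) =
      (volume.restrict (Set.Icc l r) : Measure ℝ) := by
  rw [← restrict_Ioc_eq_restrict_Icc (a := m),
    ← Measure.restrict_union (Set.disjoint_left.2 fun x hx hx' => hx'.1.not_ge hx.2)
      measurableSet_Ioc, Set.Icc_union_Ioc_eq_Icc h h']

theorem DiscreteDom.meanLaw {n : ℕ} (H : TwoPoint n) (N : ℕ) : ∀ (l r : ℝ) (s : Finset ℝ)
    (p : ℝ → ℝ), l ≤ r → s.card ≤ N → DiscreteDom l r s p →
    MeanLaw n (volume.restrict (Set.Icc l r)) (discreteMeasure s p) := by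
  induction N with
  | zero =>
    intro l r s p hlr hs h
    have hs : s = ∅ := Finset.card_eq_zero.1 (Nat.le_zero.1 hs)
    have hm := h.mass
    rw [hs, Finset.sum_empty] at hm
    have : r = l := by linarith
    simpa [hs, discreteMeasure] using H l r l l 0 0 hlr le_rfl le_rfl (by simpa using hm)
      (by rw [this]; ring) le_rfl (by linarith)
  | succ N ih =>
    intro l r s p hlr hs h
    have of_zero : ∀ q : ℝ → ℝ, DiscreteDom l r s q → (∃ y ∈ s, q y = 0) →
        MeanLaw n (volume.restrict (Set.Icc l r)) (discreteMeasure s q) := by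
      rintro q hq ⟨y, hys, hy⟩
      rw [← discreteMeasure_erase hy]
      refine ih l r _ q hlr ?_ (hq.erase hy)
      rw [Finset.card_erase_of_mem hys]
      omega
    have of_contact : ∀ q : ℝ → ℝ, DiscreteDom l r s q → (∃ k ∈ Set.Ioo l r,
        ∑ y ∈ s, q y * max (y - k) 0 = stopLoss l r k) →
        MeanLaw n (volume.restrict (Set.Icc l r)) (discreteMeasure s q) := by
      rintro q hq ⟨k, ⟨hlk, hkr⟩, hk⟩
      obtain ⟨h0, hL, hR⟩ := hq.split hlk hkr hk
      have e : discreteMeasure s q = discreteMeasure (s.filter (· < k)) q +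
          discreteMeasure (s.filter (k < ·)) q := by
        simp only [discreteMeasure, Finset.sum_filter, ← Finset.sum_add_distrib]
        refine Finset.sum_congr rfl fun y hy => ?_
        rcases lt_trichotomy y k with hyk | rfl | hyk
        · rw [if_pos hyk, if_neg hyk.not_gt, add_zero]
        · simp [h0 hy]
        · rw [if_pos hyk, if_neg hyk.not_gt, zero_add]
      have c : (s.filter (· < k)).card + (s.filter (k < ·)).card ≤ s.card := by
        rw [← Finset.card_union_of_disjoint
          (Finset.disjoint_filter.2 fun y _ h1 h2 => h1.not_gt h2)]
        exact Finset.card_le_card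
          (Finset.union_subset (Finset.filter_subset _ _) (Finset.filter_subset _ _))
      have cL : 0 < (s.filter (· < k)).card := by
        rw [Finset.card_pos, Finset.nonempty_iff_ne_empty]
        intro he
        have := hL.mass
        rw [he, Finset.sum_empty] at this
        linarith
      have cR : 0 < (s.filter (k < ·)).card := by
        rw [Finset.card_pos, Finset.nonempty_iff_ne_empty]
        intro he
        have := hR.mass
        rw [he, Finset.sum_empty] at this
        linarith
      rw [e, ← restrict_Icc_add hlk.le hkr.le]
      exact (ih l k _ q hlk.le (by omega) hL).add (ih k r _ q hkr.le (by omega) hR)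
    by_cases hz : ∃ y ∈ s, p y = 0
    · exact of_zero p h hz
    have hpos : ∀ y ∈ s, 0 < p y := fun y hy =>
      lt_of_le_of_ne (h.nonneg y hy) fun hc => hz ⟨y, hy, hc.symm⟩
    by_cases hcard : 2 < s.card
    · obtain ⟨a, ha, b, hb, c, hc, hab, hac, hbc⟩ := Finset.two_lt_card.1 hcard
      obtain ⟨x₁, h₁, x₂, h₂, x₃, h₃, h12, h23⟩ : ∃ x₁ ∈ s, ∃ x₂ ∈ s, ∃ x₃ ∈ s,
          x₁ < x₂ ∧ x₂ < x₃ := by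
        rcases lt_or_gt_of_ne hab with h1 | h1 <;> rcases lt_or_gt_of_ne hac with h2 | h2 <;>
          rcases lt_or_gt_of_ne hbc with h3 | h3
        · exact ⟨a, ha, b, hb, c, hc, h1, h3⟩
        · exact ⟨a, ha, c, hc, b, hb, h2, h3⟩
        · linarith
        · exact ⟨c, hc, a, ha, b, hb, h2, h1⟩
        · exact ⟨b, hb, a, ha, c, hc, h1, h2⟩
        · linarith
        · exact ⟨b, hb, c, hc, a, ha, h3, h2⟩
        · exact ⟨c, hc, b, hb, a, ha, h3, h1⟩
      obtain ⟨t, ht, hD, hcase⟩ := h.exists_spread hlr hpos h₁ h₂ h₃ h12 h23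
      obtain ⟨t', ht', hD', hcase'⟩ := h.exists_contract hpos h₁ h₂ h₃ h12 h23
      have m1 : MeanLaw n (volume.restrict (Set.Icc l r))
          (discreteMeasure s fun y => p y + t * spread x₁ x₂ x₃ y) :=
        hcase.elim (of_zero _ hD) (of_contact _ hD)
      have m2 := of_zero _ hD' hcase'
      have hsum : 0 < t + t' := by linarith
      have key := (m1.smul (ENNReal.ofReal (t' / (t + t')))).add
        (m2.smul (ENNReal.ofReal (t / (t + t'))))
      have hw1 : 0 ≤ t' / (t + t') := by positivity
      have hw2 : 0 ≤ t / (t + t') := by positivity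
      rw [← add_smul, ← ENNReal.ofReal_add hw1 hw2,
        show t' / (t + t') + t / (t + t') = 1 by field_simp; ring, ENNReal.ofReal_one,
        one_smul] at key
      convert key using 1
      simp only [discreteMeasure, Finset.smul_sum, smul_smul, ← Finset.sum_add_distrib,
        ← add_smul]
      refine Finset.sum_congr rfl fun y hy => ?_
      have n1 : 0 ≤ p y + t * spread x₁ x₂ x₃ y := hD.nonneg y hy
      have n2 : 0 ≤ p y - t' * spread x₁ x₂ x₃ y := hD'.nonneg y hy
      rw [← ENNReal.ofReal_mul hw1, ← ENNReal.ofReal_mul hw2,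
        ← ENNReal.ofReal_add (mul_nonneg hw1 n1) (mul_nonneg hw2 n2)]
      congr 2
      field_simp
      ring
    · have hlt : s.card = 0 ∨ s.card = 1 ∨ s.card = 2 := by omega
      have hma := h.mass
      have hme := h.mean
      rcases hlt with hc | hc | hc
      · exact ih l r s p hlr (by omega) h
      · obtain ⟨y, rfl⟩ := Finset.card_eq_one.1 hc
        simp only [Finset.sum_singleton] at hma hme
        have := H l r y y (p y) 0 hlr (hpos y (by simp)).le le_rfl (by linarith) (by linarith)
          le_rfl (by linarith)
        simpa [discreteMeasure] using this
      · obtain ⟨y, z, hyz, rfl⟩ := Finset.card_eq_two.1 hc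
        rw [Finset.sum_pair hyz] at hma hme
        have key : ∀ y z : ℝ, y < z → 0 < p y → 0 < p z → p y + p z = r - l →
            p y * y + p z * z = (r ^ 2 - l ^ 2) / 2 →
            (∀ k, p y * max (y - k) 0 + p z * max (z - k) 0 ≤ stopLoss l r k) →
            MeanLaw n (volume.restrict (Set.Icc l r))
              (ENNReal.ofReal (p y) • Measure.dirac y + ENNReal.ofReal (p z) • Measure.dirac z) := by
          intro y z hyz hy hz hma hme hst
          refine H l r y z (p y) (p z) hlr hy.le hz.le hma hme hyz.le ?_
          have h1 := hst (l + p y)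
          rw [stopLoss_of_mem (by linarith) (by linarith)] at h1
          have h2 : z - (l + p y) ≤ p z / 2 := by
            have h3 := mul_nonneg hy.le (le_max_right (y - (l + p y)) 0)
            have h4 := mul_le_mul_of_nonneg_left (le_max_left (z - (l + p y)) 0) hz.le
            have h5 : r - (l + p y) = p z := by linarith
            rw [h5] at h1
            by_contra! hcon
            nlinarith
          have h6 : p y * (z - y) ≤ p y * ((r - l) / 2) := by
            have hr : r = l + p y + p z := by linarith
            subst hr
            nlinarith
          exact le_of_mul_le_mul_left h6 hy
        rw [discreteMeasure, Finset.sum_pair hyz]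
        have hst := h.loss
        simp only [Finset.sum_pair hyz] at hst
        rcases lt_or_gt_of_ne hyz with hlt | hlt
        · exact key y z hlt (hpos y (by simp)) (hpos z (by simp)) hma hme hst
        · rw [add_comm]
          exact key z y hlt (hpos z (by simp)) (hpos y (by simp)) (by linarith) (by linarith)
            fun k => by linarith [hst k]

end

/-- `ν` is, up to normalisation, the average of the marginal laws of three variables with constant
sum `σ`. -/
def JointMix (σ : ℝ) (ν : Measure ℝ) : Prop :=
  ∃ m : ℝ≥0∞, MeanLaw 3 ν (m • Measure.dirac (σ / 3))

lemma JointMix.add {σ : ℝ} {ν ν' : Measure ℝ} (h : JointMix σ ν) (h' : JointMix σ ν') :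
    JointMix σ (ν + ν') := by
  obtain ⟨m, hm⟩ := h
  obtain ⟨m', hm'⟩ := h'
  exact ⟨m + m', by rw [add_smul]; exact hm.add hm'⟩

lemma JointMix.smul {σ : ℝ} {ν : Measure ℝ} (c : ℝ≥0∞) (h : JointMix σ ν) :
    JointMix σ (c • ν) := by
  obtain ⟨m, hm⟩ := h
  exact ⟨c * m, by rw [← smul_smul]; exact hm.smul c⟩

lemma JointMix.zero (σ : ℝ) : JointMix σ 0 :=
  ⟨0, ⟨0, by simp, by simp⟩⟩

lemma JointMix.affine {σ : ℝ} {ν : Measure ℝ} (s t : ℝ) (h : JointMix σ ν) :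
    JointMix (s * σ + 3 * t) (ν.map fun x => s * x + t) := by
  obtain ⟨m, hm⟩ := h
  refine ⟨m, ?_⟩
  have := hm.affine (by norm_num) s t
  rw [Measure.map_smul, Measure.map_dirac' (by fun_prop)] at this
  convert this using 3
  ring

lemma JointMix.of_lintegral {Θ : Type*} [MeasurableSpace Θ] (m : Measure Θ) {φ₀ φ₁ φ₂ : Θ → ℝ}
    (h₀ : Measurable φ₀) (h₁ : Measurable φ₁) (h₂ : Measurable φ₂) {σ : ℝ}
    (hσ : ∀ᵐ θ ∂m, φ₀ θ + φ₁ θ + φ₂ θ = σ) {ν : Measure ℝ}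
    (hν : ∀ h : ℝ → ℝ≥0∞, Measurable h →
      ∫⁻ θ, h (φ₀ θ) + h (φ₁ θ) + h (φ₂ θ) ∂m = ∫⁻ x, h x ∂ν) : JointMix σ ν := by
  have hφ : ∀ i, Measurable ((![φ₀, φ₁, φ₂] : Fin 3 → Θ → ℝ) i) := by
    intro i; fin_cases i <;> assumption
  refine ⟨(3 • m) Set.univ, MeanLaw.of_map (3 • m) ![φ₀, φ₁, φ₂] hφ ?_ ?_⟩
  · have e : m.map φ₀ + m.map φ₁ + m.map φ₂ = ν := by
      refine Measure.ext_of_lintegral _ fun h hh => ?_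
      rw [lintegral_add_measure, lintegral_add_measure, lintegral_map hh h₀, lintegral_map hh h₁,
        lintegral_map hh h₂, ← hν h hh, lintegral_add_left (by fun_prop),
        lintegral_add_left (by fun_prop)]
    rw [Fin.sum_univ_three, ← e]
    change (3 • m).map φ₀ + (3 • m).map φ₁ + (3 • m).map φ₂ = _
    have h3 : (3 • m : Measure Θ) = ((3 : ℕ) : ℝ≥0∞) • m := by
      rw [← Nat.cast_smul_eq_nsmul ℝ≥0∞]
    rw [h3]
    simp only [Measure.map_smul, smul_add]
  · have : (fun θ => (∑ i, (![φ₀, φ₁, φ₂] : Fin 3 → Θ → ℝ) i θ) / ((3 : ℕ) : ℝ)) =ᵐ[3 • m]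
        fun _ => σ / 3 := by
      refine Measure.ae_smul_measure (hσ.mono fun θ hθ => ?_) 3
      simp [Fin.sum_univ_three, hθ]
    rw [Measure.map_congr this, Measure.map_const]

/-- The linear density `1 - e x` on `[-1, 1]`. -/
noncomputable def linearDensity (e : ℝ) : Measure ℝ :=
  (volume.restrict (Set.Icc (-1) 1)).withDensity fun x => ENNReal.ofReal (1 - e * x)

/-- A density on the plane `x + y + z = -e`, symmetric in the three coordinates, whose marginal
densities are linear. -/
noncomputable def planeDensity (e x y : ℝ) : ℝ≥0∞ :=
  if |x| ≤ 1 ∧ |y| ≤ 1 ∧ |e + x + y| ≤ 1 then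
    ENNReal.ofReal (max (max e |x|) (max |y| |e + x + y|)) else 0

lemma planeDensity_comm (e x y : ℝ) : planeDensity e x y = planeDensity e y x := by
  have h : e + y + x = e + x + y := by ring
  unfold planeDensity
  rw [h]
  congr 1
  · exact propext ⟨fun h => ⟨h.2.1, h.1, h.2.2⟩, fun h => ⟨h.2.1, h.1, h.2.2⟩⟩
  · rw [max_assoc, max_assoc, max_left_comm |x|]

lemma planeDensity_reflect (e x y : ℝ) : planeDensity e (-(e + y) - x) y = planeDensity e x y := by
  have h : e + (-(e + y) - x) + y = -x := by ring
  have h' : |-(e + y) - x| = |e + x + y| := by rw [← abs_neg]; congr 1; ring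
  unfold planeDensity
  rw [h, h', abs_neg]
  congr 1
  · exact propext ⟨fun h => ⟨h.2.2, h.2.1, h.1⟩, fun h => ⟨h.2.2, h.2.1, h.1⟩⟩
  · congr 1; ac_rfl

lemma measurable_planeDensity (e : ℝ) :
    Measurable fun v : ℝ × ℝ => planeDensity e v.1 v.2 := by
  unfold planeDensity
  refine Measurable.ite ?_ (by fun_prop) measurable_const
  refine (measurableSet_le (f := fun v : ℝ × ℝ => |v.1|) (by fun_prop) measurable_const).inter
    ((measurableSet_le (f := fun v : ℝ × ℝ => |v.2|) (by fun_prop) measurable_const).inter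
    (measurableSet_le (f := fun v : ℝ × ℝ => |e + v.1 + v.2|) (by fun_prop) measurable_const))

lemma integral_max_abs_add {M q : ℝ} (hqM : q ≤ M) (hM : M ≤ 1) :
    ∫ w in (-(1 - q))..(1 - q), max M (|w| + q) = 1 + M ^ 2 - 2 * M * q := by
  have hc : Continuous fun w : ℝ => max M (|w| + q) := by fun_prop
  have hpos : ∫ w in (0 : ℝ)..(1 - q), max M (|w| + q) = (1 + M ^ 2) / 2 - M * q := by
    rw [← intervalIntegral.integral_add_adjacent_intervals (b := M - q)
      (hc.intervalIntegrable _ _) (hc.intervalIntegrable _ _)]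
    have e1 : ∫ w in (0 : ℝ)..(M - q), max M (|w| + q) = ∫ w in (0 : ℝ)..(M - q), M := by
      refine intervalIntegral.integral_congr fun w hw => ?_
      rw [Set.uIcc_of_le (by linarith)] at hw
      simp only [abs_of_nonneg hw.1]
      exact max_eq_left (by linarith [hw.2])
    have e2 : ∫ w in (M - q)..(1 - q), max M (|w| + q) = ∫ w in (M - q)..(1 - q), (w + q) := by
      refine intervalIntegral.integral_congr fun w hw => ?_
      rw [Set.uIcc_of_le (by linarith)] at hw
      rw [abs_of_nonneg (by linarith [hw.1])]
      exact max_eq_right (by linarith [hw.1])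
    rw [e1, e2]
    simp
    ring
  have hneg : ∫ w in (-(1 - q))..0, max M (|w| + q) = ∫ w in (0 : ℝ)..(1 - q), max M (|w| + q) := by
    have := intervalIntegral.integral_comp_neg (a := 0) (b := 1 - q) fun w => max M (|w| + q)
    simp only [abs_neg, neg_zero] at this
    exact this.symm
  rw [← intervalIntegral.integral_add_adjacent_intervals (b := 0)
    (hc.intervalIntegrable _ _) (hc.intervalIntegrable _ _), hneg, hpos]
  ring

lemma lintegral_planeDensity {e : ℝ} (h0 : 0 ≤ e) (h1 : e ≤ 1) (x : ℝ) :
    ∫⁻ y, planeDensity e x y =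
      (Set.Icc (-1 : ℝ) 1).indicator (fun x => ENNReal.ofReal (1 - e * x)) x := by
  by_cases hx : |x| ≤ 1
  swap
  · rw [Set.indicator_of_notMem (s := Set.Icc (-1 : ℝ) 1) (fun h => hx (abs_le.2 h))]
    simp [planeDensity, hx]
  rw [Set.indicator_of_mem (s := Set.Icc (-1 : ℝ) 1) (abs_le.1 hx)]
  set q := |(e + x) / 2| with hq
  set M := max e |x| with hM
  have hqM : q ≤ M := by
    rw [hq, abs_div, abs_two]
    have := abs_add_le e x
    rw [abs_of_nonneg h0] at this
    linarith [le_max_left e |x|, le_max_right e |x|]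
  have hM1 : M ≤ 1 := max_le h1 hx
  rw [← lintegral_sub_right_eq_self _ ((e + x) / 2)]
  have key : ∀ w : ℝ, planeDensity e x (w - (e + x) / 2) =
      (Set.Icc (-(1 - q)) (1 - q)).indicator (fun w => ENNReal.ofReal (max M (|w| + q))) w := by
    intro w
    have hw : max |w - (e + x) / 2| |w + (e + x) / 2| = |w| + q := by
      rw [hq]
      rcases abs_cases (w - (e + x) / 2) with h | h <;>
      rcases abs_cases (w + (e + x) / 2) with h' | h' <;>
      rcases abs_cases w with h'' | h'' <;> rcases abs_cases ((e + x) / 2) with h3 | h3 <;>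
      rw [h.1, h'.1, h''.1, h3.1] <;>
      first
        | (rw [max_eq_left (by linarith)] <;> linarith)
        | (rw [max_eq_right (by linarith)] <;> linarith)
    have hz : e + x + (w - (e + x) / 2) = w + (e + x) / 2 := by ring
    unfold planeDensity
    rw [hz, hw]
    by_cases h : w ∈ Set.Icc (-(1 - q)) (1 - q)
    · have hwq : |w| + q ≤ 1 := by linarith [abs_le.2 h]
      rw [Set.indicator_of_mem h, if_pos]
      refine ⟨hx, ?_, ?_⟩ <;> linarith [le_max_left |w - (e + x) / 2| |w + (e + x) / 2|,
        le_max_right |w - (e + x) / 2| |w + (e + x) / 2|]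
    · rw [Set.indicator_of_notMem h, if_neg]
      rintro ⟨-, h2, h3⟩
      have := max_le h2 h3
      rw [hw] at this
      exact h (abs_le.1 (by linarith))
  simp_rw [key]
  rw [lintegral_indicator measurableSet_Icc, ← ofReal_integral_eq_lintegral_ofReal
    (Continuous.integrableOn_Icc (by fun_prop)) (ae_of_all _ fun w => (h0.trans
      (le_max_left e |x|)).trans (le_max_left _ _)), integral_Icc_eq_integral_Ioc,
    ← intervalIntegral.integral_of_le (by linarith), integral_max_abs_add hqM hM1]
  congr 1
  have hq2 : 2 * q = |e + x| := by
    rw [hq, abs_div, abs_two]; ring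
  have : 2 * M * q = M * |e + x| := by rw [← hq2]; ring
  rw [this, hM]
  rcases abs_cases x with h | h <;> rcases max_cases e |x| with h' | h' <;>
    rcases abs_cases (e + x) with h'' | h'' <;> rw [h'.1, h''.1] <;> (try rw [h.1]) <;>
    first | (exfalso; linarith) | ring1

lemma lintegral_linearDensity (e : ℝ) {h : ℝ → ℝ≥0∞} (hh : Measurable h) :
    ∫⁻ x, h x ∂(linearDensity e) = ∫⁻ x in Set.Icc (-1) 1, ENNReal.ofReal (1 - e * x) * h x := by
  rw [linearDensity, lintegral_withDensity_eq_lintegral_mul _ (by fun_prop) hh]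
  rfl

lemma lintegral_planeDensity_mul {e : ℝ} (h0 : 0 ≤ e) (h1 : e ≤ 1) {h : ℝ → ℝ≥0∞}
    (hh : Measurable h) :
    ∫⁻ x, ∫⁻ y, planeDensity e x y * h x = ∫⁻ x, h x ∂(linearDensity e) := by
  rw [lintegral_linearDensity e hh, ← lintegral_indicator measurableSet_Icc]
  refine lintegral_congr fun x => ?_
  have hm : Measurable fun y => planeDensity e x y :=
    (measurable_planeDensity e).comp (measurable_const.prodMk measurable_id)
  rw [lintegral_mul_const _ hm, lintegral_planeDensity h0 h1]
  by_cases hx : x ∈ Set.Icc (-1 : ℝ) 1 <;> simp [hx]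

/-- A linear density on `[-1, 1]` is the marginal law of an exchangeable triple with constant
sum. -/
lemma jointMix_linearDensity {e : ℝ} (h0 : 0 ≤ e) (h1 : e ≤ 1) :
    JointMix (-e) (linearDensity e) := by
  have hψ := measurable_planeDensity e
  set μ := (volume : Measure (ℝ × ℝ)).withDensity fun v => planeDensity e v.1 v.2
  have key : JointMix (-e) ((3 : ℝ≥0∞) • linearDensity e) := by
    refine JointMix.of_lintegral μ (φ₀ := fun v => v.1) (φ₁ := fun v => v.2)
      (φ₂ := fun v => -(e + v.2) - v.1) (by fun_prop) (by fun_prop) (by fun_prop)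
      (ae_of_all _ fun v => by ring) fun h hh => ?_
    have e0 : ∫⁻ v, h v.1 ∂μ = ∫⁻ x, h x ∂(linearDensity e) := by
      rw [lintegral_withDensity_eq_lintegral_mul _ hψ (by fun_prop), Measure.volume_eq_prod,
        lintegral_prod _ (by fun_prop), ← lintegral_planeDensity_mul h0 h1 hh]
      rfl
    have e1 : ∫⁻ v, h v.2 ∂μ = ∫⁻ x, h x ∂(linearDensity e) := by
      rw [lintegral_withDensity_eq_lintegral_mul _ hψ (by fun_prop), Measure.volume_eq_prod,
        lintegral_prod_symm _ (by fun_prop), ← lintegral_planeDensity_mul h0 h1 hh]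
      refine lintegral_congr fun y => lintegral_congr fun x => ?_
      simp [planeDensity_comm e x y]
    have e2 : ∫⁻ v, h (-(e + v.2) - v.1) ∂μ = ∫⁻ x, h x ∂(linearDensity e) := by
      rw [← e0, lintegral_withDensity_eq_lintegral_mul _ hψ (by fun_prop),
        lintegral_withDensity_eq_lintegral_mul _ hψ (by fun_prop), Measure.volume_eq_prod,
        lintegral_prod_symm _ (by fun_prop), lintegral_prod_symm _ (by fun_prop)]
      refine lintegral_congr fun y => ?_
      rw [← lintegral_sub_left_eq_self _ (-(e + y))]
      refine lintegral_congr fun x => ?_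
      rw [Pi.mul_apply, Pi.mul_apply, planeDensity_reflect]
      simp only [sub_sub_cancel]
    rw [lintegral_add_left (by fun_prop), lintegral_add_left (by fun_prop), e0, e1, e2,
      lintegral_smul_measure, smul_eq_mul]
    ring
  have := key.smul 3⁻¹
  rwa [smul_smul, ENNReal.inv_mul_cancel (by norm_num) (by norm_num), one_smul] at this

section

lemma map_affine_restrict {s : ℝ} (hs : 0 < s) (t l r : ℝ) :
    (volume.restrict (Set.Icc l r)).map (fun x => s * x + t) =
      ENNReal.ofReal s⁻¹ • volume.restrict (Set.Icc (s * l + t) (s * r + t)) := by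
  have hf : Measurable fun x : ℝ => s * x + t := by fun_prop
  have hv : volume.map (fun x : ℝ => s * x + t) = ENNReal.ofReal s⁻¹ • (volume : Measure ℝ) := by
    have h1 := Real.map_volume_mul_left hs.ne'
    rw [abs_of_pos (inv_pos.2 hs)] at h1
    have h2 : (fun x : ℝ => s * x + t) = (fun x => x + t) ∘ (fun x => s * x) := rfl
    rw [h2, ← Measure.map_map (by fun_prop) (by fun_prop), h1, Measure.map_smul,
      map_add_right_eq_self]
  have hp : Set.Icc l r = (fun x : ℝ => s * x + t) ⁻¹' Set.Icc (s * l + t) (s * r + t) := by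
    ext x
    simp only [Set.mem_preimage, Set.mem_Icc, add_le_add_iff_right, mul_le_mul_iff_right₀ hs]
  rw [hp, ← Measure.restrict_map hf measurableSet_Icc, hv, Measure.restrict_smul]

lemma map_neg_restrict (l r : ℝ) :
    (volume.restrict (Set.Icc l r)).map (fun x : ℝ => -x) =
      volume.restrict (Set.Icc (-r) (-l)) := by
  have hp : Set.Icc l r = (fun x : ℝ => -x) ⁻¹' Set.Icc (-r) (-l) := by
    ext x; simp
  rw [hp, ← Measure.restrict_map measurable_neg measurableSet_Icc]
  congr 1
  exact Measure.map_neg_eq_self (volume : Measure ℝ)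

/-- The Lebesgue measure on `[l, r]` splits into the marginal laws of two exchangeable triples with
constant sums `a` and `b`. -/
def Splits (a b l r : ℝ) : Prop :=
  ∃ ν₁ ν₂, JointMix a ν₁ ∧ JointMix b ν₂ ∧ ν₁ + ν₂ = volume.restrict (Set.Icc l r)

variable {a b l r : ℝ}

lemma Splits.of_map {s t l' r' : ℝ} (h : Splits a b l r) (c : ℝ≥0∞)
    (hv : (volume.restrict (Set.Icc l r)).map (fun x => s * x + t) =
      c • volume.restrict (Set.Icc l' r')) (h0 : c ≠ 0) (hT : c ≠ ⊤) :
    Splits (s * a + 3 * t) (s * b + 3 * t) l' r' := by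
  obtain ⟨ν₁, ν₂, h₁, h₂, h⟩ := h
  refine ⟨_, _, (h₁.affine s t).smul c⁻¹, (h₂.affine s t).smul c⁻¹, ?_⟩
  rw [← smul_add, ← Measure.map_add _ _ (by fun_prop), h, hv, smul_smul,
    ENNReal.inv_mul_cancel h0 hT, one_smul]

lemma Splits.affine {s : ℝ} (hs : 0 < s) (t : ℝ) (h : Splits a b l r) :
    Splits (s * a + 3 * t) (s * b + 3 * t) (s * l + t) (s * r + t) :=
  h.of_map _ (map_affine_restrict hs t l r) (by simpa using hs) (by simp)

lemma Splits.neg (h : Splits a b l r) : Splits (-a) (-b) (-r) (-l) := by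
  have := h.of_map (s := -1) (t := 0) (l' := -r) (r' := -l) 1
    (by simpa using map_neg_restrict l r) (by simp) (by simp)
  simpa using this

lemma Splits.symm (h : Splits a b l r) : Splits b a l r := by
  obtain ⟨ν₁, ν₂, h₁, h₂, h⟩ := h
  exact ⟨ν₂, ν₁, h₂, h₁, by rw [add_comm, h]⟩

lemma linearDensity_zero : linearDensity 0 = volume.restrict (Set.Icc (-1) 1) := by
  simp [linearDensity]

lemma jointMix_restrict_Icc (h : l ≤ r) : JointMix (3 * (l + r) / 2) (volume.restrict (Set.Icc l r)) := by
  rcases h.eq_or_lt with rfl | h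
  · simpa using JointMix.zero _
  have hJ := jointMix_linearDensity le_rfl zero_le_one
  rw [linearDensity_zero] at hJ
  have hs : 0 < (r - l) / 2 := by linarith
  have := (hJ.affine ((r - l) / 2) ((l + r) / 2)).smul (ENNReal.ofReal ((r - l) / 2))
  rw [map_affine_restrict hs, smul_smul, ← ENNReal.ofReal_mul hs.le, mul_inv_cancel₀ hs.ne',
    ENNReal.ofReal_one, one_smul] at this
  convert this using 2
  · ring
  · congr 1 <;> ring

lemma Splits.of_sub_eq (h : b - a = 3 * (r - l) / 2) (ha : a ≤ 3 * (l + r) / 2)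
    (hb : 3 * (l + r) / 2 ≤ b) : Splits a b l r := by
  have h1 : l ≤ 2 * a / 3 - l := by linarith
  have h2 : 2 * a / 3 - l ≤ r := by linarith
  refine ⟨_, _, ?_, ?_, restrict_Icc_add h1 h2⟩
  · convert jointMix_restrict_Icc h1 using 1; ring
  · convert jointMix_restrict_Icc h2 using 1; linarith

lemma Splits.of_left (h : l ≤ r) (ha : a = 3 * (l + r) / 2) : Splits a b l r :=
  ⟨_, 0, ha ▸ jointMix_restrict_Icc h, JointMix.zero _, add_zero _⟩

lemma map_neg_linearDensity (e : ℝ) :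
    (linearDensity e).map (fun x => -1 * x + 0) = linearDensity (-e) := by
  refine Measure.ext_of_lintegral _ fun h hh => ?_
  rw [lintegral_map hh (by fun_prop), lintegral_linearDensity _ (by fun_prop),
    lintegral_linearDensity _ hh]
  have := map_neg_restrict (-1) 1
  rw [neg_neg] at this
  nth_rw 2 [← this]
  rw [lintegral_map (by fun_prop) (by fun_prop)]
  simp

lemma jointMix_linearDensity_neg {e : ℝ} (h0 : 0 ≤ e) (h1 : e ≤ 1) :
    JointMix e (linearDensity (-e)) := by
  have := (jointMix_linearDensity h0 h1).affine (-1) 0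
  rw [map_neg_linearDensity] at this
  simpa using this

lemma Splits.of_le_one {α β : ℝ} (hα : 0 ≤ α) (hα1 : α ≤ 1) (hβ : 0 ≤ β) (hβ1 : β ≤ 1) :
    Splits (-α) β (-1) 1 := by
  rcases hα.eq_or_lt with rfl | hα0
  · exact Splits.of_left (by norm_num) (by norm_num)
  have hd : 0 < α + β := by linarith
  refine ⟨_, _, (jointMix_linearDensity hα hα1).smul (ENNReal.ofReal (β / (α + β))),
    (jointMix_linearDensity_neg hβ hβ1).smul (ENNReal.ofReal (α / (α + β))), ?_⟩
  refine Measure.ext_of_lintegral _ fun h hh => ?_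
  rw [lintegral_add_measure, lintegral_smul_measure, lintegral_smul_measure,
    lintegral_linearDensity _ hh, lintegral_linearDensity _ hh, smul_eq_mul, smul_eq_mul,
    ← lintegral_const_mul _ (by fun_prop), ← lintegral_const_mul _ (by fun_prop),
    ← lintegral_add_left (by fun_prop)]
  refine setLIntegral_congr_fun measurableSet_Icc fun x hx => ?_
  have h1 : 0 ≤ 1 - α * x := by nlinarith [hx.2, hx.1]
  have h2 : 0 ≤ 1 - -β * x := by nlinarith [hx.2, hx.1]
  rw [← mul_assoc, ← mul_assoc, ← add_mul, ← ENNReal.ofReal_mul (by positivity),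
    ← ENNReal.ofReal_mul (by positivity), ← ENNReal.ofReal_add (by positivity) (by positivity)]
  have : β / (α + β) * (1 - α * x) + α / (α + β) * (1 - -β * x) = 1 := by
    field_simp
    ring
  rw [this, ENNReal.ofReal_one, one_mul]

end

lemma lintegral_unit_affine {s : ℝ} (hs : 0 < s) (t : ℝ) {h : ℝ → ℝ≥0∞} (hh : Measurable h) :
    ENNReal.ofReal s * ∫⁻ v in Set.Icc (0 : ℝ) 1, h (s * v + t) =
      ∫⁻ x in Set.Icc t (s + t), h x := by
  rw [← lintegral_map hh (by fun_prop), map_affine_restrict hs, lintegral_smul_measure,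
    smul_eq_mul, ← mul_assoc, ← ENNReal.ofReal_mul hs.le, mul_inv_cancel₀ hs.ne']
  simp

lemma lintegral_unit_reflect (s : ℝ) (h : ℝ → ℝ≥0∞) :
    ∫⁻ v in Set.Icc (0 : ℝ) 1, h (-s * v + s) = ∫⁻ v in Set.Icc (0 : ℝ) 1, h (s * v + 0) := by
  rw [← lintegral_indicator measurableSet_Icc, ← lintegral_indicator measurableSet_Icc,
    ← lintegral_sub_left_eq_self _ 1]
  refine lintegral_congr fun v => ?_
  by_cases hv : v ∈ Set.Icc (0 : ℝ) 1
  · rw [Set.indicator_of_mem hv, Set.indicator_of_mem (by constructor <;> linarith [hv.1, hv.2])]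
    congr 1; ring
  · rw [Set.indicator_of_notMem hv, Set.indicator_of_notMem fun hv' => hv
      (by constructor <;> linarith [hv'.1, hv'.2])]

lemma lintegral_unit_concat {a b c : ℝ} (ha : 0 < a) (hb : 0 < b) (hc : 0 < c) {h : ℝ → ℝ≥0∞}
    (hh : Measurable h) :
    ENNReal.ofReal (a * c) * (∫⁻ v in Set.Icc (0 : ℝ) 1, h (c * v + 0)) +
      ENNReal.ofReal (a * b) * (∫⁻ v in Set.Icc (0 : ℝ) 1, h (b * v + c)) =
      ENNReal.ofReal (a * (b + c)) * ∫⁻ v in Set.Icc (0 : ℝ) 1, h ((b + c) * v + 0) := by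
  rw [ENNReal.ofReal_mul ha.le, ENNReal.ofReal_mul ha.le, ENNReal.ofReal_mul ha.le, mul_assoc,
    mul_assoc, mul_assoc, lintegral_unit_affine hc _ hh, lintegral_unit_affine hb _ hh,
    lintegral_unit_affine (by linarith) _ hh, ← mul_add, ← lintegral_add_measure, add_zero,
    add_zero, restrict_Icc_add hc.le (by linarith)]

/-- Three uniform variables, on a segment in the plane `x + y + z = A`. -/
lemma jointMix_segment {Z : Type*} [MeasurableSpace Z] (μ : Measure Z) [SFinite μ] {a b c : Z → ℝ}
    (ha : Measurable a) (hb : Measurable b) (hc : Measurable c) {A : ℝ}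
    (hA : ∀ᵐ z ∂μ, a z + b z + c z = A) {W : Z → ℝ≥0∞} (hW : Measurable W) :
    ∃ ν, JointMix A ν ∧ ∀ h : ℝ → ℝ≥0∞, Measurable h → ∫⁻ x, h x ∂ν =
      ∫⁻ z, W z * ((∫⁻ v in Set.Icc (0 : ℝ) 1, h (c z * v + 0)) +
        (∫⁻ v in Set.Icc (0 : ℝ) 1, h ((a z + c z) * v + 0)) +
        ∫⁻ v in Set.Icc (0 : ℝ) 1, h (a z * v + b z)) ∂μ := by
  set m := ((μ.withDensity W).prod (volume.restrict (Set.Icc (0 : ℝ) 1)))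
  set φ₀ : Z × ℝ → ℝ := fun w => c w.1 * w.2 + 0
  set φ₁ : Z × ℝ → ℝ := fun w => -(a w.1 + c w.1) * w.2 + (a w.1 + c w.1)
  set φ₂ : Z × ℝ → ℝ := fun w => a w.1 * w.2 + b w.1
  have h₀ : Measurable φ₀ := by fun_prop
  have h₁ : Measurable φ₁ := by fun_prop
  have h₂ : Measurable φ₂ := by fun_prop
  have hlin : ∀ h : ℝ → ℝ≥0∞, Measurable h →
      ∫⁻ x, h x ∂(m.map φ₀ + m.map φ₁ + m.map φ₂) = ∫⁻ θ, h (φ₀ θ) + h (φ₁ θ) + h (φ₂ θ) ∂m := by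
    intro h hh
    rw [lintegral_add_measure, lintegral_add_measure, lintegral_map hh h₀, lintegral_map hh h₁,
        lintegral_map hh h₂, lintegral_add_left (by fun_prop), lintegral_add_left (by fun_prop)]
  refine ⟨m.map φ₀ + m.map φ₁ + m.map φ₂, JointMix.of_lintegral m h₀ h₁ h₂ ?_
    fun h hh => (hlin h hh).symm, fun h hh => ?_⟩
  · have := (Measure.quasiMeasurePreserving_fst (μ := μ.withDensity W)
      (ν := volume.restrict (Set.Icc (0 : ℝ) 1))).ae
      ((withDensity_absolutelyContinuous μ W).ae_le hA)
    filter_upwards [this] with w hw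
    simp only [φ₀, φ₁, φ₂]
    linarith
  · have hm : Measurable fun z => ∫⁻ v in Set.Icc (0 : ℝ) 1,
        h (φ₀ (z, v)) + h (φ₁ (z, v)) + h (φ₂ (z, v)) :=
      Measurable.lintegral_prod_right'
        (f := fun w : Z × ℝ => h (φ₀ w) + h (φ₁ w) + h (φ₂ w)) (by fun_prop)
    rw [hlin h hh, lintegral_prod _ (by fun_prop), lintegral_withDensity_eq_lintegral_mul _ hW hm]
    refine lintegral_congr fun z => ?_
    rw [Pi.mul_apply]
    congr 1
    rw [lintegral_add_left (by fun_prop), lintegral_add_left (by fun_prop)]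
    simp only [φ₀, φ₁, φ₂]
    rw [lintegral_unit_reflect]

lemma segment_identity {a b c : ℝ} (ha : 0 < a) (hb : 0 < b) (hc : 0 < c) {h : ℝ → ℝ≥0∞}
    (hh : Measurable h) {U : ℝ → ℝ → ℝ≥0∞}
    (hU : ∀ s t, U s t = ∫⁻ v in Set.Icc (0 : ℝ) 1, h (s * v + t)) :
    ENNReal.ofReal (a * c / (a * b + b * c + c * a)) * (U c 0 + U (a + c) 0 + U a b) +
      ENNReal.ofReal (b * a / (a * b + b * c + c * a)) * (U a 0 + U (b + a) 0 + U b c) +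
      ENNReal.ofReal (c * b / (a * b + b * c + c * a)) * (U b 0 + U (c + b) 0 + U c a) =
      U (b + c) 0 + U (c + a) 0 + U (a + b) 0 := by
  have hσ : 0 < a * b + b * c + c * a := by positivity
  set σ := a * b + b * c + c * a with hσd
  have e1 := lintegral_unit_concat ha hb hc hh
  have e2 := lintegral_unit_concat hb hc ha hh
  have e3 := lintegral_unit_concat hc ha hb hh
  simp only [← hU] at e1 e2 e3
  have hne : ENNReal.ofReal σ ≠ 0 := by simpa using hσ
  refine (ENNReal.mul_right_inj hne ENNReal.ofReal_ne_top).1 ?_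
  have hd : ∀ x : ℝ, 0 ≤ x → ENNReal.ofReal σ * ENNReal.ofReal (x / σ) = ENNReal.ofReal x := by
    intro x hx
    rw [← ENNReal.ofReal_mul hσ.le, mul_div_cancel₀ _ hσ.ne']
  have hs : ∀ x y : ℝ, 0 ≤ x → 0 ≤ y → x + y = σ →
      ENNReal.ofReal σ = ENNReal.ofReal x + ENNReal.ofReal y := by
    intro x y hx hy hxy
    rw [← ENNReal.ofReal_add hx hy, hxy]
  have s1 := hs (a * (b + c)) (c * b) (by positivity) (by positivity) (by rw [hσd]; ring)
  have s2 := hs (b * (c + a)) (a * c) (by positivity) (by positivity) (by rw [hσd]; ring)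
  have s3 := hs (c * (a + b)) (b * a) (by positivity) (by positivity) (by rw [hσd]; ring)
  calc _ = ENNReal.ofReal (a * c) * (U c 0 + U (a + c) 0 + U a b) +
      ENNReal.ofReal (b * a) * (U a 0 + U (b + a) 0 + U b c) +
      ENNReal.ofReal (c * b) * (U b 0 + U (c + b) 0 + U c a) := by
        rw [mul_add, mul_add, ← mul_assoc, ← mul_assoc, ← mul_assoc, hd _ (by positivity),
          hd _ (by positivity), hd _ (by positivity)]
    _ = (ENNReal.ofReal (a * (b + c)) * U (b + c) 0 + ENNReal.ofReal (c * b) * U (b + c) 0) +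
        (ENNReal.ofReal (b * (c + a)) * U (c + a) 0 + ENNReal.ofReal (a * c) * U (c + a) 0) +
        (ENNReal.ofReal (c * (a + b)) * U (a + b) 0 + ENNReal.ofReal (b * a) * U (a + b) 0) := by
        rw [← e1, ← e2, ← e3, add_comm a c, add_comm b a, add_comm c b, mul_comm b a, mul_comm c b,
          mul_comm c a]
        ring
    _ = _ := by
        rw [← add_mul, ← add_mul, ← add_mul, ← s1, ← s2, ← s3]
        ring

/-- If nonnegative `Z₀ + Z₁ + Z₂ = A`, then uniform variables on `[0, A - Zᵢ]` can be coupled to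
have sum `A`. -/
lemma JointMix.uniform_scale {A : ℝ} {ν : Measure ℝ} [IsFiniteMeasure ν] (h : JointMix A ν)
    (hν : ∀ᵐ z ∂ν, 0 < z) :
    JointMix A ((ν.prod (volume.restrict (Set.Icc (0 : ℝ) 1))).map
      fun w => (A - w.1) * w.2 + 0) := by
  obtain ⟨m, μ, h1, h2⟩ := h
  have hμ : IsFiniteMeasure μ := by
    have := MeanLaw.univ_eq (by norm_num) ⟨μ, h1, rfl⟩
    rw [Measure.map_apply (by fun_prop) MeasurableSet.univ, Set.preimage_univ] at this
    exact ⟨this ▸ measure_lt_top ν _⟩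
  have hsum : ∀ᵐ z ∂μ, z 0 + z 1 + z 2 = A := by
    have : ∀ᵐ x ∂(m • Measure.dirac (A / 3)), x = A / 3 := by
      refine Measure.ae_smul_measure ?_ m
      rw [ae_dirac_eq]
      exact rfl
    rw [← h2] at this
    filter_upwards [ae_of_ae_map (by fun_prop) this] with z hz
    rw [Fin.sum_univ_three] at hz
    have h3 : ((3 : ℕ) : ℝ) = 3 := by norm_num
    rw [h3] at hz
    linarith
  have hpos : ∀ i, ∀ᵐ z ∂μ, 0 < z i := by
    intro i
    have : ∀ᵐ x ∂(∑ i, μ.map fun z => z i), 0 < x := by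
      rw [h1]; exact Measure.ae_smul_measure hν _
    rw [ae_iff, Measure.coe_finsetSum, Finset.sum_apply, Finset.sum_eq_zero_iff] at this
    exact ae_of_ae_map (measurable_pi_apply i).aemeasurable (this i (Finset.mem_univ i))
  have hm : ∀ i, Measurable fun z : Fin 3 → ℝ => z i := fun i => measurable_pi_apply i
  obtain ⟨ν₀, hJ₀, hν₀⟩ := jointMix_segment μ (hm 0) (hm 1) (hm 2) hsum
    (W := fun z => ENNReal.ofReal (z 0 * z 2 / (z 0 * z 1 + z 1 * z 2 + z 2 * z 0))) (by fun_prop)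
  obtain ⟨ν₁, hJ₁, hν₁⟩ := jointMix_segment μ (hm 1) (hm 2) (hm 0)
    (hsum.mono fun z hz => by linarith)
    (W := fun z => ENNReal.ofReal (z 1 * z 0 / (z 0 * z 1 + z 1 * z 2 + z 2 * z 0))) (by fun_prop)
  obtain ⟨ν₂, hJ₂, hν₂⟩ := jointMix_segment μ (hm 2) (hm 0) (hm 1)
    (hsum.mono fun z hz => by linarith)
    (W := fun z => ENNReal.ofReal (z 2 * z 1 / (z 0 * z 1 + z 1 * z 2 + z 2 * z 0))) (by fun_prop)
  have key := ((hJ₀.add hJ₁).add hJ₂).smul 3⁻¹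
  convert key using 1
  refine Measure.ext_of_lintegral _ fun h hh => ?_
  have hV : Measurable fun z : ℝ => ∫⁻ v in Set.Icc (0 : ℝ) 1, h ((A - z) * v + 0) :=
    Measurable.lintegral_prod_right' (f := fun w : ℝ × ℝ => h ((A - w.1) * w.2 + 0)) (by fun_prop)
  have hU : ∀ {s t : (Fin 3 → ℝ) → ℝ}, Measurable s → Measurable t →
      Measurable fun z => ∫⁻ v in Set.Icc (0 : ℝ) 1, h (s z * v + t z) := fun {s t} hs ht =>
    Measurable.lintegral_prod_right' (f := fun w : (Fin 3 → ℝ) × ℝ => h (s w.1 * w.2 + t w.1))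
      (by fun_prop)
  have hsm : ∀ i, AEMeasurable (fun z : Fin 3 → ℝ => z i) μ := fun i => (hm i).aemeasurable
  have e : (3 : ℝ≥0∞) * ∫⁻ z, (∫⁻ v in Set.Icc (0 : ℝ) 1, h ((A - z) * v + 0)) ∂ν =
      ∫⁻ z, (∫⁻ v in Set.Icc (0 : ℝ) 1, h ((z 1 + z 2) * v + 0)) +
        (∫⁻ v in Set.Icc (0 : ℝ) 1, h ((z 2 + z 0) * v + 0)) +
        (∫⁻ v in Set.Icc (0 : ℝ) 1, h ((z 0 + z 1) * v + 0)) ∂μ := by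
    have e1 := congrArg (fun ρ : Measure ℝ =>
      ∫⁻ z, (∫⁻ v in Set.Icc (0 : ℝ) 1, h ((A - z) * v + 0)) ∂ρ) h1
    simp only [Fin.sum_univ_three, lintegral_add_measure, lintegral_smul_measure,
      lintegral_map hV (hm _), smul_eq_mul, Nat.cast_ofNat] at e1
    have w : ∀ i, Measurable fun z : Fin 3 → ℝ =>
        ∫⁻ v in Set.Icc (0 : ℝ) 1, h ((A - z i) * v + 0) := fun i => hV.comp (hm i)
    have w0 := w 0
    have w1 := w 1
    rw [← e1, ← lintegral_add_left (by fun_prop), ← lintegral_add_left (by fun_prop)]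
    refine lintegral_congr_ae (hsum.mono fun z hz => ?_)
    have q0 : A - z 0 = z 1 + z 2 := by linarith
    have q1 : A - z 1 = z 2 + z 0 := by linarith
    have q2 : A - z 2 = z 0 + z 1 := by linarith
    simp only [q0, q1, q2]
  rw [lintegral_map hh (by fun_prop), lintegral_prod _ (by fun_prop), lintegral_smul_measure,
    lintegral_add_measure, lintegral_add_measure, hν₀ h hh, hν₁ h hh, hν₂ h hh, smul_eq_mul]
  have m0 := hU (hm 0) (hm 1)
  have m1 := hU (hm 1) (hm 2)
  have m2 := hU (hm 2) (hm 0)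
  have n0 := hU (hm 0) (measurable_const (a := 0))
  have n1 := hU (hm 1) (measurable_const (a := 0))
  have n2 := hU (hm 2) (measurable_const (a := 0))
  have k0 := hU ((hm 0).add (hm 2)) (measurable_const (a := 0))
  have k1 := hU ((hm 1).add (hm 0)) (measurable_const (a := 0))
  have k2 := hU ((hm 2).add (hm 1)) (measurable_const (a := 0))
  simp only [Pi.add_apply] at k0 k1 k2
  rw [← lintegral_add_left (by fun_prop), ← lintegral_add_left (by fun_prop)]
  have e' : ∫⁻ z, (∫⁻ v in Set.Icc (0 : ℝ) 1, h ((A - z) * v + 0)) ∂ν = 3⁻¹ *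
      ((3 : ℝ≥0∞) * ∫⁻ z, (∫⁻ v in Set.Icc (0 : ℝ) 1, h ((A - z) * v + 0)) ∂ν) := by
    rw [← mul_assoc, ENNReal.inv_mul_cancel (by norm_num) (by norm_num), one_mul]
  rw [e', e]
  congr 1
  refine lintegral_congr_ae ?_
  filter_upwards [hpos 0, hpos 1, hpos 2] with z p0 p1 p2
  exact (segment_identity p0 p1 p2 hh
    (U := fun s t => ∫⁻ v in Set.Icc (0 : ℝ) 1, h (s * v + t)) fun _ _ => rfl).symm

/-- A trapezoidal measure on `[0, 2]`: its density is constant on `[0, q - e]` and then decreases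
linearly to zero at `q + e`. -/
noncomputable def trapezoid (q e : ℝ) : Measure ℝ :=
  (volume.restrict (Set.Icc 0 2)).withDensity
    fun y => ENNReal.ofReal (min 2 (max (1 + (q - y) / e) 0))

lemma lintegral_trapezoid (q e : ℝ) {h : ℝ → ℝ≥0∞} (hh : Measurable h) :
    ∫⁻ x, h x ∂(trapezoid q e) =
      ∫⁻ y in Set.Icc 0 2, ENNReal.ofReal (min 2 (max (1 + (q - y) / e) 0)) * h y := by
  rw [trapezoid, lintegral_withDensity_eq_lintegral_mul _ (by fun_prop) hh]
  rfl

lemma isFiniteMeasure_linearDensity (e : ℝ) : IsFiniteMeasure (linearDensity e) := by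
  refine isFiniteMeasure_withDensity_ofReal ?_
  exact (Continuous.integrableOn_Icc (by fun_prop)).2

lemma ae_linearDensity (e : ℝ) : ∀ᵐ x ∂(linearDensity e), -1 < x := by
  refine (withDensity_absolutelyContinuous _ _).ae_le ?_
  rw [← restrict_Ioc_eq_restrict_Icc]
  filter_upwards [ae_restrict_mem measurableSet_Ioc] with x hx using hx.1

lemma lintegral_unit_scale {c : ℝ} (hc : 0 ≤ c) {h : ℝ → ℝ≥0∞} (hh : Measurable h) :
    ENNReal.ofReal c * ∫⁻ v in Set.Icc (0 : ℝ) 1, h (c * v + 0) = ∫⁻ x in Set.Icc 0 c, h x := by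
  rcases hc.eq_or_lt with rfl | hc
  · simp
  · rw [lintegral_unit_affine hc _ hh, add_zero]

lemma jointMix_trapezoid {A q e : ℝ} (he : 0 < e) (heq : e ≤ q) (hq : q + e ≤ 2)
    (h2 : e ^ 2 = (2 * A - 3 * q) * q) : JointMix A (trapezoid q e) := by
  have hq0 : 0 < q := he.trans_le heq
  have hAq : 0 < 2 * A - 3 * q := by
    by_contra! hc
    nlinarith [sq_nonneg e, pow_pos he 2]
  have hm : e ≤ A - q := by
    by_contra! hc
    nlinarith [sq_nonneg (A - 2 * q)]
  have hε : e / q ≤ 1 := (div_le_one hq0).2 heq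
  have hfin := isFiniteMeasure_linearDensity (e / q)
  have hJ := (jointMix_linearDensity (div_nonneg he.le hq0.le) hε).affine e (A - q)
  have hσ : e * -(e / q) + 3 * (A - q) = A := by
    field_simp
    rw [h2]
    ring
  rw [hσ] at hJ
  have hf : Measurable fun x : ℝ => e * x + (A - q) := by fun_prop
  have hpos : ∀ᵐ z ∂((linearDensity (e / q)).map fun x => e * x + (A - q)), 0 < z := by
    rw [ae_map_iff hf.aemeasurable measurableSet_Ioi]
    filter_upwards [ae_linearDensity (e / q)] with x hx
    nlinarith
  convert (hJ.uniform_scale hpos).smul (ENNReal.ofReal q) using 1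
  refine Measure.ext_of_lintegral _ fun h hh => ?_
  have hV : Measurable fun z : ℝ => ∫⁻ v in Set.Icc (0 : ℝ) 1, h ((A - z) * v + 0) :=
    Measurable.lintegral_prod_right' (f := fun w : ℝ × ℝ => h ((A - w.1) * w.2 + 0)) (by fun_prop)
  have hVf := hV.comp hf
  simp only [Function.comp_def] at hVf
  have hK : Measurable fun w : ℝ × ℝ => if w.2 ≤ q - e * w.1 then h w.2 else 0 :=
    Measurable.ite (measurableSet_le (by fun_prop) (by fun_prop)) (by fun_prop) measurable_const
  rw [lintegral_trapezoid _ _ hh, lintegral_smul_measure, lintegral_map hh (by fun_prop),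
    lintegral_prod _ (by fun_prop), lintegral_map hV hf, lintegral_linearDensity _ hVf,
    smul_eq_mul, ← lintegral_const_mul _ (by fun_prop)]
  have e1 : ∀ x ∈ Set.Icc (-1 : ℝ) 1, ENNReal.ofReal q * (ENNReal.ofReal (1 - e / q * x) *
      ∫⁻ v in Set.Icc (0 : ℝ) 1, h ((A - (e * x + (A - q))) * v + 0)) =
      ∫⁻ y in Set.Icc (0 : ℝ) 2, if y ≤ q - e * x then h y else 0 := by
    intro x hx
    have hc : A - (e * x + (A - q)) = q - e * x := by ring
    have hc' : q * (1 - e / q * x) = q - e * x := by field_simp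
    have hc0 : 0 ≤ q - e * x := by nlinarith [hx.2]
    have hc2 : q - e * x ≤ 2 := by nlinarith [hx.1]
    rw [← mul_assoc, ← ENNReal.ofReal_mul hq0.le, hc, hc', lintegral_unit_scale hc0 hh,
      ← lintegral_indicator measurableSet_Icc, ← lintegral_indicator measurableSet_Icc]
    refine lintegral_congr fun y => ?_
    simp only [Set.indicator_apply, Set.mem_Icc]
    split_ifs <;> first | rfl | (exfalso; grind)
  rw [setLIntegral_congr_fun measurableSet_Icc e1, lintegral_lintegral_swap hK.aemeasurable]
  refine setLIntegral_congr_fun measurableSet_Icc fun y hy => ?_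
  have e2 : ∀ x : ℝ, (if y ≤ q - e * x then h y else 0) =
      (Set.Iic ((q - y) / e)).indicator (fun _ => h y) x := by
    intro x
    simp only [Set.indicator_apply, Set.mem_Iic, le_div_iff₀ he]
    refine if_congr ?_ rfl rfl
    constructor <;> intro <;> linarith
  simp_rw [e2]
  rw [lintegral_indicator measurableSet_Iic, lintegral_const, Measure.restrict_restrict
    measurableSet_Iic, Measure.restrict_apply MeasurableSet.univ, Set.univ_inter, mul_comm]
  congr 1
  have e3 : Set.Iic ((q - y) / e) ∩ Set.Icc (-1) 1 = Set.Icc (-1) (min 1 ((q - y) / e)) := by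
    ext x
    simp only [Set.mem_inter_iff, Set.mem_Iic, Set.mem_Icc, le_min_iff]
    tauto
  rw [e3, Real.volume_Icc]
  rcases le_total 0 (1 + (q - y) / e) with h0 | h0
  · rw [max_eq_left h0]
    congr 1
    rcases le_total 1 ((q - y) / e) with h1 | h1
    · rw [min_eq_left h1, min_eq_left (by linarith)]; norm_num
    · rw [min_eq_right h1, min_eq_right (by linarith)]; ring
  · rw [max_eq_right h0, min_eq_right (by norm_num), min_eq_right (by linarith),
      ENNReal.ofReal_zero, ENNReal.ofReal_of_nonpos (by linarith)]

lemma map_neg_trapezoid {q e : ℝ} :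
    (trapezoid q e).map (fun x => -1 * x + 2) = (volume.restrict (Set.Icc 0 2)).withDensity
      fun y => ENNReal.ofReal (min 2 (max (1 + (y - (2 - q)) / e) 0)) := by
  have hr : (volume.restrict (Set.Icc (0 : ℝ) 2)).map (fun x => -1 * x + 2) =
      volume.restrict (Set.Icc 0 2) := by
    have h1 := map_neg_restrict 0 2
    have h2 := map_affine_restrict one_pos 2 (-2) (-0)
    rw [← h1, Measure.map_map (by fun_prop) (by fun_prop)] at h2
    simp only [inv_one, ENNReal.ofReal_one, one_smul, Function.comp_def, one_mul] at h2
    rw [show (fun x : ℝ => -1 * x + 2) = fun x => -x + 2 by ext x; ring, h2]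
    norm_num
  refine Measure.ext_of_lintegral _ fun h hh => ?_
  rw [lintegral_map hh (by fun_prop), lintegral_trapezoid _ _ (by fun_prop),
    lintegral_withDensity_eq_lintegral_mul _ (by fun_prop) hh]
  nth_rw 2 [← hr]
  rw [lintegral_map (by fun_prop) (by fun_prop)]
  refine lintegral_congr fun y => ?_
  rw [Pi.mul_apply]
  congr 4
  ring

lemma trapezoid_add {q e : ℝ} :
    trapezoid q e + (volume.restrict (Set.Icc 0 2)).withDensity
      (fun y => ENNReal.ofReal (min 2 (max (1 + (y - q) / e) 0))) =
      (2 : ℝ≥0∞) • volume.restrict (Set.Icc 0 2) := by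
  rw [trapezoid, ← withDensity_add_left (by fun_prop), ← withDensity_const]
  congr 1
  ext1 y
  rw [Pi.add_apply, ← ENNReal.ofReal_add (by positivity) (by positivity)]
  have h : (y - q) / e = -((q - y) / e) := by rw [← neg_div]; congr 1; ring
  rw [h]
  generalize (q - y) / e = u
  have : min 2 (max (1 + u) 0) + min 2 (max (1 + -u) 0) = 2 := by
    rcases max_cases (1 + u) 0 with h1 | h1 <;> rcases max_cases (1 + -u) 0 with h2 | h2 <;>
    rw [h1.1, h2.1] <;>
    first
      | rw [min_eq_right (by linarith), min_eq_right (by linarith)]; linarith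
      | rw [min_eq_left (by linarith), min_eq_right (by linarith)]; linarith
      | rw [min_eq_right (by linarith), min_eq_left (by linarith)]; linarith
      | linarith
  rw [this]
  norm_num

lemma Splits.of_one_le {α β : ℝ} (hα : 1 ≤ α) (hβ : 1 ≤ β) (hd : α + β ≤ 3) :
    Splits (-α) β (-1) 1 := by
  rcases hd.eq_or_lt with hd | hd
  · exact Splits.of_sub_eq (by linarith) (by linarith) (by linarith)
  set A := 3 - α with hA
  set δ := 3 - (α + β) with hδ
  have hδ0 : 0 < δ := by linarith
  have hδ1 : δ ≤ 1 := by linarith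
  have h3 : 0 < 3 - δ := by linarith
  set q := (2 * A - 2 * δ) / (3 - δ) with hq
  have hq3 : q * (3 - δ) = 2 * A - 2 * δ := div_mul_cancel₀ _ h3.ne'
  have hq0 : 0 < q := div_pos (by linarith) h3
  have hq2 : 0 < 2 - q := by
    have : (2 - q) * (3 - δ) = 6 - 2 * A := by linarith
    by_contra! hc
    nlinarith
  have hpos : 0 < δ * q * (2 - q) := by positivity
  set e := √(δ * q * (2 - q)) with he
  have he0 : 0 < e := Real.sqrt_pos.2 hpos
  have he2 : e ^ 2 = δ * q * (2 - q) := Real.sq_sqrt hpos.le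
  have hk : 2 * A - 3 * q = δ * (2 - q) := by linarith
  have hAδ : 1 + δ ≤ A := by linarith
  have hA2 : A ≤ 2 := by linarith
  have b1 : δ * (2 - q) ≤ q := by
    have h1 : 0 ≤ (q * (1 + δ) - 2 * δ) * (3 - δ) := by
      have : (q * (1 + δ) - 2 * δ) * (3 - δ) = (2 * A - 2 * δ) * (1 + δ) - 2 * δ * (3 - δ) := by
        rw [← hq3]; ring
      rw [this]
      nlinarith [sq_nonneg (1 - δ)]
    have := nonneg_of_mul_nonneg_left h1 h3
    linarith
  have b2 : δ * q ≤ 2 - q := by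
    have h1 : 0 ≤ (2 - q * (1 + δ)) * (3 - δ) := by
      have : (2 - q * (1 + δ)) * (3 - δ) = 2 * (3 - δ) - (2 * A - 2 * δ) * (1 + δ) := by
        rw [← hq3]; ring
      rw [this]
      nlinarith [sq_nonneg (1 - δ)]
    have := nonneg_of_mul_nonneg_left h1 h3
    linarith
  have heq : e ≤ q := by
    refine abs_le_of_sq_le_sq' ?_ hq0.le |>.2
    rw [he2]; nlinarith
  have heq2 : e ≤ 2 - q := by
    refine abs_le_of_sq_le_sq' ?_ hq2.le |>.2
    rw [he2]; nlinarith
  have J1 : JointMix A (trapezoid q e) :=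
    jointMix_trapezoid he0 heq (by linarith) (by rw [he2, hk]; ring)
  have J2 : JointMix (3 - β) (trapezoid (2 - q) e) :=
    jointMix_trapezoid he0 heq2 (by linarith) (by
      rw [he2]
      have : 2 * (3 - β) - 3 * (2 - q) = δ * q := by linarith
      rw [this])
  have J2' := J2.affine (-1) 2
  rw [map_neg_trapezoid, sub_sub_cancel] at J2'
  have hs : Splits A (β + 3) 0 2 := by
    have hb : -1 * (3 - β) + 3 * 2 = β + 3 := by ring
    rw [hb] at J2'
    refine ⟨_, _, J1.smul 2⁻¹, J2'.smul 2⁻¹, ?_⟩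
    rw [← smul_add, trapezoid_add, smul_smul, ENNReal.inv_mul_cancel (by norm_num) (by norm_num),
      one_smul]
  have := hs.affine one_pos (-1)
  convert this using 1 <;> (try rw [hA]) <;> ring

lemma JointMix.of_map {Θ : Type*} [MeasurableSpace Θ] (m : Measure Θ) {φ₀ φ₁ φ₂ : Θ → ℝ}
    (h₀ : Measurable φ₀) (h₁ : Measurable φ₁) (h₂ : Measurable φ₂) {σ : ℝ}
    (hσ : ∀ᵐ θ ∂m, φ₀ θ + φ₁ θ + φ₂ θ = σ) :
    JointMix σ (m.map φ₀ + m.map φ₁ + m.map φ₂) := by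
  refine JointMix.of_lintegral m h₀ h₁ h₂ hσ fun h hh => ?_
  rw [lintegral_add_measure, lintegral_add_measure, lintegral_map hh h₀, lintegral_map hh h₁,
    lintegral_map hh h₂, lintegral_add_left (by fun_prop), lintegral_add_left (by fun_prop)]

/-- The centre of the interval `[center α t - t, center α t + t]` in the peeling of `[-1, 1]`. -/
noncomputable def center (α t : ℝ) : ℝ := α / 3 * ((t ^ 3)⁻¹ - 1)

lemma hasDerivAt_center (α : ℝ) {t : ℝ} (ht : t ≠ 0) :
    HasDerivAt (center α) (-(α / t ^ 4)) t := by
  have h := (((hasDerivAt_pow 3 t).inv (pow_ne_zero 3 ht)).sub_const 1).const_mul (α / 3)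
  have e : -(α / t ^ 4) = α / 3 * (-(((3 : ℕ) : ℝ) * t ^ (3 - 1)) / (t ^ 3) ^ 2) := by
    push_cast
    field_simp
  rw [e]
  exact h

/-- The other coordinates of a point with one coordinate at an end of the interval of half-length
`t`. -/
noncomputable def endPoint (α t v : ℝ) : ℝ :=
  if -(α / t ^ 4) < v then center α t - t else center α t + t

lemma integral_endPoint {α t : ℝ} (ht : 0 < t) (h0 : 0 ≤ α) (hα : α ≤ t ^ 4) {h : ℝ → ℝ}
    (hh : Continuous h) :
    ∫ v in (-1 : ℝ)..1, h (endPoint α t v) + h (center α t + t * v) +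
        h (-α - endPoint α t v - (center α t + t * v)) =
      (1 + α / t ^ 4) * h (center α t - t) + (1 - α / t ^ 4) * h (center α t + t) +
        2 * ∫ v in (-1 : ℝ)..1, h (center α t + t * v) := by
  set c := center α t with hc
  set w := α / t ^ 4 with hw
  have hw0 : 0 ≤ w := by positivity
  have hw1 : w ≤ 1 := (div_le_one (by positivity)).2 hα
  have hcw : -α - 3 * c = -(t * w) := by
    rw [hc, hw, center]; field_simp; ring
  have hi : ∀ x y, IntervalIntegrable (fun v => h (c + t * v)) volume x y := fun x y =>
    Continuous.intervalIntegrable (by fun_prop) x y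
  have eL : ∫ v in (-1 : ℝ)..(-w), h (endPoint α t v) + h (c + t * v) +
      h (-α - endPoint α t v - (c + t * v)) =
      ∫ v in (-1 : ℝ)..(-w), h (c + t) + h (c + t * v) + h (c + t * ((-w - 1) - v)) := by
    refine intervalIntegral.integral_congr fun v hv => ?_
    rw [Set.uIcc_of_le (by linarith)] at hv
    have : endPoint α t v = c + t := if_neg (not_lt.2 hv.2)
    simp only [this]
    congr 2
    linarith
  have eR : ∫ v in (-w)..1, h (endPoint α t v) + h (c + t * v) +
      h (-α - endPoint α t v - (c + t * v)) =
      ∫ v in (-w)..1, h (c - t) + h (c + t * v) + h (c + t * ((-w + 1) - v)) := by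
    refine intervalIntegral.integral_congr_ae (ae_of_all _ fun v hv => ?_)
    rw [Set.uIoc_of_le (by linarith)] at hv
    have : endPoint α t v = c - t := if_pos hv.1
    simp only [this]
    congr 2
    linarith
  have iL : IntervalIntegrable (fun v => h (endPoint α t v) + h (c + t * v) +
      h (-α - endPoint α t v - (c + t * v))) volume (-1) (-w) := by
    refine IntervalIntegrable.congr (f := fun v => h (c + t) + h (c + t * v) +
      h (c + t * ((-w - 1) - v))) ?_ (Continuous.intervalIntegrable (by fun_prop) _ _)
    intro v hv
    rw [Set.uIoc_of_le (by linarith)] at hv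
    have : endPoint α t v = c + t := if_neg (not_lt.2 hv.2)
    simp only [this]
    congr 2
    linarith
  have iR : IntervalIntegrable (fun v => h (endPoint α t v) + h (c + t * v) +
      h (-α - endPoint α t v - (c + t * v))) volume (-w) 1 := by
    refine IntervalIntegrable.congr (f := fun v => h (c - t) + h (c + t * v) +
      h (c + t * ((-w + 1) - v))) ?_ (Continuous.intervalIntegrable (by fun_prop) _ _)
    intro v hv
    rw [Set.uIoc_of_le (by linarith)] at hv
    have : endPoint α t v = c - t := if_pos hv.1
    simp only [this]
    congr 2
    linarith
  have hi' : ∀ x y z, IntervalIntegrable (fun v => h (c + t * (z - v))) volume x y := fun x y z =>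
    Continuous.intervalIntegrable (by fun_prop) x y
  have rL := intervalIntegral.integral_comp_sub_left (a := -1) (b := -w)
    (fun v => h (c + t * v)) (-w - 1)
  have rR := intervalIntegral.integral_comp_sub_left (a := -w) (b := 1)
    (fun v => h (c + t * v)) (-w + 1)
  rw [show -w - 1 - -w = -1 by ring, show -w - 1 - -1 = -w by ring] at rL
  rw [show -w + 1 - -w = 1 by ring, show -w + 1 - 1 = -w by ring] at rR
  rw [← intervalIntegral.integral_add_adjacent_intervals iL iR, eL, eR,
    intervalIntegral.integral_add ((intervalIntegrable_const).add (hi _ _)) (hi' _ _ _),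
    intervalIntegral.integral_add intervalIntegrable_const (hi _ _),
    intervalIntegral.integral_add ((intervalIntegrable_const).add (hi _ _)) (hi' _ _ _),
    intervalIntegral.integral_add intervalIntegrable_const (hi _ _), rL, rR,
    ← intervalIntegral.integral_add_adjacent_intervals (hi (-1) (-w)) (hi (-w) 1)]
  simp only [intervalIntegral.integral_const, smul_eq_mul]
  ring

lemma integral_peel {α w : ℝ} (hw : 0 < w) (hw1 : w ≤ 1) (h0 : 0 ≤ α) (hα : α ≤ w ^ 4)
    {h : ℝ → ℝ} (hh : Continuous h) :
    ∫ t in w..1, t ^ 2 * ∫ v in (-1 : ℝ)..1, h (endPoint α t v) + h (center α t + t * v) +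
        h (-α - endPoint α t v - (center α t + t * v)) =
      (∫ x in (-1 : ℝ)..1, h x) - w ^ 2 * ∫ x in (center α w - w)..(center α w + w), h x := by
  set H : ℝ → ℝ := fun x => ∫ y in (0 : ℝ)..x, h y with hH
  have hH' : ∀ x, HasDerivAt H (h x) x := fun x =>
    intervalIntegral.integral_hasDerivAt_right (hh.intervalIntegrable _ _)
      (hh.stronglyMeasurableAtFilter _ _) hh.continuousAt
  have hHs : ∀ x y, ∫ z in x..y, h z = H y - H x := fun x y =>
    (intervalIntegral.integral_interval_sub_left (hh.intervalIntegrable _ _)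
      (hh.intervalIntegrable _ _)).symm
  set G : ℝ → ℝ := fun t => 2 * t * (H (center α t + t) - H (center α t - t)) +
    t ^ 2 * (h (center α t + t) * (-(α / t ^ 4) + 1) - h (center α t - t) * (-(α / t ^ 4) - 1))
    with hG
  have hpos : ∀ t ∈ Set.uIcc w 1, 0 < t := fun t ht => by
    rw [Set.uIcc_of_le hw1] at ht
    exact hw.trans_le ht.1
  have e1 : ∀ t ∈ Set.uIcc w 1, (t ^ 2 * ∫ v in (-1 : ℝ)..1, h (endPoint α t v) +
      h (center α t + t * v) + h (-α - endPoint α t v - (center α t + t * v))) = G t := by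
    intro t ht
    have ht0 := hpos t ht
    rw [Set.uIcc_of_le hw1] at ht
    have e : t * ∫ v in (-1 : ℝ)..1, h (center α t + t * v) =
        H (center α t + t) - H (center α t - t) := by
      have := intervalIntegral.mul_integral_comp_mul_add (f := h) (a := -1) (b := 1) t (center α t)
      rw [hHs] at this
      simp only [add_comm (center α t)]
      rw [this]
      congr 2 <;> ring
    rw [integral_endPoint ht0 h0 (hα.trans (pow_le_pow_left₀ hw.le ht.1 4)) hh, hG]
    simp only
    rw [← e]
    ring
  rw [intervalIntegral.integral_congr e1]
  have hd : ∀ t ∈ Set.uIcc w 1, HasDerivAt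
      (fun t => t ^ 2 * (H (center α t + t) - H (center α t - t))) (G t) t := by
    intro t ht
    have hc := hasDerivAt_center α (hpos t ht).ne'
    have h1 : HasDerivAt (fun t => H (center α t + t))
        (h (center α t + t) * (-(α / t ^ 4) + 1)) t :=
      HasDerivAt.comp (h₂ := H) (h := fun t => center α t + t) t (hH' (center α t + t))
        (hc.add (hasDerivAt_id t))
    have h2 : HasDerivAt (fun t => H (center α t - t))
        (h (center α t - t) * (-(α / t ^ 4) - 1)) t :=
      HasDerivAt.comp (h₂ := H) (h := fun t => center α t - t) t (hH' (center α t - t))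
        (hc.sub (hasDerivAt_id t))
    have := (hasDerivAt_pow 2 t).mul (h1.sub h2)
    rw [show ((2 : ℕ) : ℝ) * t ^ (2 - 1) = 2 * t by norm_num] at this
    exact this
  have hcc : ContinuousOn (center α) (Set.uIcc w 1) := fun t ht =>
    (hasDerivAt_center α (hpos t ht).ne').continuousAt.continuousWithinAt
  have hHc : Continuous H := continuous_iff_continuousAt.2 fun x => (hH' x).continuousAt
  have hGc : ContinuousOn G (Set.uIcc w 1) := by
    have h4 : ContinuousOn (fun t : ℝ => α / t ^ 4) (Set.uIcc w 1) :=
      continuousOn_const.div (by fun_prop) fun t ht => pow_ne_zero 4 (hpos t ht).ne'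
    have a1 := hHc.comp_continuousOn (hcc.add continuousOn_id)
    have a2 := hHc.comp_continuousOn (hcc.sub continuousOn_id)
    have a3 := hh.comp_continuousOn (hcc.add continuousOn_id)
    have a4 := hh.comp_continuousOn (hcc.sub continuousOn_id)
    exact ((continuousOn_const.mul continuousOn_id).mul (a1.sub a2)).add
      ((continuousOn_id.pow 2).mul ((a3.mul (h4.neg.add continuousOn_const)).sub
        (a4.mul (h4.neg.sub continuousOn_const))))
  rw [intervalIntegral.integral_eq_sub_of_hasDerivAt hd hGc.intervalIntegrable, hHs, hHs]
  simp [center]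

lemma measurable_center (α : ℝ) : Measurable (center α) := by
  unfold center
  fun_prop

lemma measurable_endPoint (α : ℝ) : Measurable fun p : ℝ × ℝ => endPoint α p.1 p.2 := by
  have := measurable_center α
  refine Measurable.ite (measurableSet_lt ?_ measurable_snd) ?_ ?_ <;> fun_prop

/-- The mixture of the peeled layers of `[-1, 1]` is jointly mixable with sum `-α`. -/
lemma exists_jointMix_peel {α w : ℝ} (hw : 0 < w) (hw1 : w ≤ 1) (h0 : 0 ≤ α) (hα : α ≤ w ^ 4) :
    ∃ ν, JointMix (-α) ν ∧ ν + ENNReal.ofReal (w ^ 2) •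
      volume.restrict (Set.Icc (center α w - w) (center α w + w)) =
      volume.restrict (Set.Icc (-1) 1) := by
  have hm2 : Measurable fun t : ℝ => ENNReal.ofReal (t ^ 2) := by fun_prop
  set m₁ : Measure ℝ := (volume.restrict (Set.Icc w 1)).withDensity
    (fun t => ENNReal.ofReal (t ^ 2)) with hm₁
  have : IsFiniteMeasure m₁ := by
    refine isFiniteMeasure_withDensity_ofReal ?_
    exact (ContinuousOn.integrableOn_compact isCompact_Icc (by fun_prop)).2
  set m := m₁.prod (volume.restrict (Set.Icc (-1 : ℝ) 1)) with hm
  set φ₀ : ℝ × ℝ → ℝ := fun p => endPoint α p.1 p.2 with hφ₀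
  set φ₁ : ℝ × ℝ → ℝ := fun p => center α p.1 + p.1 * p.2 with hφ₁
  set φ₂ : ℝ × ℝ → ℝ := fun p => -α - endPoint α p.1 p.2 - (center α p.1 + p.1 * p.2) with hφ₂
  have h₀ : Measurable φ₀ := measurable_endPoint α
  have hc := measurable_center α
  have h₁ : Measurable φ₁ := by fun_prop
  have h₂ : Measurable φ₂ := (measurable_const.sub h₀).sub h₁
  refine ⟨m.map φ₀ + m.map φ₁ + m.map φ₂, JointMix.of_map m h₀ h₁ h₂
    (ae_of_all _ fun p => by simp only [hφ₀, hφ₁, hφ₂]; ring), ?_⟩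
  have : IsFiniteMeasure (ENNReal.ofReal (w ^ 2) •
      volume.restrict (Set.Icc (center α w - w) (center α w + w))) :=
    Measure.smul_finite _ ENNReal.ofReal_ne_top
  refine ext_of_forall_integral_eq_of_IsFiniteMeasure fun h => ?_
  have i : ∀ (μ : Measure ℝ) [IsFiniteMeasure μ], Integrable h μ := fun μ _ => h.integrable μ
  have j : ∀ φ : ℝ × ℝ → ℝ, Measurable φ → Integrable (fun p => h (φ p)) m := fun φ hφ =>
    (integrable_map_measure h.continuous.aestronglyMeasurable hφ.aemeasurable).1 (i (m.map φ))
  have e : ∫ p, h (φ₀ p) + h (φ₁ p) + h (φ₂ p) ∂m = ∫ t in w..1, t ^ 2 * ∫ v in (-1 : ℝ)..1,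
      h (endPoint α t v) + h (center α t + t * v) +
        h (-α - endPoint α t v - (center α t + t * v)) := by
    rw [hm, integral_prod (fun p => h (φ₀ p) + h (φ₁ p) + h (φ₂ p))
        (((j φ₀ h₀).add (j φ₁ h₁)).add (j φ₂ h₂)), hm₁,
      integral_withDensity_eq_integral_toReal_smul hm2 (by simp), integral_Icc_eq_integral_Ioc,
      ← intervalIntegral.integral_of_le hw1]
    simp only [integral_Icc_eq_integral_Ioc, smul_eq_mul,
      ← intervalIntegral.integral_of_le (show (-1 : ℝ) ≤ 1 by norm_num),
      ENNReal.toReal_ofReal (sq_nonneg _)]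
    rfl
  rw [integral_add (f := fun p => h (φ₀ p) + h (φ₁ p)) (((j φ₀ h₀).add (j φ₁ h₁))) (j φ₂ h₂), integral_add (j φ₀ h₀) (j φ₁ h₁),
    integral_peel hw hw1 h0 hα h.continuous] at e
  rw [integral_add_measure (i _) (i _), integral_add_measure (i _) (i _),
    integral_add_measure (i _) (i _), integral_map h₀.aemeasurable
      h.continuous.aestronglyMeasurable, integral_map h₁.aemeasurable
      h.continuous.aestronglyMeasurable, integral_map h₂.aemeasurable
      h.continuous.aestronglyMeasurable, e, integral_smul_measure,
    integral_Icc_eq_integral_Ioc, integral_Icc_eq_integral_Ioc,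
    ← intervalIntegral.integral_of_le (show (-1 : ℝ) ≤ 1 by norm_num),
    ← intervalIntegral.integral_of_le (show center α w - w ≤ center α w + w by linarith),
    ENNReal.toReal_ofReal (sq_nonneg _), smul_eq_mul]
  ring

lemma Splits.of_le_one_of_one_le {α β : ℝ} (hα : 0 ≤ α) (hα1 : α ≤ 1) (hβ : 1 ≤ β)
    (hd : α + β ≤ 3) : Splits (-α) β (-1) 1 := by
  rcases hα.eq_or_lt with rfl | hα0
  · exact Splits.of_left (by norm_num) (by norm_num)
  set u := √√α with hu
  have hu0 : 0 < u := Real.sqrt_pos.2 (Real.sqrt_pos.2 hα0)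
  have hu4 : u ^ 4 = α := by
    rw [show u ^ 4 = (u ^ 2) ^ 2 by ring, hu, Real.sq_sqrt (Real.sqrt_nonneg _), Real.sq_sqrt hα]
  have hu1 : u ≤ 1 := by
    by_contra h
    have := one_lt_pow₀ (not_le.1 h) (n := 4) (by norm_num)
    linarith
  set w := max u ((α + β) / 3) with hw
  have huw : u ≤ w := le_max_left _ _
  have hw0 : 0 < w := hu0.trans_le huw
  have hw1 : w ≤ 1 := max_le hu1 (by linarith)
  have hαw : α ≤ w ^ 4 := by
    rw [← hu4]
    exact pow_le_pow_left₀ hu0.le huw 4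
  have hdw : α + β ≤ 3 * w := by
    have := le_max_right u ((α + β) / 3)
    linarith
  obtain ⟨ν, hν, hsum⟩ := exists_jointMix_peel hw0 hw1 hα hαw
  set α' := α / w ^ 4 with hα'
  have hα'0 : 0 ≤ α' := by positivity
  have hα'1 : α' ≤ 1 := (div_le_one (by positivity)).2 hαw
  have key : Splits (-α') ((α + β) / w - α') (-1) 1 := by
    rcases le_total ((α + β) / 3) u with h | h
    · have hwu : w = u := max_eq_left h
      have e : α' = 1 := by rw [hα', hwu, hu4, div_self hα0.ne']
      have h3 : (α + β) / w ≤ 3 := (div_le_iff₀ hw0).2 hdw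
      have h1 : 1 ≤ (α + β) / w := (le_div_iff₀ hw0).2 (by linarith)
      rcases le_total ((α + β) / w - α') 1 with h' | h'
      · exact Splits.of_le_one hα'0 hα'1 (by linarith) h'
      · exact Splits.of_one_le e.ge h' (by linarith)
    · have hwd : w = (α + β) / 3 := max_eq_right h
      have e : (α + β) / w = 3 := by rw [hwd]; field_simp
      rw [e]
      exact Splits.of_sub_eq (by ring) (by linarith) (by linarith)
  have e₁ : w * -α' + 3 * center α w = -α := by
    rw [hα', center]; field_simp; ring
  have e₂ : w * ((α + β) / w - α') + 3 * center α w = β := by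
    rw [mul_sub, mul_div_cancel₀ _ hw0.ne']
    linarith
  have := key.affine hw0 (center α w)
  rw [e₁, e₂] at this
  obtain ⟨ν₁, ν₂, h₁, h₂, h⟩ := this
  refine ⟨ν + ENNReal.ofReal (w ^ 2) • ν₁, ENNReal.ofReal (w ^ 2) • ν₂, hν.add (h₁.smul _),
    h₂.smul _, ?_⟩
  rw [add_assoc, ← smul_add, h, ← hsum]
  ring_nf

lemma Splits.of_add_le {α β : ℝ} (hα : 0 ≤ α) (hβ : 0 ≤ β) (hd : α + β ≤ 3) :
    Splits (-α) β (-1) 1 := by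
  rcases le_total α 1 with h | h <;> rcases le_total β 1 with h' | h'
  · exact .of_le_one hα h hβ h'
  · exact .of_le_one_of_one_le hα h h' hd
  · simpa using (Splits.of_le_one_of_one_le hβ h' h (by linarith)).neg.symm
  · exact .of_one_le h h' hd

lemma twoPoint_three : TwoPoint 3 := by
  intro l r y z a b hlr ha hb hab hm hyz hzy
  rcases hlr.eq_or_lt with rfl | hlr
  · obtain rfl : a = 0 := by linarith
    obtain rfl : b = 0 := by linarith
    refine ⟨0, ?_, ?_⟩ <;> simp
  have hl : 0 < r - l := sub_pos.2 hlr
  have hlin : a * y + b * z = (a + b) * ((l + r) / 2) := by rw [hm, hab]; ring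
  have hy : y ≤ (l + r) / 2 := by
    by_contra! h
    nlinarith [mul_nonneg hb (sub_nonneg.2 hyz)]
  have hz : (l + r) / 2 ≤ z := by
    by_contra! h
    nlinarith [mul_nonneg ha (sub_nonneg.2 hyz)]
  set s := (r - l) / 2 with hs
  have hs0 : 0 < s := by positivity
  have key := (Splits.of_add_le (α := 3 * ((l + r) / 2 - y) / s) (β := 3 * (z - (l + r) / 2) / s)
    (div_nonneg (by linarith) hs0.le) (div_nonneg (by linarith) hs0.le) (by
      rw [← add_div, div_le_iff₀ hs0]; linarith)).affine hs0 ((l + r) / 2)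
  have e₁ : s * -(3 * ((l + r) / 2 - y) / s) + 3 * ((l + r) / 2) = 3 * y := by
    field_simp; ring
  have e₂ : s * (3 * (z - (l + r) / 2) / s) + 3 * ((l + r) / 2) = 3 * z := by
    field_simp; ring
  rw [e₁, e₂, show s * -1 + (l + r) / 2 = l by rw [hs]; ring,
    show s * 1 + (l + r) / 2 = r by rw [hs]; ring] at key
  obtain ⟨ν₁, ν₂, ⟨m₁, h₁⟩, ⟨m₂, h₂⟩, hν⟩ := key
  have h := h₁.add h₂
  rw [hν, mul_div_cancel_left₀ _ (by norm_num), mul_div_cancel_left₀ _ (by norm_num)] at h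
  have hu := h.univ_eq (by norm_num)
  simp only [Measure.add_apply, Measure.smul_apply, measure_univ, smul_eq_mul, mul_one,
    Measure.restrict_apply_univ, Real.volume_Icc] at hu
  have hi := h.integral_eq (by norm_num)
    (ContinuousOn.integrableOn_compact isCompact_Icc continuousOn_id)
  have hm₁ : m₁ ≠ ⊤ := fun e => by simp [e] at hu
  have hm₂ : m₂ ≠ ⊤ := fun e => by simp [e] at hu
  lift m₁ to NNReal using hm₁
  lift m₂ to NNReal using hm₂
  have hd : ∀ (m : NNReal) (x : ℝ), Integrable (fun x : ℝ => x) ((m : ℝ≥0∞) • Measure.dirac x) :=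
    fun m x => (integrable_dirac (by simp)).smul_measure ENNReal.coe_ne_top
  rw [integral_add_measure (hd _ _) (hd _ _), integral_smul_measure, integral_smul_measure,
    integral_dirac, integral_dirac, integral_Icc_eq_integral_Ioc,
    ← intervalIntegral.integral_of_le hlr.le, integral_id] at hi
  simp only [ENNReal.coe_toReal, smul_eq_mul] at hi
  have hu' : (m₁ : ℝ) + m₂ = r - l := by
    have := congrArg ENNReal.toReal hu
    rwa [ENNReal.toReal_ofReal hl.le, ENNReal.toReal_add (by simp) (by simp)] at this
  rcases hyz.eq_or_lt with rfl | hyz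
  · rw [← add_smul, hu] at h
    rwa [← add_smul, ← ENNReal.ofReal_add ha hb, hab]
  · have e₂ : (m₂ : ℝ) = b := by
      have : (m₂ - b) * (z - y) = 0 := by linear_combination hi - hm - y * hu' + y * hab
      rcases mul_eq_zero.1 this with h | h <;> linarith
    have e₁ : (m₁ : ℝ) = a := by linarith
    rwa [← e₁, ← e₂, ENNReal.ofReal_coe_nnreal, ENNReal.ofReal_coe_nnreal]

section

open Filter Topology BoundedContinuousFunction

lemma MeanLaw.of_tendsto {n : ℕ} (hn : n ≠ 0) {ν G : Measure ℝ} [IsProbabilityMeasure ν]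
    [IsFiniteMeasure G] {l r : ℝ} (hν : ν (Set.Icc l r)ᶜ = 0) {F : ℕ → Measure ℝ}
    (hF : ∀ N, MeanLaw n ν (F N))
    (h : ∀ f : ℝ →ᵇ ℝ, Tendsto (fun N => ∫ x, f x ∂(F N)) atTop (𝓝 (∫ x, f x ∂G))) :
    MeanLaw n ν G := by
  choose μ h1 h2 using hF
  have hn' : (n : ℝ≥0∞) ≠ 0 := by exact_mod_cast hn
  have hprob : ∀ N, IsProbabilityMeasure (μ N) := by
    intro N
    have := congrArg (fun m : Measure ℝ => m Set.univ) (h1 N)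
    simp only [Measure.coe_finsetSum, Finset.sum_apply, Measure.smul_apply, smul_eq_mul,
      Measure.map_apply (measurable_pi_apply _) MeasurableSet.univ, Set.preimage_univ,
      Finset.sum_const, Finset.card_univ, Fintype.card_fin, nsmul_eq_mul, measure_univ] at this
    exact ⟨(ENNReal.mul_right_inj hn' (by simp)).1 this⟩
  have hcoord : ∀ N i, μ N {x | x i ∉ Set.Icc l r} = 0 := by
    intro N i
    have := congrArg (fun m : Measure ℝ => m (Set.Icc l r)ᶜ) (h1 N)
    simp only [Measure.coe_finsetSum, Finset.sum_apply, Measure.smul_apply, smul_eq_mul, hν,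
      mul_zero, Measure.map_apply (measurable_pi_apply _) measurableSet_Icc.compl,
      Finset.sum_eq_zero_iff] at this
    exact this i (Finset.mem_univ i)
  have hcube : ∀ N, μ N (Set.Icc (fun _ => l) (fun _ => r))ᶜ = 0 := by
    intro N
    refine measure_mono_null ?_ (measure_iUnion_null (hcoord N))
    intro x hx
    simp only [Set.mem_iUnion, Set.mem_ofPred_eq]
    by_contra! h'
    exact hx ⟨fun i => (h' i).1, fun i => (h' i).2⟩
  set u : ℕ → ProbabilityMeasure (Fin n → ℝ) := fun N => ⟨μ N, hprob N⟩ with hu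
  have hcomp : IsCompact (closure (Set.range u)) := by
    refine isCompact_closure_of_isTightMeasureSet ?_
    rw [isTightMeasureSet_iff_exists_isCompact_measure_compl_le]
    refine fun ε hε => ⟨Set.Icc (fun _ => l) (fun _ => r), isCompact_Icc, ?_⟩
    rintro _ ⟨_, ⟨N, rfl⟩, rfl⟩
    exact (hcube N).le.trans zero_le
  obtain ⟨P, -, hP⟩ := hcomp.ultrafilter_le_nhds ((hyperfilter ℕ).map u) (by
    refine le_principal_iff.2 (mem_map.2 (univ_mem' fun N => subset_closure ⟨N, rfl⟩)))
  have hlim : ∀ f : (Fin n → ℝ) →ᵇ ℝ,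
      Tendsto (fun N => ∫ x, f x ∂(μ N)) (hyperfilter ℕ) (𝓝 (∫ x, f x ∂(P : Measure _))) :=
    ProbabilityMeasure.tendsto_iff_forall_integral_tendsto.1
      (show Tendsto u (hyperfilter ℕ) (𝓝 P) from hP)
  refine ⟨P, ?_, ?_⟩
  · have : IsFiniteMeasure ((n : ℝ≥0∞) • ν) := Measure.smul_finite _ (by simp)
    refine ext_of_forall_integral_eq_of_IsFiniteMeasure fun f => ?_
    have e : ∀ Q : Measure (Fin n → ℝ), IsProbabilityMeasure Q →
        ∫ x, f x ∂(∑ i, Q.map fun x => x i) = ∑ i, ∫ x, f (x i) ∂Q := by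
      intro Q hQ
      rw [integral_finsetSum_measure]
      · exact Finset.sum_congr rfl fun i _ => integral_map (measurable_pi_apply i).aemeasurable
          f.continuous.aestronglyMeasurable
      · exact fun i _ => f.integrable _
    rw [e _ inferInstance]
    refine tendsto_nhds_unique (tendsto_finsetSum _ fun i _ => hlim
      (f.compContinuous ⟨fun x => x i, continuous_apply i⟩)) ?_
    refine tendsto_const_nhds.congr fun N => ?_
    rw [← h1 N, e _ (hprob N)]
    rfl
  · have hm : Measurable fun x : Fin n → ℝ => (∑ i, x i) / (n : ℝ) := by fun_prop
    refine ext_of_forall_integral_eq_of_IsFiniteMeasure fun f => ?_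
    rw [integral_map hm.aemeasurable f.continuous.aestronglyMeasurable]
    refine tendsto_nhds_unique (hlim (f.compContinuous
      ⟨fun x => (∑ i, x i) / (n : ℝ), by fun_prop⟩))
      (((h f).mono_left Nat.hyperfilter_le_atTop).congr fun N => ?_)
    rw [← h2 N, integral_map hm.aemeasurable f.continuous.aestronglyMeasurable]
    rfl

lemma meanLaw_of_finset {n : ℕ} (H : TwoPoint n) {ι : Type*} (t : Finset ι) (w y : ι → ℝ)
    {l r : ℝ} (hlr : l ≤ r) (hw : ∀ i ∈ t, 0 ≤ w i) (mass : ∑ i ∈ t, w i = r - l)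
    (mean : ∑ i ∈ t, w i * y i = (r ^ 2 - l ^ 2) / 2)
    (loss : ∀ k, ∑ i ∈ t, w i * max (y i - k) 0 ≤ stopLoss l r k) :
    MeanLaw n (volume.restrict (Set.Icc l r))
      (∑ i ∈ t, ENNReal.ofReal (w i) • Measure.dirac (y i)) := by
  set p : ℝ → ℝ := fun v => ∑ i ∈ t with y i = v, w i with hp
  have hmaps : ∀ i ∈ t, y i ∈ t.image y := fun i hi => Finset.mem_image_of_mem y hi
  have key : ∀ g : ℝ → ℝ, ∑ v ∈ t.image y, p v * g v = ∑ i ∈ t, w i * g (y i) := by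
    intro g
    rw [← Finset.sum_fiberwise_of_maps_to hmaps]
    refine Finset.sum_congr rfl fun v _ => ?_
    rw [hp, Finset.sum_mul]
    refine Finset.sum_congr rfl fun i hi => ?_
    rw [(Finset.mem_filter.1 hi).2]
  have D : DiscreteDom l r (t.image y) p :=
    ⟨fun v _ => Finset.sum_nonneg fun i hi => hw i (Finset.mem_filter.1 hi).1,
      by simpa using (key fun _ => 1).trans (by simpa using mass), (key fun v => v).trans mean,
      fun k => (key fun v => max (v - k) 0).trans_le (loss k)⟩
  convert D.meanLaw H (t.image y).card l r _ p hlr le_rfl using 1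
  rw [discreteMeasure, ← Finset.sum_fiberwise_of_maps_to hmaps]
  refine Finset.sum_congr rfl fun v _ => ?_
  rw [hp, ENNReal.ofReal_sum_of_nonneg fun i hi => hw i (Finset.mem_filter.1 hi).1,
    Finset.sum_smul]
  refine Finset.sum_congr rfl fun i hi => ?_
  rw [(Finset.mem_filter.1 hi).2]

/-- The points `x` with `j ≤ N * x < j + 1`; those with `N * x < 0` are put into the first cell. -/
def cell (N j : ℕ) : Set ℝ := {x | ⌊(N : ℝ) * x⌋₊ = j}

lemma measurableSet_cell (N j : ℕ) : MeasurableSet (cell N j) :=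
  (Nat.measurable_floor.comp (measurable_const_mul (N : ℝ))) (measurableSet_singleton j)

/-- The barycentre of `G` on a cell. -/
noncomputable def barycenter (G : Measure ℝ) (N j : ℕ) : ℝ :=
  if G.real (cell N j) = 0 then j / N else (∫ x in cell N j, x ∂G) / G.real (cell N j)

section Cells

variable {G : Measure ℝ}

lemma real_mul_barycenter [IsFiniteMeasure G] (N j : ℕ) :
    G.real (cell N j) * barycenter G N j = ∫ x in cell N j, x ∂G := by
  rw [barycenter]
  split_ifs with h
  · rw [h, zero_mul, setIntegral_measure_zero _ ((measureReal_eq_zero_iff).1 h)]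
  · exact mul_div_cancel₀ _ h

lemma integral_eq_sum_cell (hG : ∀ᵐ x ∂G, x ∈ Set.Icc (0 : ℝ) 1) (N : ℕ) {g : ℝ → ℝ}
    (hg : Integrable g G) :
    ∫ x, g x ∂G = ∑ j ∈ Finset.range (N + 1), ∫ x in cell N j, g x ∂G := by
  rw [← integral_biUnion_finset _ (fun j _ => measurableSet_cell N j) _ fun _ _ => hg.integrableOn]
  · have : G.restrict (⋃ j ∈ Finset.range (N + 1), cell N j) = G := by
      rw [Measure.restrict_eq_self_of_ae_mem]
      filter_upwards [hG] with x hx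
      simp only [Set.mem_iUnion, Finset.mem_range]
      refine ⟨_, Nat.lt_succ_of_le (Nat.floor_le_of_le ?_), rfl⟩
      exact mul_le_of_le_one_right (Nat.cast_nonneg N) hx.2
    rw [this]
  · intro i _ j _ hij
    exact Set.disjoint_left.2 fun x hx hx' => hij (hx.symm.trans hx')

lemma abs_barycenter_sub_le [IsFiniteMeasure G] (hG : ∀ᵐ x ∂G, x ∈ Set.Icc (0 : ℝ) 1) {N : ℕ} (hN : 0 < N) {x : ℝ}
    (hx : x ∈ Set.Icc (0 : ℝ) 1) :
    |barycenter G N ⌊(N : ℝ) * x⌋₊ - x| ≤ 1 / N := by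
  have hN' : (0 : ℝ) < N := by exact_mod_cast hN
  have hcell : ∀ (j : ℕ) (z : ℝ), 0 ≤ z → z ∈ cell N j → (j : ℝ) / N ≤ z ∧ z ≤ (j + 1) / N := by
    intro j z hz hzj
    have := (Nat.floor_eq_iff (mul_nonneg hN'.le hz)).1 hzj
    exact ⟨(div_le_iff₀' hN').2 this.1, (le_div_iff₀' hN').2 this.2.le⟩
  set j := ⌊(N : ℝ) * x⌋₊ with hj
  have h1 := hcell j x hx.1 rfl
  have hi : Integrable (fun x : ℝ => x) G :=
    Integrable.of_mem_Icc 0 1 measurable_id.aemeasurable hG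
  have h2 : (j : ℝ) / N ≤ barycenter G N j ∧ barycenter G N j ≤ (j + 1) / N := by
    rw [barycenter]
    split_ifs with h
    · exact ⟨le_rfl, by gcongr; linarith⟩
    · have hp : 0 < G.real (cell N j) := lt_of_le_of_ne measureReal_nonneg (Ne.symm h)
      have hc : ∀ c : ℝ, ∫ _ in cell N j, c ∂G = c * G.real (cell N j) := fun c => by
        rw [setIntegral_const, smul_eq_mul, mul_comm]
      constructor
      · rw [le_div_iff₀ hp, ← hc]
        refine setIntegral_mono_on_ae (by simp) hi.integrableOn (measurableSet_cell N j) ?_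
        filter_upwards [hG] with z hz hzj using (hcell j z hz.1 hzj).1
      · rw [div_le_iff₀ hp, ← hc]
        refine setIntegral_mono_on_ae hi.integrableOn (by simp) (measurableSet_cell N j) ?_
        filter_upwards [hG] with z hz hzj using (hcell j z hz.1 hzj).2
  have h3 : ((j : ℝ) + 1) / N = j / N + 1 / N := add_div _ _ _
  rw [abs_le]
  constructor <;> linarith [h1.1, h1.2, h2.1, h2.2]

lemma tendsto_integral_barycenter [IsFiniteMeasure G] (hG : ∀ᵐ x ∂G, x ∈ Set.Icc (0 : ℝ) 1) (f : ℝ →ᵇ ℝ) :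
    Tendsto (fun N : ℕ => ∫ x, f x ∂(∑ j ∈ Finset.range (N + 1 + 1),
      ENNReal.ofReal (G.real (cell (N + 1) j)) • Measure.dirac (barycenter G (N + 1) j)))
      atTop (𝓝 (∫ x, f x ∂G)) := by
  have hm : ∀ N : ℕ, Measurable fun x : ℝ => barycenter G N ⌊(N : ℝ) * x⌋₊ := fun N =>
    (measurable_from_nat (f := barycenter G N)).comp
      (Nat.measurable_floor.comp (measurable_const_mul (N : ℝ)))
  have hms : ∀ N : ℕ, AEStronglyMeasurable (fun x : ℝ => f (barycenter G N ⌊(N : ℝ) * x⌋₊)) G :=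
    fun N => (f.continuous.measurable.comp (hm N)).aestronglyMeasurable
  have hint : ∀ N : ℕ, Integrable (fun x : ℝ => f (barycenter G N ⌊(N : ℝ) * x⌋₊)) G := fun N =>
    Integrable.of_bound (hms N) ‖f‖ (ae_of_all _ fun x => f.norm_coe_le_norm _)
  have e : ∀ N : ℕ, ∫ x, f x ∂(∑ j ∈ Finset.range (N + 1),
      ENNReal.ofReal (G.real (cell N j)) • Measure.dirac (barycenter G N j)) =
      ∫ x, f (barycenter G N ⌊(N : ℝ) * x⌋₊) ∂G := by
    intro N
    rw [integral_eq_sum_cell hG N (hint N), integral_finsetSum_measure]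
    · refine Finset.sum_congr rfl fun j _ => ?_
      rw [integral_smul_measure, integral_dirac, ENNReal.toReal_ofReal measureReal_nonneg,
        ← setIntegral_const]
      refine setIntegral_congr_fun (measurableSet_cell N j) fun x hx => ?_
      rw [show ⌊(N : ℝ) * x⌋₊ = j from hx]
    · exact fun j _ => (integrable_dirac (by simp)).smul_measure ENNReal.ofReal_ne_top
  simp_rw [e]
  refine tendsto_integral_of_dominated_convergence (fun _ => ‖f‖) (fun N => hms (N + 1))
    (integrable_const _) (fun N => ae_of_all _ fun x => f.norm_coe_le_norm _) ?_
  filter_upwards [hG] with x hx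
  refine (f.continuous.tendsto x).comp ?_
  rw [tendsto_iff_dist_tendsto_zero]
  refine squeeze_zero (fun _ => dist_nonneg) (fun N => ?_)
    (tendsto_one_div_add_atTop_nhds_zero_nat (𝕜 := ℝ))
  have := abs_barycenter_sub_le hG N.succ_pos hx
  rw [Real.dist_eq]
  push_cast at this ⊢
  exact this

end Cells

lemma meanLaw_of_stopLoss {n : ℕ} (hn : n ≠ 0) (H : TwoPoint n) {G : Measure ℝ}
    [IsProbabilityMeasure G] (hG : ∀ᵐ x ∂G, x ∈ Set.Icc (0 : ℝ) 1) (mean : ∫ x, x ∂G = 1 / 2)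
    (loss : ∀ k, ∫ x, max (x - k) 0 ∂G ≤ stopLoss 0 1 k) :
    MeanLaw n (volume.restrict (Set.Icc 0 1)) G := by
  have : IsProbabilityMeasure (volume.restrict (Set.Icc (0 : ℝ) 1)) := ⟨by simp⟩
  have hi : Integrable (fun x : ℝ => x) G :=
    Integrable.of_mem_Icc 0 1 measurable_id.aemeasurable hG
  refine MeanLaw.of_tendsto hn (l := 0) (r := 1) (by simp [measurableSet_Icc.compl])
    (fun N => ?_) (tendsto_integral_barycenter hG)
  refine meanLaw_of_finset H _ (fun j => G.real (cell (N + 1) j)) (barycenter G (N + 1))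
    zero_le_one (fun _ _ => measureReal_nonneg) ?_ ?_ fun k => ?_
  · have := integral_eq_sum_cell hG (N + 1) (integrable_const (1 : ℝ))
    simpa [-Finset.sum_apply] using this.symm
  · simp_rw [real_mul_barycenter]
    rw [← integral_eq_sum_cell hG (N + 1) hi, mean]
    norm_num
  · refine le_trans ?_ (loss k)
    have hk : Integrable (fun x : ℝ => max (x - k) 0) G := (hi.sub (integrable_const k)).pos_part
    rw [integral_eq_sum_cell hG (N + 1) hk]
    refine Finset.sum_le_sum fun j _ => ?_
    rw [mul_max_of_nonneg _ _ measureReal_nonneg, mul_zero, mul_sub, real_mul_barycenter]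
    refine max_le ?_ (integral_nonneg fun x => le_max_right _ _)
    have : G.real (cell (N + 1) j) * k = ∫ _ in cell (N + 1) j, k ∂G := by
      rw [setIntegral_const, smul_eq_mul]
    rw [this, ← integral_sub hi.integrableOn (by simp)]
    exact setIntegral_mono_on (hi.integrableOn.sub (by simp)) hk.integrableOn
      (measurableSet_cell _ _) fun x _ => le_max_left _ _

end

/-- Two laws with a common image are the marginals of a coupling that respects the common image. -/
lemma exists_coupling {α β : Type*} [MeasurableSpace α] [MeasurableSpace β]
    [StandardBorelSpace β] [Nonempty β] (ν : Measure α) [IsFiniteMeasure ν] (μ : Measure β) [IsFiniteMeasure μ]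
    {f : α → ℝ} {g : β → ℝ} (hf : Measurable f) (hg : Measurable g) (h : ν.map f = μ.map g) :
    ∃ π : Measure (α × β), π.map Prod.fst = ν ∧ π.map Prod.snd = μ ∧ ∀ᵐ p ∂π, f p.1 = g p.2 := by
  set κ : Kernel ℝ β := condDistrib id g μ with hκ
  have e : (ν ⊗ₘ κ.comap f hf).map (Prod.map f id) = μ.map fun b => (g b, b) := by
    have hm : Measurable (Prod.map f (id : β → β)) := hf.prodMap measurable_id
    refine Eq.trans ?_ (compProd_map_condDistrib (X := g) measurable_id.aemeasurable)
    rw [← h]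
    refine Measure.ext_of_lintegral _ fun F hF => ?_
    rw [lintegral_map hF hm, 
      Measure.lintegral_compProd (f := fun a => F (Prod.map f id a)) (hF.comp hm),
       Measure.lintegral_compProd hF,
      lintegral_map hF.lintegral_kernel_prod_right' hf]
    rfl
  refine ⟨ν ⊗ₘ κ.comap f hf, Measure.fst_compProd ν _, ?_, ?_⟩
  · have := congrArg (Measure.map Prod.snd) e
    rw [Measure.map_map measurable_snd (by fun_prop), Measure.map_map measurable_snd
      (by fun_prop)] at this
    simpa [Function.comp_def] using this
  · have hs : MeasurableSet {p : ℝ × β | p.1 = g p.2} := 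
      measurableSet_eq_fun measurable_fst (hg.comp measurable_snd)
    have : ∀ᵐ p ∂(μ.map fun b => (g b, b)), p.1 = g p.2 := by
      rw [ae_map_iff (by fun_prop) hs]
      exact ae_of_all _ fun _ => rfl
    rw [← e, ae_map_iff (by fun_prop) hs] at this
    exact this

lemma integral_contract_le {φ : ℝ → ℝ} (hφ : ConvexOn ℝ Set.univ φ) (hc : Continuous φ)
    {l r s : ℝ} (hlr : l ≤ r) (hs : |s| ≤ 1) :
    ∫ x in l..r, φ ((l + r) / 2 + s * (x - (l + r) / 2)) ≤ ∫ x in l..r, φ x := by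
  have hs' := abs_le.1 hs
  have hr := intervalIntegral.integral_comp_sub_left (a := l) (b := r) φ (l + r)
  rw [add_sub_cancel_right, add_sub_cancel_left] at hr
  calc ∫ x in l..r, φ ((l + r) / 2 + s * (x - (l + r) / 2))
      ≤ ∫ x in l..r, (1 + s) / 2 * φ x + (1 - s) / 2 * φ (l + r - x) := by
        refine intervalIntegral.integral_mono_on hlr
          (Continuous.intervalIntegrable (by fun_prop) _ _)
          (Continuous.intervalIntegrable (by fun_prop) _ _) fun x _ => ?_
        have := hφ.2 (Set.mem_univ x) (Set.mem_univ (l + r - x)) 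
          (show 0 ≤ (1 + s) / 2 by linarith) (show 0 ≤ (1 - s) / 2 by linarith) (by ring)
        simp only [smul_eq_mul] at this
        refine le_of_eq_of_le ?_ this
        congr 1
        ring
    _ = ∫ x in l..r, φ x := by
        rw [intervalIntegral.integral_add (Continuous.intervalIntegrable (by fun_prop) _ _)
          (Continuous.intervalIntegrable (by fun_prop) _ _),
          intervalIntegral.integral_const_mul, intervalIntegral.integral_const_mul, hr]
        ring

lemma ae_mem_Icc_of_stopLoss {G : Measure ℝ} [IsProbabilityMeasure G]
    (hi : Integrable (fun x : ℝ => x) G) (mean : ∫ x, x ∂G = 1 / 2)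
    (loss : ∀ k, ∫ x, max (x - k) 0 ∂G ≤ stopLoss 0 1 k) : ∀ᵐ x ∂G, x ∈ Set.Icc (0 : ℝ) 1 := by
  have hk : ∀ k : ℝ, Integrable (fun x : ℝ => max (x - k) 0) G := fun k =>
    (hi.sub (integrable_const k)).pos_part
  have h1 : ∀ᵐ x ∂G, x ≤ 1 := by
    have h := loss 1
    rw [stopLoss_of_ge zero_le_one le_rfl] at h
    have := (integral_eq_zero_iff_of_nonneg (fun x => le_max_right _ _) (hk 1)).1
      (h.antisymm (integral_nonneg fun x => le_max_right _ _))
    filter_upwards [this] with x hx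
    have := le_max_left (x - 1) 0
    simp only [Pi.zero_apply] at hx
    linarith
  have h0 : ∀ᵐ x ∂G, 0 ≤ x := by
    have h := loss 0
    rw [stopLoss_of_le zero_le_one le_rfl] at h
    have hd : Integrable (fun x : ℝ => max (x - 0) 0 - x) G := (hk 0).sub hi
    have h2 : 0 ≤ fun x : ℝ => max (x - 0) 0 - x := fun x => by
      have := le_max_left (x - 0) 0
      simp only [Pi.zero_apply]
      linarith
    have := (integral_eq_zero_iff_of_nonneg h2 hd).1 (le_antisymm (by
      rw [integral_sub (hk 0) hi, mean]; linarith) (integral_nonneg h2))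
    filter_upwards [this] with x hx
    have := le_max_right (x - 0) 0
    simp only [Pi.zero_apply] at hx
    linarith
  filter_upwards [h0, h1] with x h h' using ⟨h, h'⟩

lemma twoPoint_of_unit {n : ℕ} (hn : n ≠ 0) (H : ∀ y z a b : ℝ, 0 ≤ a → 0 ≤ b → a + b = 1 →
    a * y + b * z = 1 / 2 → z - y ≤ 1 / 2 → y ≤ z → MeanLaw n (volume.restrict (Set.Icc 0 1))
      (ENNReal.ofReal a • Measure.dirac y + ENNReal.ofReal b • Measure.dirac z)) : TwoPoint n := by
  intro l r y z a b hlr ha hb hab hm hyz hzy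
  rcases hlr.eq_or_lt with rfl | hlr
  · obtain rfl : a = 0 := by linarith
    obtain rfl : b = 0 := by linarith
    refine ⟨0, ?_, ?_⟩ <;> simp
  have hs : 0 < r - l := sub_pos.2 hlr
  set s := r - l with hs_def
  have key := ((H ((y - l) / s) ((z - l) / s) (a / s) (b / s) (by positivity) (by positivity)
    (by rw [← add_div, hab, div_self hs.ne']) (by
      field_simp
      rw [hs_def] at hab ⊢
      linear_combination 2 * hm - 2 * l * hab) (by
      rw [← sub_div, div_le_iff₀ hs]; linarith) (by gcongr)).affine hn s l).smul
    (ENNReal.ofReal s)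
  have hmap : Measurable fun x : ℝ => s * x + l := by fun_prop
  have e : ∀ c : ℝ, ENNReal.ofReal s * ENNReal.ofReal (c / s) = ENNReal.ofReal c := fun c => by
    rw [← ENNReal.ofReal_mul hs.le, mul_div_cancel₀ _ hs.ne']
  rw [map_affine_restrict hs, smul_smul, ← ENNReal.ofReal_mul hs.le, mul_inv_cancel₀ hs.ne',
    ENNReal.ofReal_one, one_smul, Measure.map_add _ _ hmap, Measure.map_smul, Measure.map_smul,
    Measure.map_dirac' hmap, Measure.map_dirac' hmap, mul_div_cancel₀ _ hs.ne', mul_div_cancel₀ _ hs.ne',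
    smul_add, smul_smul, smul_smul, e, e, sub_add_cancel, sub_add_cancel, mul_zero, zero_add,
    mul_one, hs_def, sub_add_cancel] at key
  exact key

lemma integral_max_sub_eq_stopLoss (l r k : ℝ) :
    ∫ x in l..r, max (x - k) 0 = stopLoss l r k := by
  have key : ∀ t : ℝ, ∫ x in k..t, max (x - k) 0 = max (t - k) 0 ^ 2 / 2 := by
    intro t
    rcases le_total k t with h | h
    · rw [max_eq_left (sub_nonneg.2 h), intervalIntegral.integral_congr (g := fun x => x - k)]
      · simp [intervalIntegral.integral_comp_sub_right (fun x => x) k]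
      · intro x hx
        rw [Set.uIcc_of_le h] at hx
        exact max_eq_left (sub_nonneg.2 hx.1)
    · rw [max_eq_right (sub_nonpos.2 h), intervalIntegral.integral_congr (g := fun _ => 0)]
      · simp
      · intro x hx
        rw [Set.uIcc_of_ge h] at hx
        exact max_eq_right (sub_nonpos.2 hx.2)
  have hi : ∀ x y : ℝ, IntervalIntegrable (fun x : ℝ => max (x - k) 0) volume x y := fun x y =>
    Continuous.intervalIntegrable (by fun_prop) x y
  rw [← intervalIntegral.integral_interval_sub_left (hi k r) (hi k l), key, key, stopLoss]
  ring

lemma convexOn_max_sub (k : ℝ) : ConvexOn ℝ Set.univ fun x : ℝ => max (x - k) 0 :=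
  ((convexOn_id convex_univ).sub (concaveOn_const k convex_univ)).sup
    (convexOn_const 0 convex_univ)

/-- The average of the other `n` variables, when the first one takes the value `x` and the average
of all of them is `y` for `x ≤ a` and `z` for `a < x`. -/
noncomputable def restAverage (n : ℕ) (y z a x : ℝ) : ℝ :=
  ((n + 1) * (if x ≤ a then y else z) - x) / n

lemma measurable_restAverage (n : ℕ) (y z a : ℝ) : Measurable (restAverage n y z a) := by
  have : Measurable fun x : ℝ => if x ≤ a then y else z :=
    Measurable.ite measurableSet_Iic measurable_const measurable_const
  unfold restAverage
  fun_prop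

lemma intervalIntegral_comp_restAverage {n : ℕ} {y z a b : ℝ}
    (ha : 0 ≤ a) (hb : 0 ≤ b) (hab : a + b = 1) {φ : ℝ → ℝ} (hc : Continuous φ) :
    ∫ x in (0 : ℝ)..1, φ (restAverage n y z a x) =
      (∫ x in (0 : ℝ)..a, φ (((n + 1) * y - x) / n)) + ∫ x in a..1, φ (((n + 1) * z - x) / n) := by
  have e₁ : Set.EqOn (fun x => φ (((n + 1) * y - x) / n)) (fun x => φ (restAverage n y z a x))
      (Set.uIoc 0 a) := fun x hx => by
    rw [Set.uIoc_of_le ha] at hx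
    simp only [restAverage, if_pos hx.2]
  have e₂ : Set.EqOn (fun x => φ (((n + 1) * z - x) / n)) (fun x => φ (restAverage n y z a x))
      (Set.uIoc a 1) := fun x hx => by
    rw [Set.uIoc_of_le (by linarith)] at hx
    simp only [restAverage, if_neg (not_le.2 hx.1)]
  have i₁ : IntervalIntegrable (fun x => φ (((n + 1) * y - x) / n)) volume 0 a :=
    Continuous.intervalIntegrable (by fun_prop) _ _
  have i₂ : IntervalIntegrable (fun x => φ (((n + 1) * z - x) / n)) volume a 1 :=
    Continuous.intervalIntegrable (by fun_prop) _ _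
  rw [← intervalIntegral.integral_add_adjacent_intervals (i₁.congr e₁) (i₂.congr e₂),
    intervalIntegral.integral_congr_ae (ae_of_all _ fun x hx => (e₁ hx).symm),
    intervalIntegral.integral_congr_ae (ae_of_all _ fun x hx => (e₂ hx).symm)]

lemma integral_comp_restAverage_le {n : ℕ} (hn : n ≠ 0) {y z a b : ℝ}
    (ha : 0 ≤ a) (hb : 0 ≤ b) (hab : a + b = 1) (hm : a * y + b * z = 1 / 2) (hzy : z - y ≤ 1 / 2)
    (hyz : y ≤ z) {φ : ℝ → ℝ} (hφ : ConvexOn ℝ Set.univ φ) (hc : Continuous φ) :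
    ∫ x in (0 : ℝ)..1, φ (restAverage n y z a x) ≤ ∫ x in (0 : ℝ)..1, φ x := by
  have hn1 : (1 : ℝ) ≤ n := by exact_mod_cast Nat.one_le_iff_ne_zero.2 hn
  have hn0 : (0 : ℝ) < n := by linarith
  have hs : |-(n : ℝ)⁻¹| ≤ 1 := by
    rw [abs_neg, abs_of_pos (inv_pos.2 hn0)]
    exact inv_le_one_of_one_le₀ hn1
  set c : ℝ := 2 * (z - y) with hcdef
  have hc0 : 0 ≤ c := by linarith
  have hc1 : 0 ≤ 1 - c := by linarith
  have hcell : ∀ l r v : ℝ, l ≤ r → v = 1 / 2 + c * ((l + r) / 2 - 1 / 2) →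
      ∫ x in l..r, φ (((n + 1) * v - x) / n) ≤
        (1 - c) * (∫ x in l..r, φ ((0 + 1) / 2 + -(n : ℝ)⁻¹ * (x - (0 + 1) / 2))) +
          c * ∫ x in l..r, φ x := by
    intro l r v hlr hv
    have h1 := integral_contract_le hφ hc hlr hs
    refine le_trans ?_ (add_le_add_right (mul_le_mul_of_nonneg_left h1 hc0) _)
    rw [← intervalIntegral.integral_const_mul, ← intervalIntegral.integral_const_mul,
      ← intervalIntegral.integral_add (Continuous.intervalIntegrable (by fun_prop) _ _)
        (Continuous.intervalIntegrable (by fun_prop) _ _)]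
    refine intervalIntegral.integral_mono_on hlr (Continuous.intervalIntegrable (by fun_prop) _ _)
      (Continuous.intervalIntegrable (by fun_prop) _ _) fun x _ => ?_
    refine le_of_eq_of_le ?_ (hφ.2 (Set.mem_univ _) (Set.mem_univ _) hc1 hc0 (by ring))
    congr 1
    rw [hv, smul_eq_mul, smul_eq_mul]
    field_simp
    ring
  have hy : y = 1 / 2 + c * ((0 + a) / 2 - 1 / 2) := by
    rw [hcdef]; linear_combination hm - z * hab
  have hz : z = 1 / 2 + c * ((a + 1) / 2 - 1 / 2) := by
    rw [hcdef]; linear_combination hm - z * hab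
  have h0 := integral_contract_le hφ hc zero_le_one hs
  have hi : ∀ l r : ℝ, IntervalIntegrable φ volume l r := fun l r => hc.intervalIntegrable l r
  have hi' : ∀ l r : ℝ, IntervalIntegrable
      (fun x => φ ((0 + 1) / 2 + -(n : ℝ)⁻¹ * (x - (0 + 1) / 2))) volume l r := fun l r =>
    Continuous.intervalIntegrable (by fun_prop) l r
  have h1 := hcell 0 a y ha hy
  have h2 := hcell a 1 z (by linarith) hz
  rw [intervalIntegral_comp_restAverage ha hb hab hc]
  have s1 := intervalIntegral.integral_add_adjacent_intervals (hi 0 a) (hi a 1)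
  have s2 := intervalIntegral.integral_add_adjacent_intervals (hi' 0 a) (hi' a 1)
  rw [← s2] at h0
  nlinarith [mul_le_mul_of_nonneg_left h0 hc1]

lemma twoPoint_succ {n : ℕ} (hn : n ≠ 0) (H : TwoPoint n) : TwoPoint (n + 1) := by
  refine twoPoint_of_unit n.succ_ne_zero fun y z a b ha hb hab hm hzy hyz => ?_
  set ν : Measure ℝ := volume.restrict (Set.Icc 0 1) with hν
  have : IsProbabilityMeasure ν := ⟨by simp [hν]⟩
  have hn0 : (n : ℝ) ≠ 0 := by exact_mod_cast hn
  set τ := restAverage n y z a with hτ_def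
  have hτ : Measurable τ := measurable_restAverage n y z a
  have hs : Measurable fun x : ℝ => if x ≤ a then y else z :=
    Measurable.ite measurableSet_Iic measurable_const measurable_const
  have hint : ∀ f : ℝ → ℝ, ∫ x, f x ∂ν = ∫ x in (0 : ℝ)..1, f x := fun f => by
    rw [hν, integral_Icc_eq_integral_Ioc, ← intervalIntegral.integral_of_le zero_le_one]
  have hprob : IsProbabilityMeasure (ν.map τ) := Measure.isProbabilityMeasure_map hτ.aemeasurable
  have htint : Integrable (fun x : ℝ => x) (ν.map τ) := by
    rw [integrable_map_measure (by fun_prop) hτ.aemeasurable]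
    have h1 : Integrable (fun x : ℝ => if x ≤ a then y else z) ν := by
      refine Integrable.of_bound hs.aestronglyMeasurable (|y| + |z|) (ae_of_all _ fun x => ?_)
      split_ifs
      · exact le_add_of_nonneg_right (abs_nonneg z)
      · exact le_add_of_nonneg_left (abs_nonneg y)
    have h2 : Integrable (fun x : ℝ => x) ν :=
      ContinuousOn.integrableOn_compact isCompact_Icc continuousOn_id
    exact ((h1.const_mul ((n : ℝ) + 1)).sub h2).div_const _
  have hmean : ∫ x, x ∂(ν.map τ) = 1 / 2 := by
    rw [integral_map hτ.aemeasurable (by fun_prop), hint]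
    have := intervalIntegral_comp_restAverage (n := n) (y := y) (z := z) ha hb hab continuous_id
    simp only [id] at this
    rw [this]
    simp only [intervalIntegral.integral_div]
    rw [intervalIntegral.integral_sub (by simp) (by simp),
      intervalIntegral.integral_sub (by simp) (by simp)]
    simp only [intervalIntegral.integral_const, integral_id, smul_eq_mul]
    field_simp
    linear_combination 2 * (n + 1) * hm - 2 * (n + 1) * z * hab
  have hloss : ∀ k, ∫ x, max (x - k) 0 ∂(ν.map τ) ≤ stopLoss 0 1 k := by
    intro k
    rw [integral_map hτ.aemeasurable (by fun_prop), hint, ← integral_max_sub_eq_stopLoss]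
    exact integral_comp_restAverage_le hn ha hb hab hm hzy hyz (convexOn_max_sub k) (by fun_prop)
  obtain ⟨μ, h1, h2⟩ := meanLaw_of_stopLoss hn H (ae_mem_Icc_of_stopLoss htint hmean hloss)
    hmean hloss
  have hμ : IsFiniteMeasure μ := by
    have : IsProbabilityMeasure (μ.map fun x => (∑ i, x i) / (n : ℝ)) := h2 ▸ hprob
    have h := measure_univ (μ := μ.map fun x => (∑ i, x i) / (n : ℝ))
    rw [Measure.map_apply (by fun_prop) MeasurableSet.univ, Set.preimage_univ] at h
    exact ⟨h ▸ ENNReal.one_lt_top⟩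
  obtain ⟨π, hfst, hsnd, hπ⟩ := exists_coupling ν μ hτ (by fun_prop) h2.symm
  refine MeanLaw.of_map π (fun i p => Fin.cons (α := fun _ => ℝ) p.1 p.2 i) ?_ ?_ ?_
  · intro i
    refine Fin.cases ?_ (fun i => ?_) i
    · exact measurable_fst
    · exact (measurable_pi_apply i).comp measurable_snd
  · rw [Fin.sum_univ_succ]
    simp only [Fin.cons_zero, Fin.cons_succ]
    have : ∀ i, π.map (fun p => p.2 i) = μ.map fun x => x i := fun i => by
      rw [← hsnd, Measure.map_map (measurable_pi_apply i) measurable_snd]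
      rfl
    simp only [this]
    rw [h1, show (fun p : ℝ × (Fin n → ℝ) => p.1) = Prod.fst from rfl, hfst]
    push_cast
    rw [add_smul, one_smul, add_comm]
  · have e : (fun p : ℝ × (Fin n → ℝ) => (∑ i, Fin.cons (α := fun _ => ℝ) p.1 p.2 i) /
        ((n + 1 : ℕ) : ℝ)) =ᵐ[π] (fun x : ℝ => if x ≤ a then y else z) ∘ Prod.fst := by
      filter_upwards [hπ] with p hp
      rw [Fin.sum_univ_succ]
      simp only [Fin.cons_zero, Fin.cons_succ, Function.comp]
      rw [hτ_def, restAverage, div_left_inj' hn0] at hp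
      rw [← hp]
      push_cast
      field_simp
      ring
    rw [Measure.map_congr e, ← Measure.map_map hs measurable_fst, hfst, hν,
      ← restrict_Icc_add ha (by linarith : a ≤ 1), Measure.map_add _ _ hs]
    congr 1
    · rw [Measure.map_congr (g := fun _ => y), Measure.map_const]
      · simp
      · filter_upwards [ae_restrict_mem measurableSet_Icc] with x hx using if_pos hx.2
    · rw [Measure.map_congr (g := fun _ => z), Measure.map_const]
      · simp [← hab]
      · filter_upwards [ae_restrict_mem measurableSet_Icc,
          ae_restrict_of_ae (Measure.ae_ne volume a)] with x hx hxa
        exact if_neg (not_le.2 (lt_of_le_of_ne hx.1 (Ne.symm hxa)))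

lemma twoPoint {n : ℕ} (hn : 3 ≤ n) : TwoPoint n := by
  induction n, hn using Nat.le_induction with
  | base => exact twoPoint_three
  | succ k hk ih => exact twoPoint_succ (by omega) ih

section Atomless

variable {Ω : Type*} [MeasurableSpace Ω] {P : Measure Ω}

lemma Atomless.exists_real_lt [IsFiniteMeasure P] (hP : Atomless P) {s : Set Ω}
    (hs : MeasurableSet s) (h0 : 0 < P.real s) :
    ∃ t ⊆ s, MeasurableSet t ∧ 0 < P.real t ∧ 2 * P.real t ≤ P.real s := by
  obtain ⟨t, hts, ht, ht0, hlt⟩ := hP s hs (ENNReal.toReal_pos_iff.1 h0).1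
  have h1 : 0 < P.real t := ENNReal.toReal_pos ht0.ne' (measure_ne_top _ _)
  have h2 : P.real t < P.real s := ENNReal.toReal_strict_mono (measure_ne_top _ _) hlt
  have h3 := measureReal_sdiff (μ := P) hts ht
  rcases le_total (2 * P.real t) (P.real s) with h | h
  · exact ⟨t, hts, ht, h1, h⟩
  · exact ⟨s \ t, Set.sdiff_subset, hs.diff ht, by linarith, by linarith⟩

lemma Atomless.exists_real_le [IsFiniteMeasure P] (hP : Atomless P) {s : Set Ω}
    (hs : MeasurableSet s) (h0 : 0 < P.real s) {ε : ℝ} (hε : 0 < ε) :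
    ∃ t ⊆ s, MeasurableSet t ∧ 0 < P.real t ∧ P.real t ≤ ε := by
  have key : ∀ k : ℕ, ∃ t ⊆ s, MeasurableSet t ∧ 0 < P.real t ∧ 2 ^ k * P.real t ≤ P.real s := by
    intro k
    induction k with
    | zero => exact ⟨s, subset_rfl, hs, h0, by simp⟩
    | succ k ih =>
      obtain ⟨t, hts, ht, ht0, hle⟩ := ih
      obtain ⟨t', hts', ht', ht0', hle'⟩ := hP.exists_real_lt ht ht0
      refine ⟨t', hts'.trans hts, ht', ht0', le_trans ?_ hle⟩
      rw [pow_succ, mul_assoc]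
      gcongr
  obtain ⟨k, hk⟩ := pow_unbounded_of_one_lt (P.real s / ε) (one_lt_two (α := ℝ))
  obtain ⟨t, hts, ht, ht0, hle⟩ := key k
  refine ⟨t, hts, ht, ht0, ?_⟩
  rw [div_lt_iff₀ hε] at hk
  exact le_of_mul_le_mul_left (hle.trans hk.le) (by positivity)

/-- An atomless finite measure takes all intermediate values between nested sets. -/
lemma Atomless.exists_real_eq [IsFiniteMeasure P] (hP : Atomless P) {A C : Set Ω}
    (hA : MeasurableSet A) (hC : MeasurableSet C) (hAC : A ⊆ C) {t : ℝ} (hAt : P.real A ≤ t)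
    (htC : t ≤ P.real C) : ∃ B, MeasurableSet B ∧ A ⊆ B ∧ B ⊆ C ∧ P.real B = t := by
  have step : ∀ B : {B : Set Ω // MeasurableSet B ∧ A ⊆ B ∧ B ⊆ C ∧ P.real B ≤ t},
      ∃ B' : {B : Set Ω // MeasurableSet B ∧ A ⊆ B ∧ B ⊆ C ∧ P.real B ≤ t}, B.1 ⊆ B'.1 ∧
        ∀ D ⊆ C \ B.1, MeasurableSet D → P.real B.1 + P.real D ≤ t →
          P.real D ≤ 2 * (P.real B'.1 - P.real B.1) := by
    rintro ⟨B, hB, hAB, hBC, hBt⟩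
    set S : Set ℝ := {x | ∃ D ⊆ C \ B, MeasurableSet D ∧ P.real B + P.real D ≤ t ∧ P.real D = x}
    have hbdd : BddAbove S := ⟨t, by
      rintro _ ⟨D, -, -, h, rfl⟩
      linarith [measureReal_nonneg (μ := P) (s := B)]⟩
    have h0 : (0 : ℝ) ∈ S := ⟨∅, by simp, .empty, by simpa using hBt, by simp⟩
    have hS : 0 ≤ sSup S := le_csSup hbdd h0
    obtain ⟨x, ⟨D, hD, hDm, hDt, rfl⟩, hx⟩ : ∃ x ∈ S, sSup S / 2 ≤ x := by
      rcases hS.eq_or_lt with h | h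
      · exact ⟨0, h0, by linarith⟩
      · obtain ⟨x, hx, hlt⟩ := exists_lt_of_lt_csSup ⟨0, h0⟩ (half_lt_self h)
        exact ⟨x, hx, hlt.le⟩
    have hu : P.real (B ∪ D) = P.real B + P.real D :=
      measureReal_union (Set.disjoint_left.2 fun x hx hx' => (hD hx').2 hx) hDm
    refine ⟨⟨B ∪ D, hB.union hDm, hAB.trans Set.subset_union_left,
      Set.union_subset hBC (hD.trans Set.sdiff_subset), by rw [hu]; exact hDt⟩,
      Set.subset_union_left, fun E hE hEm hEt => ?_⟩
    have := le_csSup hbdd (⟨E, hE, hEm, hEt, rfl⟩ : P.real E ∈ S)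
    simp only [hu]
    linarith
  choose next hsub hnext using step
  set F : ℕ → {B : Set Ω // MeasurableSet B ∧ A ⊆ B ∧ B ⊆ C ∧ P.real B ≤ t} := fun k =>
    next^[k] ⟨A, hA, subset_rfl, hAC, hAt⟩ with hF
  have hFs : ∀ k, F (k + 1) = next (F k) := fun k => Function.iterate_succ_apply' _ _ _
  have hmono : Monotone fun k => (F k).1 := monotone_nat_of_le_succ fun k => by
    rw [hFs]; exact hsub _
  have htend := tendsto_measure_iUnion_atTop (μ := P) hmono
  have htend' : Filter.Tendsto (fun k => P.real (F k).1) Filter.atTop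
      (nhds (P.real (⋃ k, (F k).1))) :=
    (ENNReal.tendsto_toReal (measure_ne_top _ _)).comp htend
  set B := ⋃ k, (F k).1 with hB
  have hBm : MeasurableSet B := MeasurableSet.iUnion fun k => (F k).2.1
  have hBC : B ⊆ C := Set.iUnion_subset fun k => (F k).2.2.2.1
  have hBt : P.real B ≤ t := le_of_tendsto' htend' fun k => (F k).2.2.2.2
  refine ⟨B, hBm, (F 0).2.2.1.trans (Set.subset_iUnion (fun k => (F k).1) 0), hBC,
    hBt.antisymm ?_⟩
  by_contra! hlt
  have hd : 0 < P.real (C \ B) := by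
    rw [measureReal_sdiff hBC hBm]
    linarith
  obtain ⟨D, hD, hDm, hD0, hDle⟩ := hP.exists_real_le (hC.diff hBm) hd (sub_pos.2 hlt)
  have hgap : ∀ k, P.real D ≤ 2 * (P.real (F (k + 1)).1 - P.real (F k).1) := by
    intro k
    rw [hFs]
    refine hnext (F k) D (hD.trans (Set.sdiff_subset_sdiff_right
      (Set.subset_iUnion (fun k => (F k).1) k))) hDm ?_
    have : P.real (F k).1 ≤ P.real B := measureReal_mono (Set.subset_iUnion (fun k => (F k).1) k)
    linarith
  have hz : Filter.Tendsto (fun k => 2 * (P.real (F (k + 1)).1 - P.real (F k).1)) Filter.atTop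
      (nhds (2 * (P.real B - P.real B))) :=
    ((htend'.comp (Filter.tendsto_add_atTop_nat 1)).sub htend').const_mul 2
  have := ge_of_tendsto' hz hgap
  linarith

lemma Atomless.exists_dyadic_chain [IsProbabilityMeasure P] (hP : Atomless P) :
    ∃ F : ℕ → ℕ → Set Ω, (∀ n k, MeasurableSet (F n k)) ∧
      (∀ n k, k ≤ 2 ^ n → P.real (F n k) = k / 2 ^ n) ∧
      ∀ n k m j, k * 2 ^ m ≤ j * 2 ^ n → F n k ⊆ F m j := by
  have mid : ∀ A C : Set Ω, ∃ B, MeasurableSet A → MeasurableSet C → A ⊆ C →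
      MeasurableSet B ∧ A ⊆ B ∧ B ⊆ C ∧ P.real B = (P.real A + P.real C) / 2 := by
    intro A C
    by_cases h : MeasurableSet A ∧ MeasurableSet C ∧ A ⊆ C
    · obtain ⟨hA, hC, hAC⟩ := h
      have := measureReal_mono (μ := P) hAC
      obtain ⟨B, hB⟩ := hP.exists_real_eq hA hC hAC
        (show P.real A ≤ (P.real A + P.real C) / 2 by linarith)
        (show (P.real A + P.real C) / 2 ≤ P.real C by linarith)
      exact ⟨B, fun _ _ _ => hB⟩
    · exact ⟨∅, fun hA hC hAC => (h ⟨hA, hC, hAC⟩).elim⟩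
  choose M hM using mid
  set F : ℕ → ℕ → Set Ω := fun n => Nat.rec (fun k => if k = 0 then ∅ else Set.univ)
    (fun _ f k => if k % 2 = 0 then f (k / 2) else M (f (k / 2)) (f (k / 2 + 1))) n with hF
  have hF0 : ∀ k, F 0 k = if k = 0 then ∅ else Set.univ := fun k => rfl
  have hFe : ∀ n k, F (n + 1) (2 * k) = F n k := fun n k => by
    have : F (n + 1) (2 * k) = if 2 * k % 2 = 0 then F n (2 * k / 2)
      else M (F n (2 * k / 2)) (F n (2 * k / 2 + 1)) := rfl
    rw [this, if_pos (by omega), Nat.mul_div_cancel_left k two_pos]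
  have hFo : ∀ n k, F (n + 1) (2 * k + 1) = M (F n k) (F n (k + 1)) := fun n k => by
    have : F (n + 1) (2 * k + 1) = if (2 * k + 1) % 2 = 0 then F n ((2 * k + 1) / 2)
      else M (F n ((2 * k + 1) / 2)) (F n ((2 * k + 1) / 2 + 1)) := rfl
    rw [this, if_neg (by omega), show (2 * k + 1) / 2 = k by omega]
  have base : ∀ n, (∀ k, MeasurableSet (F n k)) ∧ Monotone (F n) := by
    intro n
    induction n with
    | zero =>
      refine ⟨fun k => ?_, fun k j hkj => ?_⟩
      · rw [hF0]; split_ifs <;> simp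
      · rw [hF0, hF0]
        split_ifs with h1 h2 h2
        · exact subset_rfl
        · exact Set.empty_subset _
        · omega
        · exact subset_rfl
    | succ n ih =>
      have hm := fun k => hM _ _ (ih.1 k) (ih.1 (k + 1)) (ih.2 k.le_succ)
      refine ⟨fun k => ?_, monotone_nat_of_le_succ fun k => ?_⟩
      · obtain ⟨j, rfl | rfl⟩ := k.even_or_odd'
        · rw [hFe]; exact ih.1 j
        · rw [hFo]; exact (hm j).1
      · obtain ⟨j, rfl | rfl⟩ := k.even_or_odd'
        · rw [hFe, hFo]; exact (hm j).2.1
        · rw [hFo, show 2 * j + 1 + 1 = 2 * (j + 1) by ring, hFe]; exact (hm j).2.2.1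
  have hmeas : ∀ n k, k ≤ 2 ^ n → P.real (F n k) = k / 2 ^ n := by
    intro n
    induction n with
    | zero =>
      intro k hk
      obtain rfl | rfl : k = 0 ∨ k = 1 := by simp at hk; omega
      · simp [hF0]
      · simp [hF0]
    | succ n ih =>
      intro k hk
      obtain ⟨j, rfl | rfl⟩ := k.even_or_odd'
      · rw [hFe, ih j (by rw [pow_succ] at hk; omega)]
        rw [pow_succ]
        push_cast
        field_simp
      · rw [hFo, (hM _ _ ((base n).1 j) ((base n).1 (j + 1)) ((base n).2 j.le_succ)).2.2.2,
          ih j (by rw [pow_succ] at hk; omega), ih (j + 1) (by rw [pow_succ] at hk; omega)]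
        push_cast
        field_simp
        ring
  have hshift : ∀ i n k, F (n + i) (2 ^ i * k) = F n k := by
    intro i n k
    induction i with
    | zero => simp
    | succ i ih => rw [pow_succ', mul_assoc, ← add_assoc, hFe, ih]
  refine ⟨F, fun n => (base n).1, hmeas, fun n k m j h => ?_⟩
  rw [← hshift m n k, ← hshift n m j, add_comm m n]
  exact (base _).2 (by rw [mul_comm, mul_comm (2 ^ n)]; exact h)

lemma Atomless.exists_uniform [IsProbabilityMeasure P] (hP : Atomless P) :
    ∃ U : Ω → ℝ, Measurable U ∧ P.map U = volume.restrict (Set.Icc 0 1) := by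
  classical
  obtain ⟨F, hFm, hFP, hFs⟩ := hP.exists_dyadic_chain
  set V : ℕ × ℕ → Ω → ℝ := fun q ω => if ω ∈ F q.1 q.2 then (q.2 : ℝ) / 2 ^ q.1 else 1 with hV
  have hVm : ∀ q, Measurable (V q) := fun q =>
    Measurable.ite (hFm _ _) measurable_const measurable_const
  have hV0 : ∀ q ω, 0 ≤ V q ω := fun q ω => by
    simp only [hV]; split_ifs <;> positivity
  set U : Ω → ℝ := fun ω => ⨅ q, V q ω with hU
  have hbdd : ∀ ω, BddBelow (Set.range fun q => V q ω) := fun ω =>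
    ⟨0, by rintro _ ⟨q, rfl⟩; exact hV0 q ω⟩
  have hUm : Measurable U := Measurable.iInf hVm
  have hU0 : ∀ ω, 0 ≤ U ω := fun ω => le_ciInf fun q => hV0 q ω
  have hU1 : ∀ ω, U ω ≤ 1 := fun ω => (ciInf_le (hbdd ω) (0, 0)).trans (by
    simp only [hV]; split_ifs <;> simp)
  have hlt : ∀ x ω, U ω < x ↔ ∃ q, V q ω < x := fun x ω => ciInf_lt_iff (hbdd ω)
  have hval : ∀ x : ℝ, 0 < x → x ≤ 1 → P.real {ω | U ω < x} = x := by
    intro x hx0 hx1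
    have hclose : ∀ n : ℕ, |P.real {ω | U ω < x} - x| ≤ (1 / 2) ^ n := by
      intro n
      have h2 : (0 : ℝ) < 2 ^ n := by positivity
      obtain ⟨j, hj⟩ : ∃ j, ⌈(2 : ℝ) ^ n * x⌉₊ = j + 1 :=
        Nat.exists_eq_succ_of_ne_zero (Nat.ceil_pos.2 (by positivity)).ne'
      have hup : (2 : ℝ) ^ n * x ≤ (j : ℝ) + 1 := by
        have := Nat.le_ceil ((2 : ℝ) ^ n * x)
        rw [hj] at this; exact_mod_cast this
      have hlo : (j : ℝ) < 2 ^ n * x := Nat.lt_ceil.1 (by omega)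
      have hjn : j + 1 ≤ 2 ^ n := by
        rw [← hj]
        refine Nat.ceil_le.2 ?_
        push_cast
        exact mul_le_of_le_one_right h2.le hx1
      have h1 : P.real (F n j) ≤ P.real {ω | U ω < x} := by
        refine measureReal_mono fun ω hω => (hlt x ω).2 ⟨(n, j), ?_⟩
        simp only [hV, if_pos hω]
        rwa [div_lt_iff₀' h2]
      have h3 : P.real {ω | U ω < x} ≤ P.real (F n (j + 1)) := by
        refine measureReal_mono fun ω hω => ?_
        obtain ⟨⟨m, i⟩, hq⟩ := (hlt x ω).1 hω
        simp only [hV] at hq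
        split_ifs at hq with hmem
        · refine hFs m i n (j + 1) ?_ hmem
          rw [div_lt_iff₀ (by positivity)] at hq
          have : (i : ℝ) * 2 ^ n ≤ (j + 1 : ℝ) * 2 ^ m := by
            have h4 : (0 : ℝ) < 2 ^ m := by positivity
            nlinarith
          exact_mod_cast this
        · linarith
      rw [hFP n j (by omega)] at h1
      rw [hFP n (j + 1) hjn] at h3
      have e : ((1 : ℝ) / 2) ^ n = 1 / 2 ^ n := by rw [div_pow, one_pow]
      have a1 : x - 1 / 2 ^ n ≤ j / 2 ^ n := by
        rw [sub_le_iff_le_add, ← add_div, le_div_iff₀' h2]; exact hup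
      have a2 : ((j + 1 : ℕ) : ℝ) / 2 ^ n ≤ x + 1 / 2 ^ n := by
        push_cast
        rw [add_div]
        have : (j : ℝ) / 2 ^ n < x := (div_lt_iff₀' h2).2 hlo
        linarith
      rw [e, abs_le]
      constructor <;> linarith
    have := ge_of_tendsto' (tendsto_pow_atTop_nhds_zero_of_lt_one (r := (1 : ℝ) / 2)
      (by norm_num) (by norm_num)) hclose
    exact sub_eq_zero.1 (abs_nonpos_iff.1 this)
  refine ⟨U, hUm, ?_⟩
  have := Measure.isProbabilityMeasure_map (μ := P) hUm.aemeasurable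
  refine Measure.ext_of_Ici _ _ fun x => ?_
  rw [Measure.map_apply hUm measurableSet_Ici, Measure.restrict_apply measurableSet_Ici]
  rcases le_or_gt x 0 with hx | hx
  · have e₁ : U ⁻¹' Set.Ici x = Set.univ := Set.eq_univ_of_forall fun ω => hx.trans (hU0 ω)
    have e₂ : Set.Ici x ∩ Set.Icc 0 1 = Set.Icc 0 1 :=
      Set.inter_eq_right.2 fun y hy => hx.trans hy.1
    rw [e₁, e₂]
    simp
  rcases lt_or_ge 1 x with hx1 | hx1
  · have e₁ : U ⁻¹' Set.Ici x = ∅ :=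
      Set.eq_empty_of_forall_notMem fun ω hω => (hx1.trans_le hω).not_ge (hU1 ω)
    have e₂ : Set.Ici x ∩ Set.Icc 0 1 = ∅ :=
      Set.eq_empty_of_forall_notMem fun y hy => (hx1.trans_le hy.1).not_ge hy.2.2
    rw [e₁, e₂]
    simp
  · have e₁ : U ⁻¹' Set.Ici x = {ω | U ω < x}ᶜ := by
      ext ω; simp
    have e₂ : Set.Ici x ∩ Set.Icc 0 1 = Set.Icc x 1 := by
      ext y
      simp only [Set.mem_inter_iff, Set.mem_Ici, Set.mem_Icc]
      exact ⟨fun h => ⟨h.1, h.2.2⟩, fun h => ⟨h.1, hx.le.trans h.1, h.2⟩⟩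
    have hm : MeasurableSet {ω | U ω < x} := measurableSet_lt hUm measurable_const
    rw [e₁, e₂, Real.volume_Icc, ← ofReal_measureReal, probReal_compl_eq_one_sub hm,
      hval x hx hx1]

lemma Atomless.exists_map_eq [IsProbabilityMeasure P] (hP : Atomless P) {Y : Type*}
    [MeasurableSpace Y] [StandardBorelSpace Y] [Nonempty Y] (μ : Measure Y)
    [IsProbabilityMeasure μ] : ∃ X : Ω → Y, Measurable X ∧ P.map X = μ := by
  obtain ⟨U, hUm, hU⟩ := hP.exists_uniform
  obtain ⟨f, hf, hfμ⟩ := Measure.exists_measurable_map_eq μ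
  have hp : Measurable (Set.projIcc (0 : ℝ) 1 zero_le_one) := continuous_projIcc.measurable
  refine ⟨f ∘ Set.projIcc 0 1 zero_le_one ∘ U, hf.comp (hp.comp hUm), ?_⟩
  rw [← Measure.map_map hf (hp.comp hUm), ← Measure.map_map hp hUm, hU]
  have h := unitInterval.measurePreserving_coe.map_eq
  rw [show volume.restrict (Set.Icc (0 : ℝ) 1) = volume.restrict unitInterval from rfl, ← h,
    Measure.map_map hp measurable_subtype_coe]
  have : Set.projIcc (0 : ℝ) 1 zero_le_one ∘ ((↑) : unitInterval → ℝ) = id := by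
    ext x; simp
  rw [this, Measure.map_id, hfμ]

end Atomless

lemma MeanLaw.exists_marginals {n : ℕ} (hn : n ≠ 0) {ν G : Measure ℝ} (h : MeanLaw n ν G) :
    ∃ μ : Measure (Fin n → ℝ), (∀ i, μ.map (fun x => x i) = ν) ∧
      μ.map (fun x => (∑ i, x i) / (n : ℝ)) = G := by
  obtain ⟨μ, h1, h2⟩ := h
  have : NeZero n := ⟨hn⟩
  have hc : ((n : ℝ≥0∞))⁻¹ * n = 1 := ENNReal.inv_mul_cancel (by exact_mod_cast hn) (by simp)
  have hm : ∀ j : Fin n, Measurable fun (x : Fin n → ℝ) i => x (i + j) := fun j => by fun_prop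
  refine ⟨(n : ℝ≥0∞)⁻¹ • ∑ j : Fin n, μ.map fun x i => x (i + j), fun i => ?_, ?_⟩
  · rw [Measure.map_smul, map_finset_sum (measurable_pi_apply i)]
    simp only [Measure.map_map (measurable_pi_apply i) (hm _), Function.comp_def]
    have e : ∑ j, μ.map (fun x => x (i + j)) = ∑ j, μ.map fun x => x j :=
      Fintype.sum_equiv (Equiv.addLeft i) _ _ fun _ => rfl
    rw [e, h1, smul_smul, hc, one_smul]
  · have ha : Measurable fun x : Fin n → ℝ => (∑ i, x i) / (n : ℝ) := by fun_prop
    rw [Measure.map_smul, map_finset_sum ha]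
    have e : ∀ j : Fin n, (μ.map fun x i => x (i + j)).map (fun x => (∑ i, x i) / (n : ℝ)) = G := by
      intro j
      rw [Measure.map_map ha (hm j), ← h2]
      congr 1
      ext x
      exact congrArg (· / (n : ℝ)) (Fintype.sum_equiv (Equiv.addRight j) (fun i => x (i + j)) x
        fun _ => rfl)
    simp only [e, Finset.sum_const, Finset.card_univ, Fintype.card_fin]
    rw [← Nat.cast_smul_eq_nsmul ℝ≥0∞, smul_smul, hc, one_smul]

lemma hasExpectation_of_integrable {F : Measure ℝ} {φ : ℝ → ℝ} (h : Integrable φ F) :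
    HasExpectation F φ :=
  Or.inl h.lintegral_lt_top.ne

lemma expectation_of_integrable {F : Measure ℝ} {φ : ℝ → ℝ} (h : Integrable φ F) :
    expectation F φ = ((∫ x, φ x ∂F : ℝ) : EReal) := by
  rw [expectation, integral_eq_lintegral_pos_part_sub_lintegral_neg_part h, EReal.coe_sub,
    EReal.coe_ennreal_toReal h.lintegral_lt_top.ne, EReal.coe_ennreal_toReal 
    (show ∫⁻ x, ENNReal.ofReal (-φ x) ∂F ≠ ⊤ from h.neg.lintegral_lt_top.ne)]

lemma unif_zero_eq_map {x : ℝ} (hx : 0 < x) :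
    unif 0 x = (volume.restrict (Set.Icc 0 1)).map fun t => x * t := by
  have := map_affine_restrict hx 0 0 1
  simp only [add_zero, mul_zero, mul_one] at this
  rw [this, unif, ProbabilityTheory.cond, Real.volume_Icc, sub_zero, ENNReal.ofReal_inv_of_pos hx]

lemma unif_zero_one : unif 0 1 = volume.restrict (Set.Icc 0 1) := by
  rw [unif_zero_eq_map one_pos]
  simp

lemma sumUnifLaws_subset {Ω : Type*} [MeasurableSpace Ω] (P : Measure Ω) [IsProbabilityMeasure P]
    {n : ℕ} (hn : n ≠ 0) : sumUnifLaws P n ⊆ dominatedUnif (n : ℝ) := by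
  rintro G ⟨X, hX, hXl, rfl⟩
  have hn0 : (0 : ℝ) < n := by exact_mod_cast Nat.pos_of_ne_zero hn
  have hS : Measurable fun ω => ∑ i, X i ω := by fun_prop
  have hae : ∀ᵐ ω ∂P, ∀ i, X i ω ∈ Set.Icc (0 : ℝ) 1 := by
    refine ae_all_iff.2 fun i => ?_
    have : ∀ᵐ x ∂(P.map (X i)), x ∈ Set.Icc (0 : ℝ) 1 := by
      rw [hXl i, unif_zero_one]
      exact ae_restrict_mem measurableSet_Icc
    exact ae_of_ae_map (hX i).aemeasurable this
  have hSae : ∀ᵐ x ∂(P.map fun ω => ∑ i, X i ω), x ∈ Set.Icc (0 : ℝ) n := by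
    rw [ae_map_iff (p := fun x => x ∈ Set.Icc (0 : ℝ) n) hS.aemeasurable measurableSet_Icc]
    filter_upwards [hae] with ω h
    refine ⟨Finset.sum_nonneg fun i _ => (h i).1, ?_⟩
    simpa using Finset.sum_le_card_nsmul Finset.univ (fun i => X i ω) 1 fun i _ => (h i).2
  have hprob := Measure.isProbabilityMeasure_map (μ := P) hS.aemeasurable
  refine ⟨⟨hprob, Integrable.of_mem_Icc 0 n measurable_id.aemeasurable hSae⟩, ?_⟩
  intro φ hφ _ _
  have hc : Continuous φ := by
    have := hφ.continuousOn isOpen_univ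
    rwa [continuousOn_univ] at this
  have hbdd : ∀ (F : Measure ℝ) [IsProbabilityMeasure F], (∀ᵐ x ∂F, x ∈ Set.Icc (0 : ℝ) n) →
      Integrable φ F := by
    intro F _ hF
    obtain ⟨C, hC⟩ := isCompact_Icc.exists_bound_of_continuousOn hc.continuousOn (s := Set.Icc 0 (n : ℝ))
    exact Integrable.of_bound hc.aestronglyMeasurable C (hF.mono fun x hx => hC x hx)
  have hν : IsProbabilityMeasure (volume.restrict (Set.Icc (0 : ℝ) 1)) := ⟨by simp⟩
  have hm : Measurable fun t : ℝ => n * t := by fun_prop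
  have hprob' : IsProbabilityMeasure (unif 0 n) := by
    rw [unif_zero_eq_map hn0]
    exact Measure.isProbabilityMeasure_map hm.aemeasurable
  have hFae : ∀ᵐ x ∂(unif 0 n), x ∈ Set.Icc (0 : ℝ) n := by
    rw [unif_zero_eq_map hn0, 
      ae_map_iff (p := fun x => x ∈ Set.Icc (0 : ℝ) n) hm.aemeasurable measurableSet_Icc]
    filter_upwards [ae_restrict_mem measurableSet_Icc] with t ht
    exact ⟨mul_nonneg hn0.le ht.1, mul_le_of_le_one_right hn0.le ht.2⟩
  have hi := hbdd _ hSae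
  have hi' := hbdd _ hFae
  rw [expectation_of_integrable hi, expectation_of_integrable hi', EReal.coe_le_coe_iff,
    integral_map hS.aemeasurable hc.aestronglyMeasurable]
  have hXi : ∀ i, Integrable (fun ω => φ (n * X i ω)) P ∧
      ∫ ω, φ (n * X i ω) ∂P = ∫ x, φ x ∂(unif 0 n) := by
    intro i
    have e : P.map (fun ω => n * X i ω) = unif 0 n := by
      rw [unif_zero_eq_map hn0, ← unif_zero_one, ← show P.map (X i) = unif 0 1 from hXl i, Measure.map_map hm (hX i)]
      rfl
    have hm' : Measurable fun ω => (n : ℝ) * X i ω := (hX i).const_mul _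
    rw [← e] at hi' ⊢
    exact ⟨(integrable_map_measure hc.aestronglyMeasurable hm'.aemeasurable).1 hi',
      (integral_map hm'.aemeasurable hc.aestronglyMeasurable).symm⟩
  calc ∫ ω, φ (∑ i, X i ω) ∂P ≤ ∫ ω, ∑ i, (n : ℝ)⁻¹ * φ (n * X i ω) ∂P := by
        refine integral_mono ((integrable_map_measure hc.aestronglyMeasurable hS.aemeasurable).1 hi)
          (integrable_finsetSum _ fun i _ => (hXi i).1.const_mul _) fun ω => ?_
        have := hφ.map_sum_le (t := Finset.univ) (w := fun _ : Fin n => (n : ℝ)⁻¹)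
          (p := fun i => n * X i ω) (fun _ _ => by positivity) (by simp [hn0.ne'])
          fun _ _ => Set.mem_univ _
        simpa [hn0.ne', smul_eq_mul] using this
    _ = ∫ x, φ x ∂(unif 0 n) := by
        rw [integral_finsetSum _ fun i _ => (hXi i).1.const_mul _]
        simp only [integral_const_mul, (hXi _).2, Finset.sum_const, Finset.card_univ,
          Fintype.card_fin, nsmul_eq_mul]
        field_simp

lemma meanLaw_of_mem_dominatedUnif {n : ℕ} (hn : 3 ≤ n) {G : Measure ℝ}
    (hG : G ∈ dominatedUnif (n : ℝ)) :
    MeanLaw n (volume.restrict (Set.Icc 0 1)) (G.map fun x => x / n) := by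
  obtain ⟨⟨hprob, hi⟩, hle⟩ := hG
  have hn' : n ≠ 0 := by omega
  have hn0 : (0 : ℝ) < n := by exact_mod_cast Nat.pos_of_ne_zero hn'
  have hm : Measurable fun x : ℝ => x / n := by fun_prop
  have hmn : Measurable fun t : ℝ => n * t := by fun_prop
  have hprob' := Measure.isProbabilityMeasure_map (μ := G) hm.aemeasurable
  have key : ∀ ψ : ℝ → ℝ, ConvexOn ℝ Set.univ ψ → Continuous ψ →
      Integrable (fun x => ψ (x / n)) G → ∫ x, ψ (x / n) ∂G ≤ ∫ x in (0 : ℝ)..1, ψ x := by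
    intro ψ hψ hc hψi
    have hconv : ConvexOn ℝ Set.univ fun x : ℝ => ψ (x / n) := by
      have := hψ.comp_linearMap ((n : ℝ)⁻¹ • LinearMap.id)
      simpa [Function.comp_def, div_eq_inv_mul] using this
    have hc' : Continuous fun x : ℝ => ψ (x / n) := by fun_prop
    have e : ∀ t : ℝ, ψ (n * t / n) = ψ t := fun t => by rw [mul_div_cancel_left₀ _ hn0.ne']
    have hui : Integrable (fun x => ψ (x / n)) (unif 0 n) := by
      rw [unif_zero_eq_map hn0, integrable_map_measure hc'.aestronglyMeasurable hmn.aemeasurable]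
      exact ContinuousOn.integrableOn_compact isCompact_Icc (by fun_prop)
    have h := hle _ hconv (hasExpectation_of_integrable hψi) (hasExpectation_of_integrable hui)
    rw [expectation_of_integrable hψi, expectation_of_integrable hui, EReal.coe_le_coe_iff] at h
    refine h.trans_eq ?_
    rw [unif_zero_eq_map hn0, integral_map hmn.aemeasurable hc'.aestronglyMeasurable]
    simp only [e]
    rw [integral_Icc_eq_integral_Ioc, ← intervalIntegral.integral_of_le zero_le_one]
  have hdiv : Integrable (fun x : ℝ => x / n) G := hi.div_const _
  have hmean : ∫ x, x ∂(G.map fun x => x / (n : ℝ)) = 1 / 2 := by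
    rw [integral_map hm.aemeasurable (by fun_prop)]
    have h1 := key (fun x => x) (convexOn_id convex_univ) continuous_id hdiv
    have h2 := key (fun x => -x) (concaveOn_id convex_univ).neg continuous_neg hdiv.neg
    rw [integral_neg, intervalIntegral.integral_neg] at h2
    rw [integral_id] at h1 h2
    norm_num at h1 h2 ⊢
    linarith
  have hloss : ∀ k, ∫ x, max (x - k) 0 ∂(G.map fun x => x / (n : ℝ)) ≤ stopLoss 0 1 k := by
    intro k
    rw [integral_map hm.aemeasurable (by fun_prop), ← integral_max_sub_eq_stopLoss]
    exact key (fun x => max (x - k) 0) (convexOn_max_sub k) (by fun_prop)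
      (hdiv.sub (integrable_const k)).pos_part
  have hint : Integrable (fun x : ℝ => x) (G.map fun x => x / n) :=
    (integrable_map_measure (by fun_prop) hm.aemeasurable).2 hdiv
  exact meanLaw_of_stopLoss hn' (twoPoint hn) (ae_mem_Icc_of_stopLoss hint hmean hloss) hmean hloss

end UniformSums

theorem theorem4 {Ω : Type*} [MeasurableSpace Ω] (P : MeasureTheory.Measure Ω)
    [MeasureTheory.IsProbabilityMeasure P] (hP : UniformSums.Atomless P) (n : ℕ) (hn : 3 ≤ n) :
    UniformSums.sumUnifLaws P n = UniformSums.dominatedUnif (n : ℝ) := by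
  have hn' : n ≠ 0 := by omega
  have hn0 : (n : ℝ) ≠ 0 := by exact_mod_cast hn'
  refine (UniformSums.sumUnifLaws_subset P hn').antisymm fun G hG => ?_
  obtain ⟨μ, hμ, hμG⟩ := (UniformSums.meanLaw_of_mem_dominatedUnif hn hG).exists_marginals hn'
  have : IsProbabilityMeasure μ := by
    have h := congrArg (fun m : Measure ℝ => m Set.univ) (hμ ⟨0, by omega⟩)
    simp only [Measure.map_apply (measurable_pi_apply _) MeasurableSet.univ, Set.preimage_univ,
      Measure.restrict_apply_univ, Real.volume_Icc, sub_zero, ENNReal.ofReal_one] at h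
    exact ⟨h⟩
  obtain ⟨X, hX, hXμ⟩ := hP.exists_map_eq μ
  refine ⟨fun i ω => X ω i, fun i => (measurable_pi_apply i).comp hX, fun i => ?_, ?_⟩
  · rw [UniformSums.unif_zero_one, ← hμ i, ← hXμ, Measure.map_map (measurable_pi_apply i) hX]
    rfl
  · have hs : Measurable fun x : Fin n → ℝ => ∑ i, x i := by fun_prop
    have h := congrArg (Measure.map fun x => x * (n : ℝ)) hμG
    rw [Measure.map_map (by fun_prop) (by fun_prop), Measure.map_map (by fun_prop) (by fun_prop)]
      at h
    simp only [Function.comp_def, div_mul_cancel₀ _ hn0, Measure.map_id'] at h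
    rw [← h, ← hXμ, Measure.map_map hs hX]
    rfl
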